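/- **Setting.** Let $L$ be meromorphic in $\mathbb C$ with at most one pole, at $x=1$, of order $q\in\{0,1\}$ ($q=0$: no pole and $L(1)\ne 0$), nonvanishing in $\{\mathrm{Re}\,x>1\}$, with $(\log L)^{(n)}(x)=O(x^{-\infty})$ as $x\to+\infty$ for every $n\ge 0$. Suppose $(x-1)^qL(x)=\mathbf G(x)\,\Xi(x)$, where $\mathbf G$ and $\Xi$ are entire functions of order $1$, $\Xi(x)=\Xi(1-x)$, all zeros $x_k$ of $\mathbf G$ satisfy $\mathrm{Re}\,x_k\le 0$, and all zeros of $\Xi$ are non-real and lie in $\{0<\mathrm{Re}\,x<1\}$; counted with multiplicity, they are $\{\frac12\pm \mathrm i\tau_k\}_{k=1,2,\dots}$ with $\mathrm{Re}\,\tau_k>0$ non-decreasing. Suppose that, as $x\to+\infty$, $$-\log\mathbf G(x)\sim \tilde a_1x(\log x-1)+b_1x+\tilde a_0\log x+b_0+\sum_{n\ge1}a_{-n}x^{-n},$$ indefinitely differentiable term by term (all coefficients may be complex). Let $\mathbf Z(s,\tfrac12)=\sum_k(\frac12-x_k)^{-s}$ (over the zeros of $\mathbf G$ with multiplicity, $\mathrm{Re}\,s>1$),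 and for every $v\in\mathbb C$ with $\tau_k^2+v\notin(-\infty,0]$ for all $k$, let $\mathcal Z(\sigma,v)=\sum_{k\ge1}(\tau_k^2+v)^{-\sigma}$ ($\mathrm{Re}\,\sigma>\frac12$). All powers are principal. Write $\mathcal Z(\sigma)=\mathcal Z(\sigma,0)$. **Claim.** These series converge absolutely in the stated half-planes, and the following hold. 0. $\mathbf Z(s,\frac12)$ continues meromorphically to $\mathbb C$; it is regular except at $s=1$, where its polar part is $\tilde a_1/(s-1)$, and for every integer $n\ge0$, with $x=\frac12$, $$\mathbf Z(-n,x)=-\frac{\tilde a_1}{n+1}x^{n+1}-\tilde a_0x^n+n\sum_{j=1}^n(-1)^j\binom{n-1}{j-1}a_{-j}x^{n-j}.$$ 1. For every such $v$, $\mathcal Z(\sigma,v)$ continues meromorphically in $\sigma$ to $\mathbb C$ and is regular except at the points $\frac12-m$, $m=0,1,2,\dots$ 2. If $|v|<\min_k|\tau_k|^2$ and $\tau_k^2+tv\notin(-\infty,0]$ for all $k$ and all $t\in[0,1]$, then $\mathcal Z(\sigma,v)=\sum_k(\tau_k^2)^{-\sigma}(1+v/\tau_k^2)^{-\sigma}$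 for $\mathrm{Re}\,\sigma>\frac12$, and for all $\sigma\notin\{\frac12-m:m\ge0\}$ $$\mathcal Z(\sigma,v)=\sum_{\ell=0}^\infty\frac{\Gamma(1-\sigma)}{\ell!\,\Gamma(1-\sigma-\ell)}\,\mathcal Z(\sigma+\ell)\,v^\ell,$$ where the Gamma quotient is the generalized binomial coefficient $\binom{-\sigma}{\ell}$ (its continuous extension at $\sigma=1,2,\dots$). 3. For every admissible $v$ and every integer $m\ge0$, as $\varepsilon\to0$, $$\mathcal Z(\tfrac12-m+\varepsilon,v)=\frac{\tilde a_1}{4\pi}\frac{\Gamma(m+\frac12)}{m!\,\Gamma(\frac12)}v^m\varepsilon^{-2}+\mathcal R_m(v)\,\varepsilon^{-1}+O(1),$$ $$\mathcal R_m(v)=-\frac{\Gamma(m+\frac12)}{m!\,\Gamma(\frac12)}\Bigl[\frac{\tilde a_1}{2\pi}\sum_{j=1}^m\frac1{2j-1}-\frac{b_1}{2\pi}\Bigr]v^m+\sum_{j=1}^m\frac{\Gamma(\frac12+m)}{(m-j)!\,\Gamma(\frac12+j)}\,\mathcal R_j\,v^{m-j},$$ $$\mathcal R_j=\frac{(-1)^j}{2\pi}\bigl[\mathbf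 Z(1-2j,\tfrac12)+q\,2^{1-2j}\bigr]\qquad(j\ge 1).$$ In particular the pole at $\frac12-m$ is exactly double whenever $\tilde a_1\ne0$ and ($m=0$ or $v\ne0$). 4. For every admissible $v$ and every integer $m\ge0$, $$\mathcal Z(-m,v)=\sum_{\ell=0}^m\binom m\ell\,\mathcal Z(-m+\ell)\,v^\ell=\frac12\Bigl[-\sum_{j=0}^m\binom mj(-1)^j\,\mathbf Z(-2j,\tfrac12)\,v^{m-j}+q\,(v-\tfrac14)^m\Bigr];$$ in particular $\mathcal Z(0,v)=\frac12[-\mathbf Z(0,\frac12)+q]=\frac12(\frac12\tilde a_1+\tilde a_0+q)$, independent of $v$. -/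

import Mathlib

open Complex Filter Topology Asymptotics Finset

noncomputable section

/-- The growth order of an entire function `f` is `μ`:
`μ` is the infimum of the exponents `r > 0` with `f z = O (exp (|z| ^ r))` as `|z| → ∞`. -/
def HasGrowthOrder (f : ℂ → ℂ) (μ : ℝ) : Prop :=
  IsGLB {r : ℝ | 0 < r ∧ f =O[cocompact ℂ] fun z : ℂ => Real.exp (‖z‖ ^ r)} μ

/-- A primary function `L`, with its explicit (trivial) factor `G` and its completed function `Ξ`.
The number `q`, equal to `0` or `1`, is the order of the pole of `L` at `1`. -/
structure IsPrimary (L G Ξ : ℂ → ℂ) (q : ℕ) : Prop where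
  q_le_one : q ≤ 1
  /-- `L` is meromorphic in the plane, and regular outside `x = 1`. -/
  analytic_off_one : ∀ x : ℂ, x ≠ 1 → AnalyticAt ℂ L x
  meromorphicAt_one : MeromorphicAt L 1
  order_at_one : meromorphicOrderAt L 1 = ((-(q : ℤ) : ℤ) : WithTop ℤ)
  /-- `L` does not vanish in the half-plane `Re x > 1`. -/
  ne_zero : ∀ x : ℂ, 1 < x.re → L x ≠ 0
  /-- `log L` (a holomorphic branch in `Re x > 1`) and all its derivatives
  are `O (x ^ (-∞))` for real `x → +∞`. -/
  log_decay : ∃ logL : ℂ → ℂ, (∀ x : ℂ, 1 < x.re → AnalyticAt ℂ logL x ∧ exp (logL x) = L x) ∧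
    ∀ n N : ℕ, (fun x : ℝ => iteratedDeriv n logL (x : ℂ)) =O[atTop] fun x : ℝ => (x ^ N)⁻¹
  /-- `G` and `Ξ` are entire functions of order `1`. -/
  entire_G : Differentiable ℂ G
  order_G : HasGrowthOrder G 1
  entire_Xi : Differentiable ℂ Ξ
  order_Xi : HasGrowthOrder Ξ 1
  /-- `Ξ x = (x - 1) ^ q * L x / G x`. -/
  factorization : ∀ x : ℂ, x ≠ 1 → G x * Ξ x = (x - 1) ^ q * L x
  functional_equation : ∀ x : ℂ, Ξ x = Ξ (1 - x)
  /-- The trivial zeros. -/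
  zeros_G : ∀ x : ℂ, G x = 0 → x.re ≤ 0
  /-- The nontrivial zeros: they lie in the critical strip, and none is real. -/
  zeros_Xi : ∀ x : ℂ, Ξ x = 0 → 0 < x.re ∧ x.re < 1 ∧ x.im ≠ 0

/-- The zeros of `Ξ`, counted with multiplicities, are the numbers `1/2 ± i τ k`, `k = 0, 1, …`,
with `Re (τ k)` positive and non-decreasing. -/
structure IsZeroSequence (Ξ : ℂ → ℂ) (τ : ℕ → ℂ) : Prop where
  re_pos : ∀ k, 0 < (τ k).re
  re_mono : Monotone fun k => (τ k).re
  multiplicity : ∀ ρ : ℂ, analyticOrderAt Ξ ρ =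
    {k : ℕ | 1 / 2 + I * τ k = ρ}.encard + {k : ℕ | 1 / 2 - I * τ k = ρ}.encard

/-- Truncated Stirling series
`a₁ x (log x - 1) + b₁ x + a₀ log x + b₀ + ∑_{n = 1}^N a_{-n} x ^ (-n)`;
here `a n` stands for the coefficient `a_{-n}`. -/
def stirlingSum (a₁ b₁ a₀ b₀ : ℂ) (a : ℕ → ℂ) (N : ℕ) (x : ℂ) : ℂ :=
  a₁ * x * (log x - 1) + b₁ * x + a₀ * log x + b₀ + ∑ n ∈ Icc 1 N, a n / x ^ n

/-- `-log G` (a holomorphic branch in `Re x > 0`) has, for real `x → +∞`, the complete asymptotic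
expansion `a₁ x (log x - 1) + b₁ x + a₀ log x + b₀ + ∑_{n ≥ 1} a_{-n} x ^ (-n)`,
which can be differentiated term by term any number `p` of times. -/
def HasStirlingExpansion (G : ℂ → ℂ) (a₁ b₁ a₀ b₀ : ℂ) (a : ℕ → ℂ) : Prop :=
  ∃ logG : ℂ → ℂ, (∀ x : ℂ, 0 < x.re → AnalyticAt ℂ logG x ∧ exp (logG x) = G x) ∧
    ∀ N p : ℕ,
      (fun x : ℝ => iteratedDeriv p (fun z => -logG z - stirlingSum a₁ b₁ a₀ b₀ a N z) (x : ℂ))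
        =O[atTop] fun x : ℝ => (x ^ (N + 1 + p))⁻¹

/-- `Z` is the meromorphic continuation in `s` of the zeta function over the trivial zeros,
`∑ (x - x_k) ^ (-s)` for `Re s > 1`, with `x_k` the zeros of `G` counted with multiplicities
(points where `G` does not vanish contribute `0`); it is regular outside `s = 1`. -/
def IsShadowZeta (G : ℂ → ℂ) (x : ℂ) (Z : ℂ → ℂ) : Prop :=
  (∀ s : ℂ, 1 < s.re →
    HasSum (fun ξ : ℂ => (analyticOrderNatAt G ξ : ℂ) * (x - ξ) ^ (-s)) (Z s)) ∧
  Meromorphic Z ∧ ∀ s : ℂ, s ≠ 1 → AnalyticAt ℂ Z s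

/-- `Z` is the meromorphic continuation in `σ` of
`∑_k (τ_k ^ 2 + v) ^ (-σ)`, `Re σ > 1/2` (principal powers);
it is regular outside the points `1/2 - m`, `m = 0, 1, 2, …`. -/
def IsSecondZeta (τ : ℕ → ℂ) (v : ℂ) (Z : ℂ → ℂ) : Prop :=
  (∀ σ : ℂ, 1 / 2 < σ.re → HasSum (fun k : ℕ => (τ k ^ 2 + v) ^ (-σ)) (Z σ)) ∧
  Meromorphic Z ∧ ∀ σ : ℂ, (∀ m : ℕ, σ ≠ 1 / 2 - m) → AnalyticAt ℂ Z σ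

/-- The explicit polynomial
`-a₁ x^(n+1) / (n+1) - a₀ x^n + n ∑_{j=1}^n (-1)^j C(n-1, j-1) a_{-j} x^(n-j)`. -/
def tracePoly (a₁ a₀ : ℂ) (a : ℕ → ℂ) (n : ℕ) (x : ℂ) : ℂ :=
  -(a₁ / (n + 1)) * x ^ (n + 1) - a₀ * x ^ n +
    n * ∑ j ∈ Icc 1 n, (-1) ^ j * ((n - 1).choose (j - 1) : ℂ) * a j * x ^ (n - j)

/-- `ℛ_j = (-1)^j / (2π) * (𝐙(1 - 2j, 1/2) + q 2^(1 - 2j))`,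
where `Zt s` stands for `𝐙(s, 1/2)`. -/
def basicResidue (q : ℕ) (Zt : ℂ → ℂ) (j : ℕ) : ℂ :=
  (-1) ^ j / (2 * Real.pi) * (Zt (1 - 2 * j) + q * (2 : ℂ) ^ (1 - 2 * (j : ℤ)))

/-- The residue polynomial `ℛ_m(v)`. -/
def residuePoly (a₁ b₁ : ℂ) (q : ℕ) (Zt : ℂ → ℂ) (m : ℕ) (v : ℂ) : ℂ :=
  -(Gamma (m + 1 / 2) / (m.factorial * Gamma (1 / 2))) *
      (a₁ / (2 * Real.pi) * ∑ j ∈ Icc 1 m, 1 / (2 * (j : ℂ) - 1) - b₁ / (2 * Real.pi)) * v ^ m +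
    ∑ j ∈ Icc 1 m, Gamma (1 / 2 + m) / ((m - j).factorial * Gamma (1 / 2 + j)) *
      basicResidue q Zt j * v ^ (m - j)

/-- The generalized binomial coefficient `C(-σ, ℓ)` is `Γ(1 - σ) / (ℓ! Γ(1 - σ - ℓ))`
(by continuity at `σ = 1, 2, …`). -/
theorem choose_neg_eq_gamma (σ : ℂ) (hσ : ∀ n : ℕ, σ ≠ n + 1) (l : ℕ) :
    Ring.choose (-σ) l = Gamma (1 - σ) / (l.factorial * Gamma (1 - σ - l)) := by
  have key : ∀ l : ℕ, (descPochhammer ℂ l).eval (-σ) = Gamma (1 - σ) / Gamma (1 - σ - l) := by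
    intro l
    induction l with
    | zero =>
      have h : Gamma (1 - σ) ≠ 0 := by
        refine Gamma_ne_zero fun n hn => hσ n ?_
        linear_combination -hn
      simp [div_self h]
    | succ l ih =>
      rw [descPochhammer_succ_eval, ih]
      by_cases h0 : -σ - l = 0
      · have h1 : (1 : ℂ) - σ - ((l + 1 : ℕ) : ℂ) = 0 := by push_cast; linear_combination h0
        rw [h0, h1, Gamma_zero]; simp
      · have h1 : (1 : ℂ) - σ - l = (-σ - l) + 1 := by ring
        have h2 : (1 : ℂ) - σ - ((l + 1 : ℕ) : ℂ) = -σ - l := by push_cast; ring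
        rw [h1, h2, Gamma_add_one _ h0]
        field_simp
  have hf : (l.factorial : ℂ) ≠ 0 := by exact_mod_cast l.factorial_ne_zero
  have h := Ring.descPochhammer_eq_factorial_smul_choose (-σ) l
  rw [← Polynomial.aeval_eq_smeval, Polynomial.aeval_def, ← Polynomial.eval_map,
    descPochhammer_map, key l, nsmul_eq_mul] at h
  have h2 : Ring.choose (-σ) l = (l.factorial : ℂ)⁻¹ * (Gamma (1 - σ) / Gamma (1 - σ - l)) := by
    rw [h, inv_mul_cancel_left₀ hf]
  rw [h2, div_mul_eq_div_div, div_eq_mul_inv, div_eq_mul_inv, div_eq_mul_inv]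
  ring

end

/-! Both zeta functions are Mellin transforms. For `z` off the negative axis, the integral of
`y^(S-1) / (z + y)` over `y > 0` is `z^(S-1) π / sin (πS)`, and differentiating in `z` gives the
analogue for `(z + y)^(-2)`. Summing over `z = 1/2 - x_k` expresses `𝐙(s, 1/2)` through `∑ (1/2 -
x_k + y)^(-2)`; summing over `z = τ_k^2` and replacing `y` by `y^2` expresses `𝒵(σ, 0)` through `∑
(τ_k^2 + y^2)⁻¹`.

Since `G` and `Ξ` have order less than 2, these sums are known: the first is `-(log G)''(1/2 + y)`
by `IsZeroFamily.hasSum_one_div_sub_sq`, the second is `(2y)⁻¹ (Ξ'/Ξ)(1/2 + y)` by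
`IsZeroFamily.hasSum_logDeriv` and the evenness of `Ξ` about `1/2`
(`IsZeroSequence.hasSum_inv_sq_add`). The factorization gives `Ξ'/Ξ = q/(x-1) + (log L)' - (log
G)'`, where `(log L)'` is negligible at infinity, so the Stirling expansion yields complete
expansions in inverse powers of `y`, with one term in `log y / y` for the second sum.

By `exists_mellin_continuation` such an expansion continues the Mellin transform: each coefficient
becomes a residue at an integer, and `log y / y` a double pole. Multiplying back by the sine, its
zeros cancel the poles at `s = -n` and turn coefficients into special values, while at `1/2 - m` the
sine is `±1` and the poles survive (`exists_zeta_of_inv_sq`, `exists_zeta_of_inv`).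

For the shift, `(z + v)^(-σ)` is expanded binomially to order `N`: the terms sum to multiples of
`𝒵(σ + ℓ)`, and the remainders sum to a function analytic for `Re σ > 1/2 - N` (`shiftZeta`). Polar
parts at `1/2 - m` thus come from finitely many terms, the double pole bringing in a derivative of a
binomial coefficient (`hasPolarPart_shiftZeta`). At `σ = -m` the binomial formula is exact and the
remainders vanish (`shiftZeta_neg_natCast`). For small `v`, the whole double series converges
absolutely (`hasSum_shiftZeta_pow`). -/

noncomputable section

/-! ### Zeros of entire functions of finite order: counting, summability, partial fractions. -/

/-- The family `ρ` lists the zeros of `f` with multiplicities. -/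
def IsZeroFamily {ι : Type*} (f : ℂ → ℂ) (ρ : ι → ℂ) : Prop :=
  ∀ z : ℂ, analyticOrderAt f z = {i | ρ i = z}.encard

namespace IsZeroFamily

variable {ι : Type*} {f : ℂ → ℂ} {ρ : ι → ℂ}

theorem ne_zero (h : IsZeroFamily f ρ) (hf : Differentiable ℂ f) {z : ℂ} (hz : f z ≠ 0) (i : ι) :
    ρ i ≠ z := by
  intro hi
  have h1 : analyticOrderAt f z = 0 := (hf.analyticAt z).analyticOrderAt_eq_zero.2 hz
  rw [h z, Set.encard_eq_zero] at h1
  exact (Set.eq_empty_iff_forall_notMem.1 h1 i) hi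

/-- Zeros are divided out one at a time by `dslope`. Factors are normalized to be 1 at the origin,
so `f 0` is unchanged, and the order of the quotient tracks the indices not yet used, which allows
repeated zeros. -/
theorem exists_factor (h : IsZeroFamily f ρ) (hf : Differentiable ℂ f) (h0 : f 0 ≠ 0)
    (s : Finset ι) : ∃ g : ℂ → ℂ, Differentiable ℂ g ∧
      (∀ z, f z = (∏ i ∈ s, (1 - z / ρ i)) * g z) ∧
      ∀ z, analyticOrderAt g z = {i | i ∉ s ∧ ρ i = z}.encard := by
  classical
  induction s using Finset.induction_on with
  | empty => exact ⟨f, hf, by simp, fun z => by simpa using h z⟩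
  | insert j s hj ih =>
    obtain ⟨g, hg, hfg, hord⟩ := ih
    have hρ : ρ j ≠ 0 := h.ne_zero hf h0 j
    have hgj : g (ρ j) = 0 := by
      rw [← (hg.analyticAt (ρ j)).analyticOrderAt_ne_zero, hord, Set.encard_ne_zero]
      exact ⟨j, hj, rfl⟩
    have hd : Differentiable ℂ (dslope g (ρ j)) := by
      rw [← differentiableOn_univ]
      exact (Complex.differentiableOn_dslope (by simp)).2 hg.differentiableOn
    -- The constant `-ρ j` converts the factor `z - ρ j` into `1 - z / ρ j`.
    set k : ℂ → ℂ := fun z => -ρ j * dslope g (ρ j) z with hk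
    have hkd : Differentiable ℂ k := hd.const_mul _
    have hgk : ∀ z, g z = (1 - z / ρ j) * k z := by
      intro z
      have h1 := sub_smul_dslope g (ρ j) z
      rw [hgj, sub_zero, smul_eq_mul] at h1
      rw [← h1, hk]
      field_simp
      ring
    refine ⟨k, hkd, fun z => ?_, fun z => ?_⟩
    · rw [hfg, Finset.prod_insert hj, hgk z]
      ring
    · have hlin : Differentiable ℂ (fun z : ℂ => 1 - z / ρ j) := by fun_prop
      have h2 : analyticOrderAt g z =
          analyticOrderAt (fun z : ℂ => 1 - z / ρ j) z + analyticOrderAt k z := by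
        rw [← analyticOrderAt_mul (hlin.analyticAt z) (hkd.analyticAt z)]
        congr 1
        funext w
        exact hgk w
      by_cases hz : ρ j = z
      · have h3 : analyticOrderAt (fun z : ℂ => 1 - z / ρ j) z = 1 := by
          refine (hlin.analyticAt z).analyticOrderAt_eq_one_of_zero_deriv_ne_zero ?_ ?_
          · rw [← hz]; field_simp; simp
          · simp [hρ]
        have h4 : {i | i ∉ s ∧ ρ i = z} = insert j {i | i ∉ insert j s ∧ ρ i = z} := by
          ext i
          by_cases hij : i = j
          · subst hij; simp [hj, hz]
          · simp [hij]
        rw [hord, h3, h4, Set.encard_insert_of_notMem (by simp), add_comm] at h2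
        exact (ENat.add_right_injective_of_ne_top ENat.one_ne_top h2).symm
      · have h3 : analyticOrderAt (fun z : ℂ => 1 - z / ρ j) z = 0 := by
          refine (hlin.analyticAt z).analyticOrderAt_eq_zero.2 ?_
          intro h5
          apply hz
          field_simp at h5
          linear_combination h5
        have h4 : {i | i ∉ s ∧ ρ i = z} = {i | i ∉ insert j s ∧ ρ i = z} := by
          ext i
          by_cases hij : i = j
          · subst hij; simp [hj, hz]
          · simp [hij]
        rw [h3, zero_add, hord, h4] at h2
        exact h2.symm

/-- The number of zeros in a disk is controlled by the maximum modulus. -/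
theorem exp_card_le (h : IsZeroFamily f ρ) (hf : Differentiable ℂ f) (h0 : f 0 ≠ 0)
    (s : Finset ι) {R B : ℝ} (hR : 0 < R) (hs : ∀ i ∈ s, ‖ρ i‖ ≤ R)
    (hB : ∀ z : ℂ, ‖z‖ = 4 * R → ‖f z‖ ≤ B) : Real.exp (s.card) * ‖f 0‖ ≤ B := by
  obtain ⟨g, hg, hfg, -⟩ := h.exists_factor hf h0 s
  have hg0 : g 0 = f 0 := by rw [hfg]; simp
  -- On the circle of radius `4R` each factor has modulus at least `4 - 1 = 3 > e`, so dividing them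
  -- out gains `e` per zero; the maximum principle carries the bound to the origin.
  have hbd : ∀ z ∈ frontier (Metric.ball (0 : ℂ) (4 * R)), ‖g z‖ ≤ B / Real.exp s.card := by
    intro z hz
    rw [frontier_ball _ (by positivity), mem_sphere_zero_iff_norm] at hz
    rw [le_div_iff₀ (Real.exp_pos _)]
    refine le_trans ?_ (hB z hz)
    rw [hfg, norm_mul, mul_comm]
    gcongr
    rw [norm_prod, ← mul_one (s.card : ℝ), Real.exp_nat_mul, ← Finset.prod_const]
    refine Finset.prod_le_prod (fun i _ => (Real.exp_pos 1).le) fun i hi => ?_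
    have h1 : (0 : ℝ) < ‖ρ i‖ := norm_pos_iff.2 (h.ne_zero hf h0 i)
    have h2 : 4 ≤ ‖z / ρ i‖ := by
      rw [norm_div, le_div_iff₀ h1, hz]
      linarith [hs i hi]
    have h3 := norm_sub_norm_le (z / ρ i) 1
    rw [norm_sub_rev, norm_one] at h3
    linarith [Real.exp_one_lt_d9]
  have h1 := Complex.norm_le_of_forall_mem_frontier_norm_le Metric.isBounded_ball
    hg.diffContOnCl hbd (z := 0) (subset_closure (by simp [hR]))
  rw [hg0, le_div_iff₀ (Real.exp_pos _)] at h1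
  linarith

end IsZeroFamily

/-- An explicit bound for a function of finite growth order. -/
theorem exists_growth_bound {f : ℂ → ℂ} {r : ℝ} (hr : 0 < r)
    (h : f =O[cocompact ℂ] fun z : ℂ => Real.exp (‖z‖ ^ r)) :
    ∃ A R₀ : ℝ, 0 < A ∧ 1 ≤ R₀ ∧ ∀ z : ℂ, R₀ ≤ ‖z‖ → ‖f z‖ ≤ Real.exp (A * ‖z‖ ^ r) := by
  obtain ⟨C, hC, hb⟩ := h.exists_pos
  have h1 := hb.bound
  rw [← Metric.cobounded_eq_cocompact, ← comap_norm_atTop, eventually_comap] at h1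
  obtain ⟨R, hR⟩ := eventually_atTop.1 h1
  -- Since `‖z‖ ^ r ≥ 1`, the multiplicative constant `C` can be absorbed into the exponent.
  refine ⟨|Real.log C| + 1, max R 1, by positivity, le_max_right _ _, fun z hz => ?_⟩
  refine (hR ‖z‖ ((le_max_left _ _).trans hz) z rfl).trans ?_
  have hz1 : 1 ≤ ‖z‖ ^ r := Real.one_le_rpow ((le_max_right _ _).trans hz) hr.le
  rw [Real.norm_eq_abs, Real.abs_exp, ← Real.exp_log hC, ← Real.exp_add, Real.exp_le_exp,
    Real.exp_log hC]
  nlinarith [le_abs_self (Real.log C), abs_nonneg (Real.log C)]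

namespace IsZeroFamily

variable {ι : Type*} {f : ℂ → ℂ} {ρ : ι → ℂ}

theorem exists_card_le (h : IsZeroFamily f ρ) (hf : Differentiable ℂ f) (h0 : f 0 ≠ 0)
    {r : ℝ} (hr : 0 < r) (hg : f =O[cocompact ℂ] fun z : ℂ => Real.exp (‖z‖ ^ r)) :
    ∃ C R₀ : ℝ, 0 < C ∧ 1 ≤ R₀ ∧ ∀ (R : ℝ), R₀ ≤ R → ∀ s : Finset ι, (∀ i ∈ s, ‖ρ i‖ ≤ R) →
      (s.card : ℝ) ≤ C * R ^ r := by
  obtain ⟨A, R₀, hA, hR₀, hb⟩ := exists_growth_bound hr hg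
  refine ⟨A * 4 ^ r + |Real.log ‖f 0‖|, R₀, by positivity, hR₀, fun R hR s hs => ?_⟩
  have hR1 : 1 ≤ R := hR₀.trans hR
  have hRp : 0 < R := by linarith
  have h1 := h.exp_card_le hf h0 s hRp hs (B := Real.exp (A * (4 * R) ^ r)) (fun z hz => by
    rw [← hz]; exact hb z (by rw [hz]; linarith))
  have hp : 0 < ‖f 0‖ := norm_pos_iff.2 h0
  rw [← Real.exp_log hp, ← Real.exp_add, Real.exp_le_exp,
    Real.mul_rpow (by norm_num) hRp.le] at h1
  have h2 : 1 ≤ R ^ r := Real.one_le_rpow hR1 hr.le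
  nlinarith [neg_abs_le (Real.log ‖f 0‖), abs_nonneg (Real.log ‖f 0‖)]

theorem finite_norm_le (h : IsZeroFamily f ρ) (hf : Differentiable ℂ f) (h0 : f 0 ≠ 0)
    {r : ℝ} (hr : 0 < r) (hg : f =O[cocompact ℂ] fun z : ℂ => Real.exp (‖z‖ ^ r)) (R : ℝ) :
    {i | ‖ρ i‖ ≤ R}.Finite := by
  obtain ⟨C, R₀, hC, hR₀, hb⟩ := h.exists_card_le hf h0 hr hg
  by_contra hinf
  obtain ⟨s, hs, hcard⟩ := (Set.Infinite.exists_subset_card_eq hinf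
    (⌊C * (max R R₀) ^ r⌋₊ + 1))
  have h1 := hb (max R R₀) (le_max_right _ _) s fun i hi => (hs hi).trans (le_max_left _ _)
  rw [hcard] at h1
  have h2 := Nat.lt_floor_add_one (C * (max R R₀) ^ r)
  push_cast at h1
  linarith

/-- Zeros are grouped in dyadic shells of outer radius `R₀ 2^m`. Each shell has at most a multiple
of `2^(rm)` zeros, each contributing about `2^(-sm)`, hence a geometric series of ratio `2^(r-s) <
1`. -/
theorem summable_rpow (h : IsZeroFamily f ρ) (hf : Differentiable ℂ f) (h0 : f 0 ≠ 0)
    {r s : ℝ} (hr : 0 < r) (hrs : r < s)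
    (hg : f =O[cocompact ℂ] fun z : ℂ => Real.exp (‖z‖ ^ r)) :
    Summable fun i => ‖ρ i‖ ^ (-s) := by
  obtain ⟨C, R₀, hC, hR₀, hb⟩ := h.exists_card_le hf h0 hr hg
  have hR0 : 0 < R₀ := by linarith
  have hs : 0 < s := hr.trans hrs
  have hpos : ∀ i, 0 < ‖ρ i‖ := fun i => norm_pos_iff.2 (h.ne_zero hf h0 i)
  obtain ⟨K, hK0, hK⟩ : ∃ K : ℝ, 0 < K ∧ ∀ i, ‖ρ i‖ ≤ R₀ → ‖ρ i‖ ^ (-s) ≤ K := by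
    have hfin := h.finite_norm_le hf h0 hr hg R₀
    obtain ⟨K, hK⟩ := (hfin.image fun i => ‖ρ i‖ ^ (-s)).bddAbove
    exact ⟨max K 1, by positivity, fun i hi => (hK ⟨i, hi, rfl⟩).trans (le_max_left _ _)⟩
  -- `K` serves the finitely many zeros in the core disk; `2^s R₀^(-s)` pays for labelling a shell
  -- by its outer radius, `n + 1` instead of `n`.
  set K' : ℝ := max K (2 ^ s * R₀ ^ (-s)) with hK'
  have hK'0 : 0 < K' := lt_max_of_lt_left hK0
  have hex : ∀ i, ∃ m : ℕ, ‖ρ i‖ ≤ R₀ * 2 ^ m ∧ ‖ρ i‖ ^ (-s) ≤ K' * ((2 : ℝ) ^ (-s)) ^ m := by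
    intro i
    by_cases hi : ‖ρ i‖ ≤ R₀
    · exact ⟨0, by simpa using hi, by rw [pow_zero, mul_one]; exact (hK i hi).trans (le_max_left _ _)⟩
    · push Not at hi
      obtain ⟨n, hn1, hn2⟩ := exists_nat_pow_near (x := ‖ρ i‖ / R₀) (y := (2 : ℝ))
        ((one_le_div hR0).2 hi.le) (by norm_num)
      refine ⟨n + 1, ?_, ?_⟩
      · rw [div_lt_iff₀ hR0] at hn2; linarith
      · rw [le_div_iff₀ hR0] at hn1
        calc ‖ρ i‖ ^ (-s) ≤ (2 ^ n * R₀) ^ (-s) :=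
              Real.rpow_le_rpow_of_nonpos (by positivity) hn1 (by linarith)
          _ = (2 ^ s * R₀ ^ (-s)) * ((2 : ℝ) ^ (-s)) ^ (n + 1) := by
              rw [Real.mul_rpow (by positivity) hR0.le, ← Real.rpow_natCast, ← Real.rpow_mul
                (by norm_num), pow_succ, ← Real.rpow_natCast, ← Real.rpow_mul (by norm_num),
                mul_comm (n : ℝ)]
              have h2 : (2 : ℝ) ^ s * 2 ^ (-s) = 1 := by
                rw [← Real.rpow_add (by norm_num)]; simp
              linear_combination (-(R₀ ^ (-s) * 2 ^ (-s * (n : ℝ)))) * h2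
          _ ≤ _ := by gcongr; exact le_max_right _ _
  choose m hm1 hm2 using hex
  set q : ℝ := 2 ^ (r - s) with hq
  have hq0 : 0 < q := by positivity
  have hq1 : q < 1 := Real.rpow_lt_one_of_one_lt_of_neg (by norm_num) (by linarith)
  refine summable_of_sum_le (c := K' * (C * R₀ ^ r) * (1 - q)⁻¹)
    (fun i => Real.rpow_nonneg (norm_nonneg _) _) fun u => ?_
  classical
  calc ∑ i ∈ u, ‖ρ i‖ ^ (-s) ≤ ∑ i ∈ u, K' * ((2 : ℝ) ^ (-s)) ^ (m i) :=
        Finset.sum_le_sum fun i _ => hm2 i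
    _ = ∑ k ∈ u.image m, ∑ i ∈ u with m i = k, K' * ((2 : ℝ) ^ (-s)) ^ (m i) :=
        (Finset.sum_fiberwise_of_maps_to (fun i hi => Finset.mem_image_of_mem m hi) _).symm
    _ ≤ ∑ k ∈ u.image m, K' * (C * R₀ ^ r) * q ^ k := by
        refine Finset.sum_le_sum fun k _ => ?_
        have h1 : ∑ i ∈ u with m i = k, K' * ((2 : ℝ) ^ (-s)) ^ (m i) =
            (#{i ∈ u | m i = k} : ℝ) * (K' * ((2 : ℝ) ^ (-s)) ^ k) := by
          rw [← nsmul_eq_mul]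
          refine Finset.sum_eq_card_nsmul fun i hi => ?_
          rw [(Finset.mem_filter.1 hi).2]
        rw [h1]
        have h2 := hb (R₀ * 2 ^ k) (le_mul_of_one_le_right hR0.le (one_le_pow₀ (by norm_num)))
          (u.filter fun i => m i = k) (fun i hi => by
            rw [← (Finset.mem_filter.1 hi).2]; exact hm1 i)
        calc _ ≤ C * (R₀ * 2 ^ k) ^ r * (K' * ((2 : ℝ) ^ (-s)) ^ k) := by gcongr
          _ = _ := by
            rw [Real.mul_rpow hR0.le (by positivity), hq, sub_eq_add_neg,
              Real.rpow_add (by norm_num), mul_pow, ← Real.rpow_natCast, ← Real.rpow_mul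
              (by norm_num), ← Real.rpow_natCast ((2 : ℝ) ^ r), ← Real.rpow_mul (by norm_num),
              mul_comm r]
            ring
    _ = K' * (C * R₀ ^ r) * ∑ k ∈ u.image m, q ^ k := by rw [Finset.mul_sum]
    _ ≤ _ := by
        gcongr
        rw [← tsum_geometric_of_lt_one hq0.le hq1]
        exact (summable_geometric_of_lt_one hq0.le hq1).sum_le_tsum _ fun k _ => by positivity

/-- A zero-free holomorphic function on a disk has a holomorphic logarithm there. -/
theorem _root_.exists_log_on_ball {g : ℂ → ℂ} {R : ℝ} (hR : 0 < R) (hg : Differentiable ℂ g)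
    (hne : ∀ z ∈ Metric.ball (0 : ℂ) R, g z ≠ 0) :
    ∃ h : ℂ → ℂ, h 0 = 0 ∧ (∀ z ∈ Metric.ball (0 : ℂ) R, HasDerivAt h (logDeriv g z) z) ∧
      ∀ z ∈ Metric.ball (0 : ℂ) R, g z = g 0 * exp (h z) := by
  have hd : DifferentiableOn ℂ (logDeriv g) (Metric.ball 0 R) := by
    intro z hz
    have h1 : DifferentiableAt ℂ (deriv g) z := (hg.analyticAt z).deriv.differentiableAt
    exact (h1.div (hg z) (hne z hz)).differentiableWithinAt
  obtain ⟨h, h0, hh⟩ := hd.isExactOn_ball.with_val_at 0 0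
  refine ⟨h, h0, hh, fun z hz => ?_⟩
  have hder : ∀ w ∈ Metric.ball (0 : ℂ) R, HasDerivAt (fun w => g w * exp (-h w)) 0 w := by
    intro w hw
    have h1 := (hg w).hasDerivAt.mul ((hh w hw).neg.cexp)
    refine h1.congr_deriv ?_
    rw [logDeriv_apply]
    have := hne w hw
    field_simp
    ring
  have h2 := (convex_ball (0 : ℂ) R).is_const_of_fderivWithin_eq_zero (𝕜 := ℂ)
    (f := fun w => g w * exp (-h w))
    (fun w hw => (hder w hw).differentiableAt.differentiableWithinAt)
    (fun w hw => by
      rw [fderivWithin_of_isOpen Metric.isOpen_ball hw]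
      ext
      simp [(hder w hw).hasFDerivAt.fderiv]) (Metric.mem_ball_self hR) hz
  simp only [h0, neg_zero, exp_zero, mul_one] at h2
  rw [h2, mul_assoc, ← exp_add]
  simp

/-- The logarithmic derivative, split off the zeros in a disk: the remaining part has a small
derivative. -/
theorem exists_logDeriv_approx (h : IsZeroFamily f ρ) (hf : Differentiable ℂ f) (h0 : f 0 ≠ 0)
    {r : ℝ} (hr : 0 < r) (hg : f =O[cocompact ℂ] fun z : ℂ => Real.exp (‖z‖ ^ r)) :
    ∃ C R₀ : ℝ, 1 ≤ R₀ ∧ ∀ R : ℝ, R₀ ≤ R → ∀ s : Finset ι, (∀ i, i ∈ s ↔ ‖ρ i‖ ≤ R) →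
      ∃ H : ℂ → ℂ, DifferentiableOn ℂ H (Metric.ball 0 R) ∧
        (∀ z ∈ Metric.ball (0 : ℂ) R, f z ≠ 0 →
          logDeriv f z = ∑ i ∈ s, 1 / (z - ρ i) + H z) ∧
        ∀ z ∈ Metric.ball (0 : ℂ) (R / 4), ‖deriv H z‖ ≤ C * R ^ (r - 2) := by
  obtain ⟨A, R₀, hA, hR₀, hb⟩ := exists_growth_bound hr hg
  set K : ℝ := A * 2 ^ r + |Real.log ‖f 0‖| with hK
  -- `64 = 2! · 2 · 4²`: a factor 2 from Borel–Carathéodory between radii `R` and `R/2`, then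
  -- Cauchy's estimate for the second derivative of the logarithm on a circle of radius `R/4`.
  refine ⟨64 * K, R₀, hR₀, fun R hR s hs => ?_⟩
  have hR1 : 1 ≤ R := hR₀.trans hR
  have hRp : 0 < R := by linarith
  obtain ⟨g, hgd, hfg, hord⟩ := h.exists_factor hf h0 s
  have hne : ∀ z ∈ Metric.ball (0 : ℂ) R, g z ≠ 0 := by
    intro z hz
    rw [← (hgd.analyticAt z).analyticOrderAt_eq_zero, hord, Set.encard_eq_zero]
    ext i
    simp only [Set.mem_ofPred_eq, Set.mem_empty_iff_false, iff_false, not_and]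
    rintro hi rfl
    exact hi ((hs i).2 (mem_ball_zero_iff.1 hz).le)
  have hg0 : g 0 = f 0 := by rw [hfg]; simp
  have hpos : ∀ i, 0 < ‖ρ i‖ := fun i => norm_pos_iff.2 (h.ne_zero hf h0 i)
  obtain ⟨l, hl0, hl, hgl⟩ := exists_log_on_ball hRp hgd hne
  -- At radius `2R` every removed factor has modulus at least 1, so the growth bound for `f` passes
  -- to `g` there, and inwards by the maximum principle.
  have hgb : ∀ z ∈ Metric.ball (0 : ℂ) R, ‖g z‖ ≤ Real.exp (A * (2 * R) ^ r) := by
    intro z hz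
    refine Complex.norm_le_of_forall_mem_frontier_norm_le
      (Metric.isBounded_ball (x := (0 : ℂ)) (r := 2 * R)) hgd.diffContOnCl (fun w hw => ?_)
      (subset_closure (Metric.ball_subset_ball (by linarith) hz))
    rw [frontier_ball _ (by positivity), mem_sphere_zero_iff_norm] at hw
    rw [← hw]
    refine le_trans ?_ (hb w (by rw [hw]; linarith))
    rw [hfg, norm_mul, norm_prod]
    refine le_mul_of_one_le_left (norm_nonneg _) ?_
    rw [← Finset.prod_const_one (s := s)]
    refine Finset.prod_le_prod (fun _ _ => zero_le_one) fun i hi => ?_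
    have h2 : 2 ≤ ‖w / ρ i‖ := by
      rw [norm_div, le_div_iff₀ (hpos i), hw]
      linarith [(hs i).1 hi]
    have h3 := norm_sub_norm_le (w / ρ i) 1
    rw [norm_sub_rev, norm_one] at h3
    linarith
  have hR1r : 1 ≤ R ^ r := Real.one_le_rpow hR1 hr.le
  have hK0 : 0 < K := by positivity
  have hre : Set.MapsTo l (Metric.ball 0 R) {z | z.re ≤ K * R ^ r} := by
    intro z hz
    have h1 := hgb z hz
    have hp : 0 < ‖f 0‖ := norm_pos_iff.2 h0
    rw [hgl z hz, hg0, norm_mul, norm_exp, ← Real.exp_log hp, ← Real.exp_add,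
      Real.exp_le_exp, Real.mul_rpow (by norm_num) hRp.le] at h1
    show (l z).re ≤ K * R ^ r
    nlinarith [neg_abs_le (Real.log ‖f 0‖), abs_nonneg (Real.log ‖f 0‖)]
  have hld : DifferentiableOn ℂ l (Metric.ball 0 R) :=
    fun z hz => (hl z hz).differentiableAt.differentiableWithinAt
  have hlb : ∀ z ∈ Metric.closedBall (0 : ℂ) (R / 2), ‖l z‖ ≤ 2 * (K * R ^ r) := by
    intro z hz
    rw [mem_closedBall_zero_iff] at hz
    refine (Complex.borelCaratheodory_zero (by positivity) hld hre hRp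
      (by rw [mem_ball_zero_iff]; linarith) hl0).trans ?_
    rw [div_le_iff₀ (by linarith)]
    have : 0 < K * R ^ r := by positivity
    nlinarith [norm_nonneg z]
  refine ⟨logDeriv g, ?_, fun z hz hfz => ?_, fun z hz => ?_⟩
  · intro z hz
    have h1 : DifferentiableAt ℂ (deriv g) z := (hgd.analyticAt z).deriv.differentiableAt
    exact (h1.div (hgd z) (hne z hz)).differentiableWithinAt
  · have hfun : f = fun z => (∏ i ∈ s, (1 - z / ρ i)) * g z := funext hfg
    have hprod : ∏ i ∈ s, (1 - z / ρ i) ≠ 0 := by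
      intro h1
      exact hfz (by rw [hfg, h1, zero_mul])
    rw [hfun, logDeriv_mul z hprod (hne z hz) (by fun_prop) (hgd z)]
    congr 1
    rw [logDeriv_prod (fun i hi => Finset.prod_ne_zero_iff.1 hprod i hi) (by fun_prop)]
    refine Finset.sum_congr rfl fun i hi => ?_
    have h1 := Finset.prod_ne_zero_iff.1 hprod i hi
    have h2 : ρ i ≠ 0 := norm_pos_iff.1 (hpos i)
    have h3 : z - ρ i ≠ 0 := by
      intro h3
      apply h1
      rw [sub_eq_zero.1 h3, div_self h2, sub_self]
    have h4 : HasDerivAt (fun z => 1 - z / ρ i) (-(1 / ρ i)) z := by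
      simpa using ((hasDerivAt_id z).div_const (ρ i)).const_sub 1
    rw [logDeriv_apply, h4.deriv, div_eq_div_iff h1 h3]
    field_simp
    ring
  · rw [mem_ball_zero_iff] at hz
    have hsub : Metric.closedBall z (R / 4) ⊆ Metric.closedBall 0 (R / 2) := by
      intro w hw
      rw [mem_closedBall_iff_norm] at hw
      rw [mem_closedBall_zero_iff]
      calc ‖w‖ = ‖(w - z) + z‖ := by simp
        _ ≤ ‖w - z‖ + ‖z‖ := norm_add_le _ _
        _ ≤ R / 2 := by linarith
    have hsub2 : Metric.closedBall (0 : ℂ) (R / 2) ⊆ Metric.ball 0 R :=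
      Metric.closedBall_subset_ball (by linarith)
    have h1 : deriv (logDeriv g) z = iteratedDeriv 2 l z := by
      rw [iteratedDeriv_succ, iteratedDeriv_one]
      refine Filter.EventuallyEq.deriv_eq ?_
      filter_upwards [Metric.isOpen_ball.mem_nhds (hsub2 (hsub (Metric.mem_closedBall_self
        (by positivity))))] with w hw
      exact (hl w hw).deriv.symm
    have h2 : DiffContOnCl ℂ l (Metric.ball z (R / 4)) := by
      refine DifferentiableOn.diffContOnCl ?_
      rw [closure_ball _ (by positivity)]
      exact hld.mono (hsub.trans hsub2)
    rw [h1]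
    refine (Complex.norm_iteratedDeriv_le_of_forall_mem_sphere_norm_le 2 (by positivity) h2
      fun w hw => hlb w (hsub (Metric.sphere_subset_closedBall hw))).trans (le_of_eq ?_)
    rw [Real.rpow_sub hRp, Real.rpow_two]
    simp [Nat.factorial]
    field_simp
    ring

theorem eventually_norm_ge (h : IsZeroFamily f ρ) (hf : Differentiable ℂ f) (h0 : f 0 ≠ 0)
    {r : ℝ} (hr : 0 < r) (hg : f =O[cocompact ℂ] fun z : ℂ => Real.exp (‖z‖ ^ r)) (R : ℝ) :
    ∀ᶠ i in cofinite, R ≤ ‖ρ i‖ := by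
  refine (h.finite_norm_le hf h0 hr hg R).subset fun i hi => ?_
  simp only [Set.mem_compl_iff, Set.mem_ofPred_eq, not_le] at hi
  exact hi.le

theorem summable_one_div_sub_sq (h : IsZeroFamily f ρ) (hf : Differentiable ℂ f) (h0 : f 0 ≠ 0)
    {r : ℝ} (hr : 0 < r) (hr2 : r < 2)
    (hg : f =O[cocompact ℂ] fun z : ℂ => Real.exp (‖z‖ ^ r)) (z : ℂ) :
    Summable fun i => 1 / (z - ρ i) ^ 2 := by
  have hs := h.summable_rpow hf h0 hr hr2 hg
  refine Summable.of_norm_bounded_eventually (hs.mul_left 4) ?_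
  filter_upwards [h.eventually_norm_ge hf h0 hr hg (2 * ‖z‖)] with i hi
  have hp : 0 < ‖ρ i‖ := norm_pos_iff.2 (h.ne_zero hf h0 i)
  have h1 : ‖ρ i‖ / 2 ≤ ‖z - ρ i‖ := by
    have := norm_sub_norm_le (ρ i) z
    rw [norm_sub_rev] at this
    linarith
  rw [norm_div, norm_one, norm_pow, Real.rpow_neg hp.le, Real.rpow_two]
  calc 1 / ‖z - ρ i‖ ^ 2 ≤ 1 / (‖ρ i‖ / 2) ^ 2 := by gcongr
    _ = 4 * (‖ρ i‖ ^ 2)⁻¹ := by field_simp; norm_num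

theorem summable_one_div_sub_add (h : IsZeroFamily f ρ) (hf : Differentiable ℂ f) (h0 : f 0 ≠ 0)
    {r : ℝ} (hr : 0 < r) (hr2 : r < 2)
    (hg : f =O[cocompact ℂ] fun z : ℂ => Real.exp (‖z‖ ^ r)) {z : ℂ} (hz : f z ≠ 0) :
    Summable fun i => 1 / (z - ρ i) + 1 / ρ i := by
  have hs := h.summable_rpow hf h0 hr hr2 hg
  refine Summable.of_norm_bounded_eventually (hs.mul_left (2 * ‖z‖)) ?_
  filter_upwards [h.eventually_norm_ge hf h0 hr hg (2 * ‖z‖)] with i hi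
  have hp : 0 < ‖ρ i‖ := norm_pos_iff.2 (h.ne_zero hf h0 i)
  have hne : z - ρ i ≠ 0 := sub_ne_zero.2 (h.ne_zero hf hz i).symm
  have hne2 : ρ i ≠ 0 := norm_pos_iff.1 hp
  have h1 : ‖ρ i‖ / 2 ≤ ‖z - ρ i‖ := by
    have := norm_sub_norm_le (ρ i) z
    rw [norm_sub_rev] at this
    linarith
  have h2 : 1 / (z - ρ i) + 1 / ρ i = z / ((z - ρ i) * ρ i) := by field_simp; ring
  rw [h2, norm_div, norm_mul, Real.rpow_neg hp.le, Real.rpow_two]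
  calc ‖z‖ / (‖z - ρ i‖ * ‖ρ i‖) ≤ ‖z‖ / (‖ρ i‖ / 2 * ‖ρ i‖) := by gcongr
    _ = 2 * ‖z‖ * (‖ρ i‖ ^ 2)⁻¹ := by field_simp

theorem tendsto_disks (h : IsZeroFamily f ρ) (hf : Differentiable ℂ f) (h0 : f 0 ≠ 0)
    {r : ℝ} (hr : 0 < r) (hg : f =O[cocompact ℂ] fun z : ℂ => Real.exp (‖z‖ ^ r)) :
    Tendsto (fun n : ℕ => (h.finite_norm_le hf h0 hr hg n).toFinset) atTop atTop := by
  refine tendsto_atTop_finset_of_monotone (fun m n hmn i hi => ?_) fun i => ?_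
  · simp only [Set.Finite.mem_toFinset, Set.mem_ofPred_eq] at hi ⊢
    exact hi.trans (by exact_mod_cast hmn)
  · obtain ⟨n, hn⟩ := exists_nat_ge ‖ρ i‖
    exact ⟨n, by simpa using hn⟩

/-- The disks only give a limit along one exhausting sequence; summability, known independently,
identifies it with the unconditional sum. -/
theorem _root_.hasSum_of_tendsto_sub {ι : Type*} {u : ι → ℂ} (hu : Summable u) {S : ℕ → Finset ι}
    (hS : Tendsto S atTop atTop) {a : ℂ}
    (h : Tendsto (fun n => a - ∑ i ∈ S n, u i) atTop (𝓝 0)) : HasSum u a := by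
  have h1 : Tendsto (fun n => ∑ i ∈ S n, u i) atTop (𝓝 (∑' i, u i)) := hu.hasSum.comp hS
  have h2 : Tendsto (fun n => ∑ i ∈ S n, u i) atTop (𝓝 a) := by
    have := (tendsto_const_nhds (x := a)).sub h
    simpa using this
  rw [← tendsto_nhds_unique h1 h2]
  exact hu.hasSum

theorem _root_.tendsto_natCast_rpow_sub {r : ℝ} (hr2 : r < 2) (C : ℝ) :
    Tendsto (fun n : ℕ => C * (n : ℝ) ^ (r - 2)) atTop (𝓝 0) := by
  have h1 := ((tendsto_rpow_neg_atTop (y := 2 - r) (by linarith)).comp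
    tendsto_natCast_atTop_atTop).const_mul C
  rw [mul_zero] at h1
  refine h1.congr fun n => ?_
  simp only [Function.comp]
  rw [neg_sub]

/-- Second logarithmic derivative of an entire function of order less than two. -/
theorem hasSum_one_div_sub_sq (h : IsZeroFamily f ρ) (hf : Differentiable ℂ f) (h0 : f 0 ≠ 0)
    {r : ℝ} (hr : 0 < r) (hr2 : r < 2)
    (hg : f =O[cocompact ℂ] fun z : ℂ => Real.exp (‖z‖ ^ r)) {z : ℂ} (hz : f z ≠ 0) :
    HasSum (fun i => 1 / (z - ρ i) ^ 2) (-deriv (logDeriv f) z) := by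
  refine hasSum_of_tendsto_sub (h.summable_one_div_sub_sq hf h0 hr hr2 hg z)
    (h.tendsto_disks hf h0 hr hg) ?_
  obtain ⟨C, R₀, hR₀, hC⟩ := h.exists_logDeriv_approx hf h0 hr hg
  refine squeeze_zero_norm' ?_ (tendsto_natCast_rpow_sub hr2 C)
  obtain ⟨n₀, hn₀⟩ := exists_nat_ge (max R₀ (4 * ‖z‖ + 1))
  filter_upwards [eventually_ge_atTop n₀] with n hn
  have hn' : max R₀ (4 * ‖z‖ + 1) ≤ n := hn₀.trans (by exact_mod_cast hn)
  have hnR : R₀ ≤ n := (le_max_left _ _).trans hn'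
  have hnz : 4 * ‖z‖ + 1 ≤ n := (le_max_right _ _).trans hn'
  obtain ⟨H, hH, hHs, hHd⟩ := hC n hnR (h.finite_norm_le hf h0 hr hg n).toFinset (by simp)
  have hz4 : z ∈ Metric.ball (0 : ℂ) (n / 4) := by rw [mem_ball_zero_iff]; linarith
  have hz1 : z ∈ Metric.ball (0 : ℂ) n := by
    rw [mem_ball_zero_iff]; linarith [norm_nonneg z]
  refine le_trans (le_of_eq ?_) (hHd z hz4)
  have hev : logDeriv f =ᶠ[𝓝 z] fun w =>
      ∑ i ∈ (h.finite_norm_le hf h0 hr hg n).toFinset, 1 / (w - ρ i) + H w := by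
    filter_upwards [Metric.isOpen_ball.mem_nhds hz1, hf.continuous.continuousAt.eventually_ne hz]
      with w hw hw0 using hHs w hw hw0
  have hder : HasDerivAt (fun w =>
      ∑ i ∈ (h.finite_norm_le hf h0 hr hg n).toFinset, 1 / (w - ρ i) + H w)
      (∑ i ∈ (h.finite_norm_le hf h0 hr hg n).toFinset, -(1 / (z - ρ i) ^ 2) + deriv H z) z := by
    refine (HasDerivAt.fun_sum fun i _ => ?_).add
      ((hH z hz1).differentiableAt (Metric.isOpen_ball.mem_nhds hz1)).hasDerivAt
    have hne : z - ρ i ≠ 0 := sub_ne_zero.2 (h.ne_zero hf hz i).symm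
    have := ((hasDerivAt_id z).sub_const (ρ i)).fun_inv hne
    simpa [neg_div] using this
  rw [hev.deriv_eq, hder.deriv, Finset.sum_neg_distrib, ← norm_neg]
  congr 1
  ring

/-- The logarithmic derivative of an entire function of order less than two. -/
theorem hasSum_logDeriv (h : IsZeroFamily f ρ) (hf : Differentiable ℂ f) (h0 : f 0 ≠ 0)
    {r : ℝ} (hr : 0 < r) (hr2 : r < 2)
    (hg : f =O[cocompact ℂ] fun z : ℂ => Real.exp (‖z‖ ^ r)) {z : ℂ} (hz : f z ≠ 0) :
    HasSum (fun i => 1 / (z - ρ i) + 1 / ρ i) (logDeriv f z - logDeriv f 0) := by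
  refine hasSum_of_tendsto_sub (h.summable_one_div_sub_add hf h0 hr hr2 hg hz)
    (h.tendsto_disks hf h0 hr hg) ?_
  obtain ⟨C, R₀, hR₀, hC⟩ := h.exists_logDeriv_approx hf h0 hr hg
  refine squeeze_zero_norm' ?_ (by simpa using (tendsto_natCast_rpow_sub hr2 C).mul_const ‖z‖)
  obtain ⟨n₀, hn₀⟩ := exists_nat_ge (max R₀ (4 * ‖z‖ + 1))
  filter_upwards [eventually_ge_atTop n₀] with n hn
  have hn' : max R₀ (4 * ‖z‖ + 1) ≤ n := hn₀.trans (by exact_mod_cast hn)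
  have hnR : R₀ ≤ n := (le_max_left _ _).trans hn'
  have hnz : 4 * ‖z‖ + 1 ≤ n := (le_max_right _ _).trans hn'
  obtain ⟨H, hH, hHs, hHd⟩ := hC n hnR (h.finite_norm_le hf h0 hr hg n).toFinset (by simp)
  have hn1 : (1 : ℝ) ≤ n := by linarith
  have hz4 : z ∈ Metric.ball (0 : ℂ) (n / 4) := by rw [mem_ball_zero_iff]; linarith
  have h04 : (0 : ℂ) ∈ Metric.ball (0 : ℂ) (n / 4) := Metric.mem_ball_self (by linarith)
  have hsub : Metric.ball (0 : ℂ) (n / 4) ⊆ Metric.ball 0 n :=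
    Metric.ball_subset_ball (by linarith)
  -- Only the derivative of `H` is known to tend to zero, not `H`; this is why the formula compares
  -- the values at `z` and at `0`, where the mean value inequality applies.
  have h1 := (convex_ball (0 : ℂ) ((n : ℝ) / 4)).norm_image_sub_le_of_norm_deriv_le
    (fun w hw => (hH w (hsub hw)).differentiableAt (Metric.isOpen_ball.mem_nhds (hsub hw)))
    hHd h04 hz4
  rw [sub_zero] at h1
  refine le_trans (le_of_eq ?_) h1
  rw [hHs z (hsub hz4) hz, hHs 0 (hsub h04) h0, Finset.sum_add_distrib]
  congr 1
  simp only [zero_sub, one_div, inv_neg, Finset.sum_neg_distrib]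
  ring

end IsZeroFamily

/-! ### Calculus of polar parts and removable singularities. -/

/-- `f` has at most a double pole at `p`, with polar part `A / (s - p) ^ 2 + B / (s - p)`. -/
def HasPolarPart (f : ℂ → ℂ) (p A B : ℂ) : Prop :=
  ∃ g : ℂ → ℂ, AnalyticAt ℂ g p ∧
    ∀ᶠ s in 𝓝[≠] p, f s = A / (s - p) ^ 2 + B / (s - p) + g s

theorem AnalyticAt.dslope_self {φ : ℂ → ℂ} {p : ℂ} (h : AnalyticAt ℂ φ p) :
    AnalyticAt ℂ (dslope φ p) p := by
  obtain ⟨q, hq⟩ := h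
  exact ⟨_, hq.has_fpower_series_dslope_fslope⟩

theorem eq_add_mul_dslope (φ : ℂ → ℂ) (p s : ℂ) : φ s = φ p + (s - p) * dslope φ p s := by
  have := sub_smul_dslope φ p s
  rw [smul_eq_mul] at this
  rw [this]; ring

namespace HasPolarPart

variable {f f' : ℂ → ℂ} {p A B A' B' : ℂ}

theorem congr (h : HasPolarPart f p A B) (hf : f =ᶠ[𝓝[≠] p] f') : HasPolarPart f' p A B := by
  obtain ⟨g, hg, he⟩ := h
  exact ⟨g, hg, by filter_upwards [he, hf] with s h1 h2 using h2 ▸ h1⟩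

theorem of_analyticAt (h : AnalyticAt ℂ f p) : HasPolarPart f p 0 0 :=
  ⟨f, h, by simp⟩

theorem add (h : HasPolarPart f p A B) (h' : HasPolarPart f' p A' B') :
    HasPolarPart (fun s => f s + f' s) p (A + A') (B + B') := by
  obtain ⟨g, hg, he⟩ := h
  obtain ⟨g', hg', he'⟩ := h'
  refine ⟨fun s => g s + g' s, hg.add hg', ?_⟩
  filter_upwards [he, he'] with s h1 h2
  rw [h1, h2]; ring

theorem sum {ι : Type*} (t : Finset ι) {F : ι → ℂ → ℂ} {α β : ι → ℂ}
    (h : ∀ i ∈ t, HasPolarPart (F i) p (α i) (β i)) :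
    HasPolarPart (fun s => ∑ i ∈ t, F i s) p (∑ i ∈ t, α i) (∑ i ∈ t, β i) := by
  classical
  induction t using Finset.induction_on with
  | empty => simpa using of_analyticAt (p := p) analyticAt_const
  | insert j t hj ih =>
    simp only [Finset.sum_insert hj]
    exact (h j (Finset.mem_insert_self _ _)).add
      (ih fun i hi => h i (Finset.mem_insert_of_mem hi))

/-- Two iterated slopes give the Taylor expansion of `φ` to second order; its linear term meets the
double pole and contributes `φ' A` to the residue. -/
theorem mul_left (h : HasPolarPart f p A B) {φ : ℂ → ℂ} (hφ : AnalyticAt ℂ φ p) :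
    HasPolarPart (fun s => φ s * f s) p (φ p * A) (deriv φ p * A + φ p * B) := by
  obtain ⟨g, hg, he⟩ := h
  have h1 := hφ.dslope_self
  have h2 := h1.dslope_self
  refine ⟨fun s => A * dslope (dslope φ p) p s + B * dslope φ p s + φ s * g s,
    ((analyticAt_const.mul h2).add (analyticAt_const.mul h1)).add (hφ.mul hg), ?_⟩
  filter_upwards [he, self_mem_nhdsWithin] with s hs hne
  have hne' : s - p ≠ 0 := sub_ne_zero.2 hne
  have e1 := eq_add_mul_dslope φ p s
  have e2 := eq_add_mul_dslope (dslope φ p) p s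
  rw [dslope_same] at e2
  rw [hs]
  field_simp
  linear_combination (A + B * (s - p)) * e1 + (s - p) * A * e2

/-- A zero of `φ` cancels a simple pole. This is how expansion coefficients become special values of
the zeta functions. -/
theorem analytic_value (h : HasPolarPart f p 0 B) {φ : ℂ → ℂ} (hφ : AnalyticAt ℂ φ p)
    (h0 : φ p = 0) : ∃ g : ℂ → ℂ, AnalyticAt ℂ g p ∧ g p = deriv φ p * B ∧
      (fun s => φ s * f s) =ᶠ[𝓝[≠] p] g := by
  obtain ⟨g, hg, he⟩ := h
  refine ⟨fun s => dslope φ p s * B + φ s * g s,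
    (hφ.dslope_self.mul analyticAt_const).add (hφ.mul hg), by simp [h0], ?_⟩
  filter_upwards [he, self_mem_nhdsWithin] with s hs hne
  have hne' : s - p ≠ 0 := sub_ne_zero.2 hne
  have e1 := eq_add_mul_dslope φ p s
  rw [h0, zero_add] at e1
  rw [hs, zero_div, zero_add, mul_add]
  congr 1
  field_simp
  linear_combination B * e1

theorem comp_affine {α β : ℂ} (hβ : β ≠ 0) (h : HasPolarPart f (α - β * p) A B) :
    HasPolarPart (fun s => f (α - β * s)) p (A / β ^ 2) (-B / β) := by
  obtain ⟨g, hg, he⟩ := h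
  refine ⟨fun s => g (α - β * s), ?_, ?_⟩
  · exact hg.comp_of_eq (f := fun s => α - β * s) (by fun_prop) rfl
  · have ht : Tendsto (fun s : ℂ => α - β * s) (𝓝[≠] p) (𝓝[≠] (α - β * p)) := by
      refine tendsto_nhdsWithin_iff.2 ⟨?_, ?_⟩
      · exact ((by fun_prop : Continuous fun s : ℂ => α - β * s).tendsto p).mono_left
          nhdsWithin_le_nhds
      · filter_upwards [self_mem_nhdsWithin] with s hs hc
        apply hs
        have : β * (s - p) = 0 := by
          have hc' : α - β * s = α - β * p := hc
          linear_combination -hc'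
        exact sub_eq_zero.1 ((mul_eq_zero.1 this).resolve_left hβ)
    filter_upwards [ht.eventually he, self_mem_nhdsWithin] with s hs hne
    have hne' : s - p ≠ 0 := sub_ne_zero.2 hne
    rw [hs]
    have e : α - β * s - (α - β * p) = -(β * (s - p)) := by ring
    rw [e]
    congr 1
    field_simp

theorem isBigO (h : HasPolarPart f p A B) :
    (fun s => f s - (A / (s - p) ^ 2 + B / (s - p))) =O[𝓝[≠] p] (fun _ => (1 : ℝ)) := by
  obtain ⟨g, hg, he⟩ := h
  have h1 : g =O[𝓝[≠] p] (fun _ => (1 : ℝ)) :=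
    (hg.continuousAt.isBigO_one ℝ).mono nhdsWithin_le_nhds
  refine h1.congr' ?_ EventuallyEq.rfl
  filter_upwards [he] with s hs
  rw [hs]; ring

theorem isBigO_add (h : HasPolarPart f p A B) :
    (fun ε => f (p + ε) - (A / ε ^ 2 + B / ε)) =O[𝓝[≠] 0] (fun _ => (1 : ℝ)) := by
  have ht : Tendsto (fun ε : ℂ => p + ε) (𝓝[≠] 0) (𝓝[≠] p) := by
    refine tendsto_nhdsWithin_iff.2 ⟨?_, ?_⟩
    · have := (by fun_prop : Continuous fun s : ℂ => p + s).tendsto 0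
      rw [add_zero] at this
      exact this.mono_left nhdsWithin_le_nhds
    · filter_upwards [self_mem_nhdsWithin] with s hs hc
      exact hs (by simpa using hc)
  refine (h.isBigO.comp_tendsto ht).congr (fun ε => ?_) fun _ => rfl
  simp [Function.comp]

theorem meromorphicAt (h : HasPolarPart f p A B) : MeromorphicAt f p := by
  obtain ⟨g, hg, he⟩ := h
  refine MeromorphicAt.congr (f := fun s => A / (s - p) ^ 2 + B / (s - p) + g s) ?_
    (EventuallyEq.symm he)
  have := hg.meromorphicAt
  fun_prop

theorem meromorphicOrderAt_eq (h : HasPolarPart f p A B) (hA : A ≠ 0) :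
    meromorphicOrderAt f p = ((-2 : ℤ) : WithTop ℤ) := by
  have hm := h.meromorphicAt
  obtain ⟨g, hg, he⟩ := h
  rw [meromorphicOrderAt_eq_int_iff hm]
  refine ⟨fun s => A + B * (s - p) + (s - p) ^ 2 * g s, by fun_prop, by simpa using hA, ?_⟩
  filter_upwards [he, self_mem_nhdsWithin] with s hs hne
  have hne' : s - p ≠ 0 := sub_ne_zero.2 hne
  rw [hs, smul_eq_mul]
  have : (s - p) ^ (-2 : ℤ) = ((s - p) ^ 2)⁻¹ := by
    rw [zpow_neg]; norm_cast
  rw [this]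
  field_simp

end HasPolarPart

/-- The function obtained by filling in the removable singularities. -/
def fillIn (f : ℂ → ℂ) (p : ℂ) : ℂ := limUnder (𝓝[≠] p) f

theorem fillIn_apply {f g : ℂ → ℂ} {p : ℂ} (h : f =ᶠ[𝓝[≠] p] g) (hg : ContinuousAt g p) :
    fillIn f p = g p := by
  refine Tendsto.limUnder_eq ?_
  exact (hg.tendsto.mono_left nhdsWithin_le_nhds).congr' h.symm

/-- Filling in modifies values only through nearby limits: a point `s ≠ p` has a neighbourhood
avoiding `p`, where `f` already equals the continuous `g`. -/
theorem fillIn_eventuallyEq_punctured {f g : ℂ → ℂ} {p : ℂ} (h : f =ᶠ[𝓝[≠] p] g)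
    (hg : ∀ᶠ s in 𝓝[≠] p, ContinuousAt g s) : fillIn f =ᶠ[𝓝[≠] p] g := by
  have h1 : ∀ᶠ s in 𝓝[≠] p, ∀ᶠ w in 𝓝 s, w ≠ p → f w = g w := by
    have h2 : ∀ᶠ w in 𝓝 p, w ≠ p → f w = g w := eventually_nhdsWithin_iff.1 h
    exact (eventually_eventually_nhds.2 h2).filter_mono nhdsWithin_le_nhds
  filter_upwards [h1, hg, self_mem_nhdsWithin] with s hs hgs hne
  refine fillIn_apply ?_ hgs
  filter_upwards [hs.filter_mono nhdsWithin_le_nhds,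
    (isOpen_ne.mem_nhds hne : {w | w ≠ p} ∈ 𝓝 s) |> mem_nhdsWithin_of_mem_nhds] with w hw hwp
  exact hw hwp

theorem fillIn_eventuallyEq {f g : ℂ → ℂ} {p : ℂ} (h : f =ᶠ[𝓝[≠] p] g)
    (hg : AnalyticAt ℂ g p) : fillIn f =ᶠ[𝓝 p] g := by
  have h1 := fillIn_eventuallyEq_punctured h
    ((hg.eventually_analyticAt.mono fun s hs => hs.continuousAt).filter_mono nhdsWithin_le_nhds)
  rw [EventuallyEq, eventually_nhdsWithin_iff] at h1
  filter_upwards [h1] with s hs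
  by_cases hsp : s = p
  · subst hsp
    exact fillIn_apply h hg.continuousAt
  · exact hs hsp

theorem analyticAt_fillIn {f g : ℂ → ℂ} {p : ℂ} (h : f =ᶠ[𝓝[≠] p] g)
    (hg : AnalyticAt ℂ g p) : AnalyticAt ℂ (fillIn f) p :=
  hg.congr (fillIn_eventuallyEq h hg).symm

theorem HasPolarPart.fillIn {f : ℂ → ℂ} {p A B : ℂ} (h : HasPolarPart f p A B) :
    HasPolarPart (fillIn f) p A B := by
  obtain ⟨g, hg, he⟩ := h
  refine ⟨g, hg, ?_⟩
  refine fillIn_eventuallyEq_punctured he ?_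
  filter_upwards [(hg.eventually_analyticAt).filter_mono nhdsWithin_le_nhds,
    self_mem_nhdsWithin] with s hs hne
  have hne' : s - p ≠ 0 := sub_ne_zero.2 hne
  have := hs.continuousAt
  fun_prop (disch := simpa using hne')

/-! ### Mellin transforms continued through an asymptotic expansion. -/

open MeasureTheory in
theorem locallyIntegrableOn_indicator_Ioi_one {h : ℝ → ℂ} (hh : ContinuousOn h (Set.Ioi 0)) :
    LocallyIntegrableOn ((Set.Ioi (1 : ℝ)).indicator h) (Set.Ioi 0) := by
  have h1 := hh.locallyIntegrableOn (μ := volume) measurableSet_Ioi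
  rw [locallyIntegrableOn_iff isOpen_Ioi.isLocallyClosed] at h1 ⊢
  exact fun k hk hkc => (h1 k hk hkc).indicator measurableSet_Ioi

/-- The function `y ^ (-n-1)` cut off to `y > 1`. -/
def invPowTail (n : ℕ) : ℝ → ℂ :=
  (Set.Ioi (1 : ℝ)).indicator fun y => ((y : ℂ) ^ (n + 1))⁻¹

theorem invPowTail_of_lt (n : ℕ) {y : ℝ} (hy : 1 < y) : invPowTail n y = ((y : ℂ) ^ (n + 1))⁻¹ :=
  Set.indicator_of_mem (s := Set.Ioi (1 : ℝ)) hy _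

theorem invPowTail_of_le (n : ℕ) {y : ℝ} (hy : y ≤ 1) : invPowTail n y = 0 :=
  Set.indicator_of_notMem (s := Set.Ioi (1 : ℝ)) (not_lt.2 hy) _

theorem locallyIntegrableOn_invPowTail (n : ℕ) :
    MeasureTheory.LocallyIntegrableOn (invPowTail n) (Set.Ioi 0) := by
  refine locallyIntegrableOn_indicator_Ioi_one ?_
  refine ContinuousOn.inv₀ (by fun_prop) fun y hy => ?_
  have : (y : ℂ) ≠ 0 := ofReal_ne_zero.2 (ne_of_gt hy)
  positivity

theorem eventually_lt_one_nhdsGT_zero : ∀ᶠ y : ℝ in 𝓝[>] 0, y < 1 :=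
  (eventually_lt_nhds (zero_lt_one (α := ℝ))).filter_mono nhdsWithin_le_nhds

theorem hasMellin_invPowTail (n : ℕ) {S : ℂ} (hS : S.re < n + 1) :
    HasMellin (invPowTail n) S (-1 / (S - (n + 1))) := by
  have ha : (S - 1 - (n + 1)).re < -1 := by simp; linarith
  have hfun : ∀ y ∈ Set.Ioi (0 : ℝ), (y : ℂ) ^ (S - 1) • invPowTail n y =
      (Set.Ioi (1 : ℝ)).indicator (fun y : ℝ => (y : ℂ) ^ (S - 1 - (n + 1))) y := by
    intro y hy
    have hy0 : (y : ℂ) ≠ 0 := ofReal_ne_zero.2 (ne_of_gt hy)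
    by_cases h : 1 < y
    · rw [invPowTail_of_lt n h, Set.indicator_of_mem (s := Set.Ioi (1 : ℝ)) h, smul_eq_mul,
        cpow_sub (S - 1) ((n : ℂ) + 1) hy0, div_eq_mul_inv]
      norm_cast
    · rw [invPowTail_of_le n (not_lt.1 h), Set.indicator_of_notMem (s := Set.Ioi (1 : ℝ)) h,
        smul_zero]
  constructor
  · rw [MellinConvergent, MeasureTheory.integrableOn_congr_fun hfun measurableSet_Ioi]
    have := (integrableOn_Ioi_cpow_of_lt ha zero_lt_one).integrable_indicator measurableSet_Ioi
    exact this.integrableOn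
  · rw [mellin, MeasureTheory.setIntegral_congr_fun measurableSet_Ioi hfun,
      MeasureTheory.setIntegral_indicator measurableSet_Ioi, Set.Ioi_inter_Ioi,
      max_eq_right zero_le_one, integral_Ioi_cpow_of_lt ha zero_lt_one]
    simp
    congr 1
    ring

/-- A factor `log y` under the integral is a derivative in `S` of the transform `-1 / (S - 1)`. -/
theorem hasMellin_log_invPowTail {S : ℂ} (hS : S.re < 1) :
    HasMellin (fun y => Real.log y • invPowTail 0 y) S (1 / (S - 1) ^ 2) := by
  have h1 := mellin_hasDerivAt_of_isBigO_rpow (E := ℂ) (a := 1) (b := S.re - 1) (s := S)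
    (locallyIntegrableOn_invPowTail 0) ?_ hS ?_ (by linarith)
  · refine ⟨h1.1, ?_⟩
    have h2 : mellin (invPowTail 0) =ᶠ[𝓝 S] fun s => -1 / (s - 1) := by
      filter_upwards [(isOpen_lt continuous_re continuous_const).mem_nhds hS] with s hs
      have := (hasMellin_invPowTail 0 (S := s) (by simpa using hs)).2
      simpa using this
    have hne : S - 1 ≠ 0 := by
      intro h
      rw [sub_eq_zero.1 h] at hS
      simp at hS
    have h3 : HasDerivAt (fun s : ℂ => -1 / (s - 1)) (1 / (S - 1) ^ 2) S := by
      have := (hasDerivAt_const S (-1 : ℂ)).fun_div ((hasDerivAt_id S).sub_const 1) hne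
      simpa using this
    exact h1.2.unique (h3.congr_of_eventuallyEq h2)
  · refine IsBigO.of_bound 1 ?_
    filter_upwards [eventually_gt_atTop 1] with y hy
    rw [invPowTail_of_lt 0 hy, Real.rpow_neg_one, one_mul]
    simp
  · refine (isBigO_zero _ _).congr' ?_ EventuallyEq.rfl
    filter_upwards [eventually_lt_one_nhdsGT_zero] with y hy
    rw [invPowTail_of_le 0 hy.le]

/-- Meromorphic continuation of the Mellin transform of a function with an asymptotic expansion in
inverse powers at infinity, with one logarithmic term. -/
theorem exists_mellin_continuation {F : ℝ → ℂ} {d : ℂ} {c : ℕ → ℂ}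
    (hF : ContinuousOn F (Set.Ioi 0)) (h0 : F =O[𝓝[>] 0] (fun _ => (1 : ℝ)))
    (hinf : ∀ N : ℕ, (fun y : ℝ => F y - (d * (Real.log y / y) +
      ∑ n ∈ range N, c n * ((y : ℂ) ^ (n + 1))⁻¹)) =O[atTop] fun y : ℝ => (y ^ (N + 1))⁻¹) :
    ∃ M : ℂ → ℂ, (∀ S : ℂ, 0 < S.re → S.re < 1 → M S = mellin F S) ∧
      (∀ S : ℂ, 0 < S.re → (∀ n : ℕ, S ≠ n + 1) → AnalyticAt ℂ M S) ∧
      ∀ n : ℕ, HasPolarPart M (n + 1) (if n = 0 then d else 0) (-c n) := by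
  set E : ℕ → ℝ → ℂ := fun N y => d • (Real.log y • invPowTail 0 y) +
    ∑ n ∈ range N, c n • invPowTail n y with hE
  -- The Mellin transform of `E N`, computed for `Re S < 1` but rational, hence defined beyond that
  -- half-plane.
  set P : ℕ → ℂ → ℂ := fun N S => d / (S - 1) ^ 2 - ∑ n ∈ range N, c n / (S - (n + 1)) with hP
  have hFl : MeasureTheory.LocallyIntegrableOn F (Set.Ioi 0) :=
    hF.locallyIntegrableOn measurableSet_Ioi
  have hlogl : MeasureTheory.LocallyIntegrableOn (fun y => Real.log y • invPowTail 0 y)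
      (Set.Ioi 0) := by
    have heq : (fun y => Real.log y • invPowTail 0 y) =
        (Set.Ioi (1 : ℝ)).indicator fun y => Real.log y • ((y : ℂ) ^ (0 + 1))⁻¹ := by
      funext y
      by_cases hy : 1 < y
      · rw [invPowTail_of_lt 0 hy, Set.indicator_of_mem (s := Set.Ioi (1 : ℝ)) hy]
      · rw [invPowTail_of_le 0 (not_lt.1 hy), Set.indicator_of_notMem (s := Set.Ioi (1 : ℝ)) hy,
          smul_zero]
    rw [heq]
    refine locallyIntegrableOn_indicator_Ioi_one ?_
    · refine ContinuousOn.smul (Real.continuousOn_log.mono fun y hy => ne_of_gt hy)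
        (ContinuousOn.inv₀ (by fun_prop) fun y hy => ?_)
      have : (y : ℂ) ≠ 0 := ofReal_ne_zero.2 (ne_of_gt hy)
      positivity
  have hEl : ∀ N, MeasureTheory.LocallyIntegrableOn (E N) (Set.Ioi 0) := by
    intro N
    refine (hlogl.smul d).add ?_
    induction N with
    | zero => simpa using (MeasureTheory.locallyIntegrable_const (0 : ℂ)).locallyIntegrableOn _
    | succ N ih =>
      simp only [Finset.sum_range_succ]
      exact ih.add ((locallyIntegrableOn_invPowTail N).smul (c N))
  set h : ℕ → ℂ → ℂ := fun N => mellin (fun y => F y - E N y) with hh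
  -- The model terms are cut off below `y = 1`, so subtracting them improves decay at infinity
  -- without spoiling the behaviour at 0; convergence holds for `0 < Re S < N + 1`.
  have hE0 : ∀ N, ∀ᶠ y in 𝓝[>] (0 : ℝ), E N y = 0 := by
    intro N
    filter_upwards [eventually_lt_one_nhdsGT_zero] with y hy
    simp [hE, invPowTail_of_le _ hy.le]
  have hlow : ∀ N, (fun y => F y - E N y) =O[𝓝[>] 0] fun y : ℝ => y ^ (-(0 : ℝ)) := by
    intro N
    simp only [neg_zero, Real.rpow_zero]
    refine h0.congr' ?_ EventuallyEq.rfl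
    filter_upwards [hE0 N] with y hy
    rw [hy, sub_zero]
  have hup : ∀ N : ℕ, (fun y => F y - E N y) =O[atTop] fun y : ℝ => y ^ (-((N + 1 : ℕ) : ℝ)) := by
    intro N
    refine (hinf N).congr' ?_ ?_
    · filter_upwards [eventually_gt_atTop 1] with y hy
      simp only [hE, invPowTail_of_lt _ hy, smul_eq_mul, real_smul]
      simp [div_eq_mul_inv]
    · filter_upwards [eventually_gt_atTop 0] with y hy
      rw [Real.rpow_neg hy.le, Real.rpow_natCast]
  have hconv : ∀ (N : ℕ) (S : ℂ), 0 < S.re → S.re < N + 1 →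
      MellinConvergent (fun y => F y - E N y) S := fun N S hS hS' =>
    mellinConvergent_of_isBigO_rpow (hFl.sub (hEl N)) (hup N) (by simpa using hS') (hlow N) hS
  have hana : ∀ (N : ℕ) (S : ℂ), 0 < S.re → S.re < N + 1 → AnalyticAt ℂ (h N) S := by
    intro N S hS hS'
    have hU : IsOpen {s : ℂ | 0 < s.re ∧ s.re < N + 1} :=
      (isOpen_lt continuous_const continuous_re).inter (isOpen_lt continuous_re continuous_const)
    refine DifferentiableOn.analyticAt (s := {s : ℂ | 0 < s.re ∧ s.re < N + 1})
      (fun s hs => ?_) (hU.mem_nhds ⟨hS, hS'⟩)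
    exact (mellin_differentiableAt_of_isBigO_rpow (hFl.sub (hEl N)) (hup N)
      (by simpa using hs.2) (hlow N) hs.1).differentiableWithinAt
  have hstep : ∀ (N : ℕ) (S : ℂ), 0 < S.re → S.re < N + 1 →
      P N S + h N S = P (N + 1) S + h (N + 1) S := by
    intro N S hS hS'
    have h1 := hasMellin_invPowTail N hS'
    have h2 : (fun y => F y - E N y) = fun y => (F y - E (N + 1) y) + c N • invPowTail N y := by
      funext y
      simp only [hE, Finset.sum_range_succ]
      ring
    have h3 := hasMellin_add (hconv (N + 1) S hS (by push_cast; linarith))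
      (h1.1.const_smul (c N))
    have h4 : h N S = h (N + 1) S + c N * (-1 / (S - (N + 1))) := by
      simp only [hh]
      rw [h2, h3.2, mellin_const_smul, h1.2, smul_eq_mul]
    rw [h4]
    simp only [hP, Finset.sum_range_succ]
    ring
  have hstep' : ∀ (N k : ℕ) (S : ℂ), 0 < S.re → S.re < N + 1 →
      P N S + h N S = P (N + k) S + h (N + k) S := by
    intro N k S hS hS'
    induction k with
    | zero => rfl
    | succ k ih => rw [ih, ← add_assoc, hstep (N + k) S hS (by push_cast; linarith)]
  -- The truncation varies with `S`; by `hstep'` any larger one gives the same value, so `M` is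
  -- locally given by a fixed formula.
  set M : ℂ → ℂ := fun S => P ⌊S.re⌋₊ S + h ⌊S.re⌋₊ S with hM
  have hMN : ∀ (N : ℕ) (S : ℂ), 0 < S.re → S.re < N + 1 → M S = P N S + h N S := by
    intro N S hS hS'
    have h1 : ⌊S.re⌋₊ ≤ N := by
      rw [← Nat.lt_add_one_iff, Nat.floor_lt hS.le]; exact_mod_cast hS'
    obtain ⟨k, hk⟩ := Nat.exists_eq_add_of_le h1
    rw [hk]
    exact hstep' _ k S hS (Nat.lt_floor_add_one _)
  have hMev : ∀ (N : ℕ) (S : ℂ), 0 < S.re → S.re < N + 1 →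
      M =ᶠ[𝓝 S] fun s => P N s + h N s := by
    intro N S hS hS'
    filter_upwards [(isOpen_lt continuous_const continuous_re).mem_nhds hS,
      (isOpen_lt continuous_re continuous_const).mem_nhds hS'] with s h1 h2
    exact hMN N s h1 h2
  refine ⟨M, fun S hS hS' => ?_, fun S hS hne => ?_, fun n => ?_⟩
  · rw [hMN 0 S hS (by simpa using hS')]
    have h1 := hasMellin_add (hconv 0 S hS (by simpa using hS'))
      ((hasMellin_log_invPowTail hS').1.const_smul d)
    have h2 : F = fun y => (F y - E 0 y) + d • (Real.log y • invPowTail 0 y) := by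
      funext y
      simp [hE]
    conv_rhs => rw [h2, h1.2, mellin_const_smul, (hasMellin_log_invPowTail hS').2]
    simp only [hP, hh, Finset.sum_range_zero, smul_eq_mul]
    ring
  · refine AnalyticAt.congr ?_ (hMev ⌊S.re⌋₊ S hS (Nat.lt_floor_add_one _)).symm
    refine AnalyticAt.add ?_ (hana _ S hS (Nat.lt_floor_add_one _))
    have h1 : S - 1 ≠ 0 := sub_ne_zero.2 (by simpa using hne 0)
    refine AnalyticAt.sub (analyticAt_const.div (by fun_prop) (pow_ne_zero 2 h1)) ?_
    refine Finset.analyticAt_fun_sum _ fun n _ => ?_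
    exact analyticAt_const.div (by fun_prop) (sub_ne_zero.2 (hne n))
  · have hre : ((n : ℂ) + 1).re = n + 1 := by simp
    have hpos : 0 < ((n : ℂ) + 1).re := by rw [hre]; positivity
    -- Truncation `n + 1` is the first whose strip contains the point `n + 1` and whose model part
    -- contains the coefficient `c n`.
    have hlt : ((n : ℂ) + 1).re < ((n + 1 : ℕ) : ℝ) + 1 := by rw [hre]; push_cast; linarith
    refine HasPolarPart.congr ?_
      ((hMev (n + 1) _ hpos hlt).filter_mono nhdsWithin_le_nhds).symm
    have hd : HasPolarPart (fun s : ℂ => d / (s - 1) ^ 2) (n + 1) (if n = 0 then d else 0) 0 := by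
      by_cases hn : n = 0
      · subst hn
        exact ⟨fun _ => 0, analyticAt_const, by simp⟩
      · rw [if_neg hn]
        refine HasPolarPart.of_analyticAt (analyticAt_const.div (by fun_prop) (pow_ne_zero 2 ?_))
        simpa using hn
    have hs := HasPolarPart.sum (range (n + 1)) (p := (n : ℂ) + 1)
      (F := fun m s => -(c m) / (s - (m + 1))) (α := fun _ => 0)
      (β := fun m => if m = n then -c n else 0) (fun m _ => by
        by_cases hm : m = n
        · subst hm
          simp only [if_true]
          exact ⟨fun _ => 0, analyticAt_const, by simp⟩
        · simp only [if_neg hm]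
          refine HasPolarPart.of_analyticAt (analyticAt_const.div (by fun_prop) ?_)
          intro hc
          apply hm
          have : (n : ℂ) = m := by linear_combination hc
          exact_mod_cast this.symm)
    have := (hd.add hs).add (HasPolarPart.of_analyticAt (hana (n + 1) _ hpos hlt))
    simp only [Finset.sum_const_zero, add_zero, zero_add, Finset.sum_ite_eq', Finset.mem_range,
      Nat.lt_add_one, if_true] at this
    refine this.congr (Eventually.of_forall fun s => ?_)
    simp only [hP, neg_div, Finset.sum_neg_distrib]
    ring

/-! ### Mellin transforms of `(z + y)⁻¹` and `(z + y)^(-2)`. -/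

/-- With `θ = arg z` this says `‖z + y‖² ≥ (1 + cos θ)/2 · (‖z‖ + y)²`. The difference of the two
sides is `(‖z‖ - Re z)(‖z‖ - y)²`. -/
theorem norm_add_ofReal_sq_ge (z : ℂ) {y : ℝ} :
    (‖z‖ + z.re) * (‖z‖ + y) ^ 2 ≤ 2 * ‖z‖ * ‖z + y‖ ^ 2 := by
  have h1 : ‖z + y‖ ^ 2 = ‖z‖ ^ 2 + 2 * y * z.re + y ^ 2 := by
    rw [← normSq_eq_norm_sq, ← normSq_eq_norm_sq, normSq_apply, normSq_apply]
    simp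
    ring
  rw [h1]
  have h2 : 0 ≤ (‖z‖ - z.re) * (‖z‖ - y) ^ 2 :=
    mul_nonneg (sub_nonneg.2 (re_le_norm z)) (sq_nonneg _)
  nlinarith

theorem norm_add_re_pos {z : ℂ} (hz : z ∈ slitPlane) : 0 < ‖z‖ + z.re := by
  rcases hz with h | h
  · have := norm_nonneg z; linarith
  · have h1 : |z.re| < ‖z‖ := abs_re_lt_norm.2 h
    linarith [neg_abs_le z.re]

theorem add_ofReal_ne_zero {z : ℂ} (hz : z ∈ slitPlane) {y : ℝ} (hy : 0 ≤ y) : z + y ≠ 0 := by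
  rcases hz with h | h
  · intro h0
    have := congrArg re h0
    simp at this
    linarith
  · intro h0
    have := congrArg im h0
    simp at this
    exact h this

theorem mellinConvergent_inv_add_pow {z : ℂ} (hz : z ∈ slitPlane) {S : ℂ} (hS : 0 < S.re)
    (n : ℕ) (hS' : S.re < n) : MellinConvergent (fun y : ℝ => ((z + y) ^ n)⁻¹) S := by
  refine mellinConvergent_of_isBigO_rpow (a := n) (b := 0) ?_ ?_ hS' ?_ hS
  · refine ContinuousOn.locallyIntegrableOn ?_ measurableSet_Ioi
    exact ContinuousOn.inv₀ (by fun_prop) fun y hy =>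
      pow_ne_zero _ (add_ofReal_ne_zero hz (le_of_lt hy))
  · refine IsBigO.of_bound (2 ^ n) ?_
    filter_upwards [eventually_gt_atTop 0, eventually_ge_atTop (2 * ‖z‖)] with y hy hyz
    have h1 : y / 2 ≤ ‖z + y‖ := by
      have := norm_sub_norm_le (y : ℂ) (-z)
      rw [norm_neg, norm_real, Real.norm_of_nonneg hy.le, sub_neg_eq_add, add_comm _ z] at this
      linarith
    rw [norm_inv, norm_pow, Real.rpow_neg hy.le, Real.rpow_natCast, norm_inv, norm_pow,
      Real.norm_of_nonneg hy.le]
    calc (‖z + y‖ ^ n)⁻¹ ≤ ((y / 2) ^ n)⁻¹ := by gcongr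
      _ = 2 ^ n * (y ^ n)⁻¹ := by rw [div_pow, inv_div, div_eq_mul_inv]
  · simp only [neg_zero, Real.rpow_zero]
    have hc : ContinuousAt (fun y : ℝ => ((z + y) ^ n)⁻¹) 0 := by
      refine ContinuousAt.inv₀ (by fun_prop) ?_
      simpa using fun h => absurd h (slitPlane_ne_zero hz)
    exact (hc.isBigO_one ℝ).mono nhdsWithin_le_nhds

open MeasureTheory in
-- Writing `1/(r + y)` as the integral of `e^(-(r+y)t)` and exchanging integrals gives `Γ(S) Γ(1 -
-- S) r^(S-1)`; the reflection formula concludes.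
theorem mellin_inv_add_ofReal {r : ℝ} (hr : 0 < r) {S : ℂ} (hS : 0 < S.re) (hS' : S.re < 1) :
    mellin (fun y : ℝ => ((r : ℂ) + y)⁻¹) S = (r : ℂ) ^ (S - 1) * (Real.pi / sin (Real.pi * S)) := by
  have hrs : (r : ℂ) ∈ slitPlane := by simpa using hr
  set Φ : ℝ → ℝ → ℂ := fun y t => (y : ℂ) ^ (S - 1) * exp (-((r : ℂ) + y) * t) with hΦ
  have hconv : MellinConvergent (fun y : ℝ => ((r : ℂ) + y)⁻¹) S := by
    simpa using mellinConvergent_inv_add_pow hrs hS 1 (by simpa using hS')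
  have hre : ∀ y : ℝ, 0 < y → (-((r : ℂ) + y)).re < 0 := fun y hy => by simp; linarith
  have h1 : ∀ y ∈ Set.Ioi (0 : ℝ), ∫ t in Set.Ioi (0 : ℝ), Φ y t =
      (y : ℂ) ^ (S - 1) • ((r : ℂ) + y)⁻¹ := by
    intro y hy
    simp only [hΦ]
    rw [integral_const_mul, integral_exp_mul_complex_Ioi (hre y hy), smul_eq_mul]
    simp only [ofReal_zero, mul_zero, exp_zero, div_neg, neg_div, neg_neg, one_div]
  have h2 : ∀ t ∈ Set.Ioi (0 : ℝ), ∫ y in Set.Ioi (0 : ℝ), Φ y t =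
      Gamma S * ((t : ℂ) ^ ((1 - S) - 1) * exp (-((r : ℂ) * t))) := by
    intro t ht
    have h3 : ∀ y : ℝ, Φ y t =
        exp (-((r : ℂ) * t)) * ((y : ℂ) ^ (S - 1) * exp (-((t : ℂ) * y))) := by
      intro y
      simp only [hΦ]
      rw [mul_left_comm, ← exp_add]
      congr 2
      ring
    simp only [h3]
    rw [integral_const_mul, integral_cpow_mul_exp_neg_mul_Ioi hS ht, one_div,
      inv_cpow _ _ (by rw [arg_ofReal_of_nonneg (le_of_lt ht)]; exact Real.pi_pos.ne),
      ← cpow_neg]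
    rw [show (1 : ℂ) - S - 1 = -S by ring]
    ring
  have hint : Integrable (Function.uncurry Φ)
      ((volume.restrict (Set.Ioi (0 : ℝ))).prod (volume.restrict (Set.Ioi (0 : ℝ)))) := by
    rw [integrable_prod_iff]
    · constructor
      · refine (ae_restrict_iff' measurableSet_Ioi).2 (Eventually.of_forall fun y hy => ?_)
        exact (integrableOn_exp_mul_complex_Ioi (hre y hy) 0).const_mul ((y : ℂ) ^ (S - 1))
      · refine Integrable.congr hconv.norm ?_
        refine (ae_restrict_iff' measurableSet_Ioi).2 (Eventually.of_forall fun y hy => ?_)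
        have hy0 : (0 : ℝ) < y := hy
        simp only [Function.uncurry, hΦ, norm_mul, norm_exp]
        rw [integral_const_mul, norm_smul]
        congr 1
        have : ∀ t : ℝ, (-((r : ℂ) + y) * t).re = -(r + y) * t := fun t => by simp
        simp only [this]
        rw [integral_exp_mul_Ioi (by linarith), norm_inv, ← ofReal_add, norm_real,
          Real.norm_of_nonneg (by positivity), mul_zero, Real.exp_zero, neg_div_neg_eq, one_div]
    · rw [Measure.prod_restrict]
      refine ContinuousOn.aestronglyMeasurable ?_ (measurableSet_Ioi.prod measurableSet_Ioi)
      simp only [Function.uncurry_def, hΦ]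
      refine ContinuousOn.mul ?_ (by fun_prop)
      refine ContinuousOn.cpow_const (by fun_prop) fun p hp => ?_
      simpa using hp.1
  rw [mellin, setIntegral_congr_fun measurableSet_Ioi (fun y hy => (h1 y hy).symm),
    integral_integral_swap hint, setIntegral_congr_fun measurableSet_Ioi h2,
    integral_const_mul, integral_cpow_mul_exp_neg_mul_Ioi (by simpa using hS') hr,
    ← Complex.Gamma_mul_Gamma_one_sub, one_div,
    inv_cpow _ _ (by rw [arg_ofReal_of_nonneg hr.le]; exact Real.pi_pos.ne), ← cpow_neg,
    neg_sub]
  ring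

open MeasureTheory in
theorem hasDerivAt_mellin_inv_add {z : ℂ} (hz : z ∈ slitPlane) {S : ℂ} (hS : 0 < S.re)
    (hS' : S.re < 1) : HasDerivAt (fun z : ℂ => mellin (fun y : ℝ => (z + y)⁻¹) S)
      (-mellin (fun y : ℝ => ((z + y) ^ 2)⁻¹) S) z := by
  have hz0 : 0 < ‖z‖ := norm_pos_iff.2 (slitPlane_ne_zero hz)
  -- The angular constant `(1 + cos θ)/2`. It is continuous at `z`, so on `U` it stays above half
  -- its value, and one integrable function dominates all derivatives.
  set κ : ℂ → ℝ := fun w => (‖w‖ + w.re) / (2 * ‖w‖) with hκ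
  have hκz : 0 < κ z := div_pos (norm_add_re_pos hz) (by positivity)
  have hκc : ContinuousAt κ z :=
    ContinuousAt.div (by fun_prop) (by fun_prop) (by positivity)
  set U : Set ℂ := {w | w ∈ slitPlane ∧ κ z / 2 < κ w ∧ ‖z‖ / 2 < ‖w‖} with hU
  have hUn : U ∈ 𝓝 z := by
    refine Filter.inter_mem (isOpen_slitPlane.mem_nhds hz) (Filter.inter_mem ?_ ?_)
    · exact hκc.eventually (lt_mem_nhds (by linarith))
    · exact continuous_norm.continuousAt.eventually (lt_mem_nhds (by linarith))
  have hr : ((‖z‖ / 2 : ℝ) : ℂ) ∈ slitPlane := by rw [ofReal_mem_slitPlane]; positivity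
  have hconv1 : ∀ w ∈ slitPlane, MellinConvergent (fun y : ℝ => (w + y)⁻¹) S := fun w hw => by
    simpa using mellinConvergent_inv_add_pow hw hS 1 (by simpa using hS')
  have hconv2 : ∀ w ∈ slitPlane, MellinConvergent (fun y : ℝ => ((w + y) ^ 2)⁻¹) S := fun w hw =>
    mellinConvergent_inv_add_pow hw hS 2 (by push_cast; linarith)
  have := hasDerivAt_integral_of_dominated_loc_of_deriv_le (𝕜 := ℂ)
    (μ := volume.restrict (Set.Ioi (0 : ℝ))) (x₀ := z) (s := U)
    (F := fun w y => (y : ℂ) ^ (S - 1) • (w + y)⁻¹)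
    (F' := fun w y => (y : ℂ) ^ (S - 1) • (-((w + y) ^ 2)⁻¹))
    (bound := fun y => (κ z / 2)⁻¹ *
      ‖(y : ℂ) ^ (S - 1) • ((((‖z‖ / 2 : ℝ) : ℂ) + y) ^ 2)⁻¹‖) hUn ?_ (hconv1 z hz) ?_ ?_ ?_ ?_
  · refine this.2.congr_deriv ?_
    simp only [smul_neg, mellin]
    rw [integral_neg]
  · filter_upwards [isOpen_slitPlane.mem_nhds hz] with w hw
    exact (hconv1 w hw).aestronglyMeasurable
  · have := (hconv2 z hz).aestronglyMeasurable.neg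
    refine this.congr (Eventually.of_forall fun y => ?_)
    simp
  · refine (ae_restrict_iff' measurableSet_Ioi).2 (Eventually.of_forall fun y hy w hw => ?_)
    have hy0 : (0 : ℝ) < y := hy
    have hwp : 0 < ‖w‖ := lt_trans (by positivity) hw.2.2
    rw [norm_smul, norm_smul, mul_left_comm]
    gcongr
    rw [norm_neg, norm_inv, norm_inv, ← mul_inv, norm_pow, norm_pow, ← ofReal_add, norm_real,
      Real.norm_of_nonneg (by positivity)]
    gcongr
    have h1 := norm_add_ofReal_sq_ge w (y := y)
    have h2 : κ z / 2 * (‖w‖ + y) ^ 2 ≤ ‖w + y‖ ^ 2 := by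
      have h3 : κ w * (‖w‖ + y) ^ 2 ≤ ‖w + y‖ ^ 2 := by
        simp only [hκ]
        rw [div_mul_eq_mul_div, div_le_iff₀ (by positivity)]
        linarith
      have h4 := hw.2.1
      exact le_trans (by gcongr) h3
    refine le_trans ?_ h2
    have h5 := hw.2.2
    gcongr
  · exact ((hconv2 _ hr).norm).const_mul _
  · refine (ae_restrict_iff' measurableSet_Ioi).2 (Eventually.of_forall fun y hy w hw => ?_)
    have hne := add_ofReal_ne_zero hw.1 (le_of_lt (show (0 : ℝ) < y from hy))
    have h1 := (((hasDerivAt_id w).add_const (y : ℂ)).fun_inv hne).const_smul ((y : ℂ) ^ (S - 1))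
    refine h1.congr_deriv ?_
    simp [div_eq_mul_inv]

/-- Both sides are holomorphic on the slit plane and agree on the positive reals, which accumulate
at 1. -/
theorem mellin_inv_add {z : ℂ} (hz : z ∈ slitPlane) {S : ℂ} (hS : 0 < S.re) (hS' : S.re < 1) :
    mellin (fun y : ℝ => (z + y)⁻¹) S = z ^ (S - 1) * (Real.pi / sin (Real.pi * S)) := by
  have hf : AnalyticOnNhd ℂ (fun z : ℂ => mellin (fun y : ℝ => (z + y)⁻¹) S) slitPlane :=
    DifferentiableOn.analyticOnNhd (fun w hw =>
      (hasDerivAt_mellin_inv_add hw hS hS').differentiableAt.differentiableWithinAt)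
      isOpen_slitPlane
  have hg : AnalyticOnNhd ℂ (fun z : ℂ => z ^ (S - 1) * (Real.pi / sin (Real.pi * S)))
      slitPlane := by
    refine DifferentiableOn.analyticOnNhd (fun w hw => ?_) isOpen_slitPlane
    exact (((hasStrictDerivAt_cpow_const hw).hasDerivAt.differentiableAt).mul_const
      _).differentiableWithinAt
  have hU : IsPreconnected slitPlane :=
    (starConvex_one_slitPlane.isPathConnected one_mem_slitPlane).isConnected.isPreconnected
  refine hf.eqOn_of_preconnected_of_frequently_eq hg hU one_mem_slitPlane ?_ hz
  have ht : Tendsto (fun x : ℝ => (x : ℂ)) (𝓝[≠] 1) (𝓝[≠] 1) := by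
    refine tendsto_nhdsWithin_iff.2 ⟨?_, ?_⟩
    · exact (continuous_ofReal.tendsto' 1 1 (by simp)).mono_left nhdsWithin_le_nhds
    · filter_upwards [self_mem_nhdsWithin] with x hx
      simpa using hx
  refine ht.frequently (Eventually.frequently ?_)
  filter_upwards [(lt_mem_nhds (zero_lt_one (α := ℝ))).filter_mono nhdsWithin_le_nhds] with x hx
  exact mellin_inv_add_ofReal hx hS hS'

theorem mellin_inv_add_sq {z : ℂ} (hz : z ∈ slitPlane) {S : ℂ} (hS : 0 < S.re) (hS' : S.re < 1) :
    mellin (fun y : ℝ => ((z + y) ^ 2)⁻¹) S =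
      z ^ (S - 2) * ((1 - S) * Real.pi / sin (Real.pi * S)) := by
  have h1 := hasDerivAt_mellin_inv_add hz hS hS'
  have h2 : HasDerivAt (fun z : ℂ => z ^ (S - 1) * (Real.pi / sin (Real.pi * S)))
      ((S - 1) * z ^ (S - 1 - 1) * (Real.pi / sin (Real.pi * S))) z :=
    (hasStrictDerivAt_cpow_const hz).hasDerivAt.mul_const _
  have h3 := h1.unique (h2.congr_of_eventuallyEq (by
    filter_upwards [isOpen_slitPlane.mem_nhds hz] with w hw using mellin_inv_add hw hS hS'))
  rw [show S - 2 = S - 1 - 1 by ring]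
  linear_combination -h3

open MeasureTheory in
-- The majorant uses the real exponent `Re S`, where the integrand is positive, so the integral of
-- its norm is a Mellin transform available in closed form.
theorem integral_norm_mellin_le {F : ℝ → ℂ} {C r : ℝ} {n : ℕ} {S : ℂ} (hr : 0 < r)
    (hS : 0 < S.re) (hS' : S.re < n)
    (hF : ∀ y : ℝ, 0 < y → ‖F y‖ ≤ C * ((r + y) ^ n)⁻¹) :
    ∫ y in Set.Ioi (0 : ℝ), ‖(y : ℂ) ^ (S - 1) • F y‖ ≤
      C * ‖mellin (fun y : ℝ => (((r : ℂ) + y) ^ n)⁻¹) (S.re : ℂ)‖ := by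
  have hrs : (r : ℂ) ∈ slitPlane := by simpa using hr
  have hconv := mellinConvergent_inv_add_pow hrs (S := (S.re : ℂ)) (by simpa using hS) n
    (by simpa using hS')
  have hnorm : ∀ y ∈ Set.Ioi (0 : ℝ), ‖(y : ℂ) ^ ((S.re : ℂ) - 1) • (((r : ℂ) + y) ^ n)⁻¹‖ =
      y ^ (S.re - 1) * ((r + y) ^ n)⁻¹ := by
    intro y hy
    have hy0 : (0 : ℝ) < y := hy
    rw [norm_smul, norm_cpow_eq_rpow_re_of_pos hy0, norm_inv, norm_pow, ← ofReal_add, norm_real,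
      Real.norm_of_nonneg (by positivity)]
    simp
  have hcomplex : ∀ y ∈ Set.Ioi (0 : ℝ), (y : ℂ) ^ ((S.re : ℂ) - 1) • (((r : ℂ) + y) ^ n)⁻¹ =
      ((y ^ (S.re - 1) * ((r + y) ^ n)⁻¹ : ℝ) : ℂ) := by
    intro y hy
    have hy0 : (0 : ℝ) < y := hy
    push_cast
    rw [ofReal_cpow hy0.le]
    push_cast
    rfl
  have hm : ‖mellin (fun y : ℝ => (((r : ℂ) + y) ^ n)⁻¹) (S.re : ℂ)‖ =
      ∫ y in Set.Ioi (0 : ℝ), y ^ (S.re - 1) * ((r + y) ^ n)⁻¹ := by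
    rw [mellin, setIntegral_congr_fun measurableSet_Ioi hcomplex, integral_complex_ofReal, norm_real,
      Real.norm_of_nonneg]
    refine setIntegral_nonneg measurableSet_Ioi fun y hy => ?_
    have hy0 : (0 : ℝ) < y := hy
    positivity
  rw [hm, ← integral_const_mul]
  refine integral_mono_of_nonneg (Eventually.of_forall fun y => norm_nonneg _) ?_ ?_
  · refine Integrable.const_mul ?_ C
    exact Integrable.congr hconv.norm ((ae_restrict_iff' measurableSet_Ioi).2
      (Eventually.of_forall hnorm))
  · refine (ae_restrict_iff' measurableSet_Ioi).2 (Eventually.of_forall fun y hy => ?_)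
    have hy0 : (0 : ℝ) < y := hy
    beta_reduce
    rw [norm_smul, norm_cpow_eq_rpow_re_of_pos hy0]
    simp only [sub_re, one_re]
    rw [mul_left_comm]
    gcongr
    exact hF y hy0

open MeasureTheory in
theorem hasSum_mellin_of_summable {ι : Type*} [Countable ι] {F : ι → ℝ → ℂ} {S : ℂ}
    (hF : ∀ i, MellinConvergent (F i) S)
    (hs : Summable fun i => ∫ y in Set.Ioi (0 : ℝ), ‖(y : ℂ) ^ (S - 1) • F i y‖) :
    HasSum (fun i => mellin (F i) S) (mellin (fun y => ∑' i, F i y) S) := by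
  have := hasSum_integral_of_summable_integral_norm (μ := volume.restrict (Set.Ioi (0 : ℝ))) hF hs
  simp only [smul_eq_mul, tsum_mul_left] at this
  exact this

/-! ### Termwise Mellin transforms over families. -/

/-- A family of complex numbers staying away from the negative real axis, in angle. -/
def AwayFromNegative {ι : Type*} (z : ι → ℂ) : Prop :=
  (∀ i, z i ∈ slitPlane) ∧
    ∃ C : ℝ, 0 < C ∧ ∀ i, ∀ y : ℝ, 0 ≤ y → ‖z i‖ + y ≤ C * ‖z i + y‖

namespace AwayFromNegative

variable {ι : Type*} {z : ι → ℂ}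

theorem norm_inv_le (h : AwayFromNegative z) : ∃ C : ℝ, 0 < C ∧ ∀ i, ∀ y : ℝ, 0 ≤ y → ∀ n : ℕ,
    ‖((z i + y) ^ n)⁻¹‖ ≤ C ^ n * ((‖z i‖ + y) ^ n)⁻¹ := by
  obtain ⟨hz, C, hC, hb⟩ := h
  refine ⟨C, hC, fun i y hy n => ?_⟩
  have h1 : 0 < ‖z i‖ := norm_pos_iff.2 (slitPlane_ne_zero (hz i))
  have h2 : 0 < ‖z i + y‖ := norm_pos_iff.2 (add_ofReal_ne_zero (hz i) hy)
  rw [norm_inv, norm_pow, ← div_eq_mul_inv, le_div_iff₀ (by positivity), inv_mul_le_iff₀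
    (by positivity), ← mul_pow]
  have h3 := hb i y hy
  rw [mul_comm] at h3
  gcongr

/-- Replacing `z i` by `‖z i‖` costs a uniform constant; the exact formula at positive reals then
bounds the `i`-th integral of norms by a multiple of `‖z i‖^(Re S - 1)`. -/
theorem hasSum_mellin_inv [Countable ι] (h : AwayFromNegative z) {S : ℂ} (hS : 0 < S.re)
    (hS' : S.re < 1) (hs : Summable fun i => ‖z i‖ ^ (S.re - 1)) :
    HasSum (fun i => z i ^ (S - 1) * (Real.pi / sin (Real.pi * S)))
      (mellin (fun y : ℝ => ∑' i, (z i + y)⁻¹) S) := by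
  obtain ⟨C, hC, hb⟩ := h.norm_inv_le
  have hpos : ∀ i, 0 < ‖z i‖ := fun i => norm_pos_iff.2 (slitPlane_ne_zero (h.1 i))
  have hconv : ∀ i, MellinConvergent (fun y : ℝ => (z i + y)⁻¹) S := fun i => by
    simpa using mellinConvergent_inv_add_pow (h.1 i) hS 1 (by simpa using hS')
  have := hasSum_mellin_of_summable hconv ?_
  · simpa only [mellin_inv_add (h.1 _) hS hS'] using this
  · refine Summable.of_nonneg_of_le (fun i => MeasureTheory.integral_nonneg fun y => norm_nonneg _)
      (fun i => integral_norm_mellin_le (n := 1) (hpos i) hS (by simpa using hS') (C := C)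
        fun y hy => by simpa using hb i y hy.le 1) ?_
    refine Summable.mul_left C ?_
    refine (hs.mul_right ‖(Real.pi : ℂ) / sin (Real.pi * (S.re : ℂ))‖).congr fun i => ?_
    simp only [pow_one]
    rw [mellin_inv_add (by simpa using hpos i) (by simpa using hS) (by simpa using hS'),
      norm_mul, norm_cpow_eq_rpow_re_of_pos (hpos i)]
    simp

theorem hasSum_mellin_inv_sq [Countable ι] (h : AwayFromNegative z) {S : ℂ} (hS : 0 < S.re)
    (hS' : S.re < 1) (hs : Summable fun i => ‖z i‖ ^ (S.re - 2)) :
    HasSum (fun i => z i ^ (S - 2) * ((1 - S) * Real.pi / sin (Real.pi * S)))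
      (mellin (fun y : ℝ => ∑' i, ((z i + y) ^ 2)⁻¹) S) := by
  obtain ⟨C, hC, hb⟩ := h.norm_inv_le
  have hpos : ∀ i, 0 < ‖z i‖ := fun i => norm_pos_iff.2 (slitPlane_ne_zero (h.1 i))
  have hconv : ∀ i, MellinConvergent (fun y : ℝ => ((z i + y) ^ 2)⁻¹) S := fun i =>
    mellinConvergent_inv_add_pow (h.1 i) hS 2 (by push_cast; linarith)
  have := hasSum_mellin_of_summable hconv ?_
  · simpa only [mellin_inv_add_sq (h.1 _) hS hS'] using this
  · refine Summable.of_nonneg_of_le (fun i => MeasureTheory.integral_nonneg fun y => norm_nonneg _)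
      (fun i => integral_norm_mellin_le (n := 2) (hpos i) hS (by push_cast; linarith) (C := C ^ 2)
        fun y hy => hb i y hy.le 2) ?_
    refine Summable.mul_left (C ^ 2) ?_
    refine (hs.mul_right ‖(1 - (S.re : ℂ)) * Real.pi / sin (Real.pi * (S.re : ℂ))‖).congr
      fun i => ?_
    rw [mellin_inv_add_sq (by simpa using hpos i) (by simpa using hS) (by simpa using hS'),
      norm_mul, norm_cpow_eq_rpow_re_of_pos (hpos i)]
    simp

end AwayFromNegative

/-! ### Asymptotic expansions in inverse powers. -/

/-- `f y ~ ∑ c n y ^ (-n-1)` as `y → +∞`. -/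
def HasInvExpansion (f : ℝ → ℂ) (c : ℕ → ℂ) : Prop :=
  ∀ N : ℕ, (fun y : ℝ => f y - ∑ n ∈ range N, c n * ((y : ℂ) ^ (n + 1))⁻¹) =O[atTop]
    fun y : ℝ => (y ^ (N + 1))⁻¹

theorem isBigO_inv_pow_of_le {m n : ℕ} (h : n ≤ m) :
    (fun y : ℝ => (y ^ m)⁻¹) =O[atTop] fun y : ℝ => (y ^ n)⁻¹ := by
  refine IsBigO.of_bound 1 ?_
  filter_upwards [eventually_ge_atTop 1] with y hy
  have h0 : 0 < y := by linarith
  rw [one_mul, Real.norm_of_nonneg (by positivity), Real.norm_of_nonneg (by positivity)]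
  gcongr

namespace HasInvExpansion

variable {f g : ℝ → ℂ} {b c : ℕ → ℂ}

theorem add (hf : HasInvExpansion f b) (hg : HasInvExpansion g c) :
    HasInvExpansion (fun y => f y + g y) (fun n => b n + c n) := by
  intro N
  refine ((hf N).add (hg N)).congr_left fun y => ?_
  simp only [add_mul, Finset.sum_add_distrib]
  ring

theorem const_mul (hf : HasInvExpansion f c) (a : ℂ) :
    HasInvExpansion (fun y => a * f y) (fun n => a * c n) := by
  intro N
  refine ((hf N).const_mul_left a).congr_left fun y => ?_
  rw [mul_sub, Finset.mul_sum]
  simp only [mul_assoc]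

theorem zero : HasInvExpansion (fun _ => 0) (fun _ => 0) := by
  intro N
  simpa using isBigO_zero (fun y : ℝ => (y ^ (N + 1))⁻¹) atTop

theorem sum {ι : Type*} (t : Finset ι) {F : ι → ℝ → ℂ} {C : ι → ℕ → ℂ}
    (h : ∀ i ∈ t, HasInvExpansion (F i) (C i)) :
    HasInvExpansion (fun y => ∑ i ∈ t, F i y) (fun n => ∑ i ∈ t, C i n) := by
  classical
  induction t using Finset.induction_on with
  | empty => simpa using zero
  | insert j t hj ih =>
    simp only [Finset.sum_insert hj]
    exact (h j (Finset.mem_insert_self _ _)).add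
      (ih fun i hi => h i (Finset.mem_insert_of_mem hi))

/-- An expansion may be checked on approximations of every order. -/
theorem of_approx (h : ∀ K : ℕ, ∃ (g : ℝ → ℂ) (b : ℕ → ℂ), HasInvExpansion g b ∧
    (∀ n < K, b n = c n) ∧ (fun y => f y - g y) =O[atTop] fun y : ℝ => (y ^ (K + 1))⁻¹) :
    HasInvExpansion f c := by
  intro N
  obtain ⟨g, b, hg, hb, hfg⟩ := h N
  refine (hfg.add (hg N)).congr_left fun y => ?_
  rw [Finset.sum_congr rfl fun n hn => by rw [hb n (Finset.mem_range.1 hn)]]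
  ring

theorem congr (hf : HasInvExpansion f c) (h : f =ᶠ[atTop] g) : HasInvExpansion g c := by
  intro N
  refine (hf N).congr' ?_ EventuallyEq.rfl
  filter_upwards [h] with y hy
  rw [hy]

theorem of_isBigO (h : ∀ N : ℕ, f =O[atTop] fun y : ℝ => (y ^ N)⁻¹) :
    HasInvExpansion f (fun _ => 0) := by
  intro N
  simpa using h (N + 1)

/-- A convergent expansion is an asymptotic expansion. -/
theorem of_hasSum (h : ∀ᶠ y : ℝ in atTop, HasSum (fun n => c n * ((y : ℂ) ^ (n + 1))⁻¹) (f y)) :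
    HasInvExpansion f c := by
  intro N
  obtain ⟨Y, hY⟩ := eventually_atTop.1 h
  set Y₁ : ℝ := max Y 1 with hY₁
  have hY₁0 : 0 < Y₁ := by positivity
  have hs := (hY Y₁ (le_max_left _ _)).summable.norm
  set T : ℝ := ∑' n, ‖c (n + N) * ((Y₁ : ℂ) ^ (n + N + 1))⁻¹‖ with hT
  have hsN := (summable_nat_add_iff N).2 hs
  refine IsBigO.of_bound (T * Y₁ ^ (N + 1)) ?_
  filter_upwards [eventually_ge_atTop Y₁] with y hy
  have hy0 : 0 < y := hY₁0.trans_le hy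
  have h1 := hY y ((le_max_left _ _).trans hy)
  have h2 : f y - ∑ n ∈ range N, c n * ((y : ℂ) ^ (n + 1))⁻¹ =
      ∑' n, c (n + N) * ((y : ℂ) ^ (n + N + 1))⁻¹ := by
    rw [← h1.tsum_eq, ← h1.summable.sum_add_tsum_nat_add N, add_sub_cancel_left]
  have hle : ∀ n, ‖c (n + N) * ((y : ℂ) ^ (n + N + 1))⁻¹‖ ≤
      ‖c (n + N) * ((Y₁ : ℂ) ^ (n + N + 1))⁻¹‖ * (Y₁ ^ (N + 1) * (y ^ (N + 1))⁻¹) := by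
    intro n
    rw [norm_mul, norm_mul, mul_assoc]
    gcongr
    simp only [norm_inv, norm_pow, norm_real, Real.norm_of_nonneg hy0.le,
      Real.norm_of_nonneg hY₁0.le]
    rw [add_assoc, pow_add, pow_add Y₁, mul_inv, mul_inv]
    calc (y ^ n)⁻¹ * (y ^ (N + 1))⁻¹ ≤ (Y₁ ^ n)⁻¹ * (y ^ (N + 1))⁻¹ := by gcongr
      _ = _ := by field_simp
  rw [h2, Real.norm_of_nonneg (by positivity : 0 ≤ (y ^ (N + 1))⁻¹), mul_assoc]
  refine tsum_of_norm_bounded ?_ hle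
  exact hsN.hasSum.mul_right _

theorem inv_id_mul (hf : HasInvExpansion f c) :
    HasInvExpansion (fun y => (y : ℂ)⁻¹ * f y) (fun n => if n = 0 then 0 else c (n - 1)) := by
  intro N
  cases N with
  | zero =>
    have h1 : (fun y : ℝ => (y : ℂ)⁻¹) =O[atTop] fun y : ℝ => (y ^ 1)⁻¹ :=
      isBigO_of_le _ fun y => by simp
    have h2 := h1.mul (hf 0)
    simp only [Finset.sum_range_zero, sub_zero] at h2 ⊢
    refine h2.trans ?_
    refine (isBigO_inv_pow_of_le (show 0 + 1 ≤ 2 by norm_num)).congr_left fun y => ?_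
    rw [zero_add, pow_one, pow_two, mul_inv_rev]
  | succ N =>
    have h1 : (fun y : ℝ => (y : ℂ)⁻¹) =O[atTop] fun y : ℝ => (y ^ 1)⁻¹ :=
      isBigO_of_le _ fun y => by simp
    refine (h1.mul (hf N)).congr (fun y => ?_) fun y => ?_
    · rw [Finset.sum_range_succ', mul_sub, Finset.mul_sum]
      simp only [Nat.add_eq_zero_iff, one_ne_zero, and_false, if_false, if_true, zero_mul, add_zero,
        Nat.add_sub_cancel]
      congr 1
      refine Finset.sum_congr rfl fun n _ => ?_
      rw [pow_succ _ (n + 1), mul_inv]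
      ring
    · rw [pow_succ _ (N + 1), mul_inv, pow_one, mul_comm]

end HasInvExpansion

theorem hasInvExpansion_inv : HasInvExpansion (fun y => (y : ℂ)⁻¹)
    (fun n => if n = 0 then 1 else 0) := by
  refine HasInvExpansion.of_hasSum (Eventually.of_forall fun y => ?_)
  have := hasSum_ite_eq (0 : ℕ) ((y : ℂ)⁻¹)
  refine this.congr_fun fun n => ?_
  by_cases hn : n = 0
  · subst hn; simp
  · simp [hn]

/-- The negative binomial series in `-h / y`. For `n < j` the binomial coefficient vanishes, so the
truncated exponent `n - j` is harmless there. -/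
theorem hasInvExpansion_inv_add_pow (h : ℂ) (j : ℕ) :
    HasInvExpansion (fun y => ((h + y) ^ (j + 1))⁻¹)
      (fun n => (n.choose j : ℂ) * (-h) ^ (n - j)) := by
  refine HasInvExpansion.of_hasSum ?_
  filter_upwards [eventually_gt_atTop (‖h‖)] with y hy
  have hy0 : 0 < y := (norm_nonneg h).trans_lt hy
  have hyc : (y : ℂ) ≠ 0 := ofReal_ne_zero.2 hy0.ne'
  have hr : ‖-h / (y : ℂ)‖ < 1 := by
    rw [norm_div, norm_neg, norm_real, Real.norm_of_nonneg hy0.le, div_lt_one hy0]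
    exact hy
  have hne : h + y ≠ 0 := by
    intro h0
    rw [eq_neg_of_add_eq_zero_left h0, norm_neg, norm_real, Real.norm_of_nonneg hy0.le] at hy
    exact lt_irrefl _ hy
  have h1 := (hasSum_choose_mul_geometric_of_norm_lt_one j hr).mul_right (((y : ℂ) ^ (j + 1))⁻¹)
  have h2 : 1 / (1 - -h / (y : ℂ)) ^ (j + 1) * (((y : ℂ) ^ (j + 1))⁻¹) =
      ((h + y) ^ (j + 1))⁻¹ := by
    rw [one_div, ← mul_inv, ← mul_pow]
    congr 2
    field_simp
    ring
  rw [h2] at h1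
  rw [← hasSum_nat_add_iff' j]
  have h3 : ∑ n ∈ range j, (n.choose j : ℂ) * (-h) ^ (n - j) * ((y : ℂ) ^ (n + 1))⁻¹ = 0 :=
    Finset.sum_eq_zero fun n hn => by
      rw [Nat.choose_eq_zero_of_lt (Finset.mem_range.1 hn)]; simp
  rw [h3, sub_zero]
  refine h1.congr_fun fun n => ?_
  rw [Nat.add_sub_cancel, div_pow, add_right_comm n j 1, add_assoc n 1, add_comm 1 j,
    pow_add _ n (j + 1)]
  field_simp

/-- Taking `h` real and positive makes all logarithms real, so no branch needs to be compared. -/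
theorem hasInvExpansion_log_add_sub (h : ℝ) (hh : 0 < h) :
    HasInvExpansion (fun y => log ((h : ℂ) + y) - Real.log y)
      (fun n => (-1) ^ n * (h : ℂ) ^ (n + 1) / (n + 1)) := by
  refine HasInvExpansion.of_hasSum ?_
  filter_upwards [eventually_gt_atTop h] with y hy
  have hy0 : 0 < y := hh.trans hy
  have hyc : (y : ℂ) ≠ 0 := ofReal_ne_zero.2 hy0.ne'
  have hr : ‖(h : ℂ) / (y : ℂ)‖ < 1 := by
    rw [norm_div, norm_real, norm_real, Real.norm_of_nonneg hy0.le, Real.norm_of_nonneg hh.le,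
      div_lt_one hy0]
    exact hy
  have h1 := hasSum_taylorSeries_log hr
  have h2 : log (1 + (h : ℂ) / y) = log ((h : ℂ) + y) - Real.log y := by
    have e1 : (1 : ℂ) + (h : ℂ) / y = ((1 + h / y : ℝ) : ℂ) := by push_cast; rfl
    have e2 : (h : ℂ) + y = ((h + y : ℝ) : ℂ) := by push_cast; rfl
    rw [e1, e2, ← ofReal_log (by positivity), ← ofReal_log (by positivity), ← ofReal_sub,
      ← Real.log_div (by positivity) (by positivity)]
    congr 2
    rw [add_div, div_self hy0.ne', add_comm]
  rw [h2, ← hasSum_nat_add_iff' 1] at h1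
  simp only [Finset.range_one, Finset.sum_singleton, pow_zero, mul_one, Nat.cast_zero, div_zero,
    sub_zero] at h1
  refine h1.congr_fun fun n => ?_
  rw [div_pow]
  push_cast
  rw [show n + 1 + 1 = n + 2 by rfl, pow_add (-1 : ℂ) n 2]
  field_simp

theorem hasInvExpansion_inv_sub (h : ℂ) :
    HasInvExpansion (fun y => ((y : ℂ) - h)⁻¹) (fun n => h ^ n) := by
  have := hasInvExpansion_inv_add_pow (-h) 0
  simpa [sub_eq_neg_add] using this

/-! ### Stirling's expansion, differentiated and recentred at `1/2`. -/

theorem hasDerivAt_div_pow (c : ℂ) (n : ℕ) {z : ℂ} (hz : z ≠ 0) :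
    HasDerivAt (fun z : ℂ => c / z ^ n) (-(n * c / z ^ (n + 1))) z := by
  have h1 := (hasDerivAt_const z c).fun_div (hasDerivAt_pow n z) (pow_ne_zero n hz)
  refine h1.congr_deriv ?_
  cases n with
  | zero => simp
  | succ n =>
    simp only [Nat.add_sub_cancel]
    field_simp
    ring

theorem hasDerivAt_stirlingSum (a₁ b₁ a₀ b₀ : ℂ) (a : ℕ → ℂ) (N : ℕ) {z : ℂ}
    (hz : z ∈ slitPlane) : HasDerivAt (stirlingSum a₁ b₁ a₀ b₀ a N)
      (a₁ * log z + b₁ + a₀ / z - ∑ n ∈ Icc 1 N, n * a n / z ^ (n + 1)) z := by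
  have hz0 := slitPlane_ne_zero hz
  have hlog := hasDerivAt_log hz
  have h1 := ((((hasDerivAt_id z).const_mul a₁).mul (hlog.sub_const 1)).add
    ((hasDerivAt_id z).const_mul b₁)).add (hlog.const_mul a₀)
  have h2 := (h1.add_const b₀).add (HasDerivAt.fun_sum fun n (_ : n ∈ Icc 1 N) =>
    hasDerivAt_div_pow (a n) n hz0)
  refine h2.congr_deriv ?_
  rw [Finset.sum_neg_distrib]
  simp
  field_simp
  ring

theorem hasDerivAt_stirlingSum_deriv (a₁ b₁ a₀ : ℂ) (a : ℕ → ℂ) (N : ℕ) {z : ℂ}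
    (hz : z ∈ slitPlane) : HasDerivAt
      (fun z => a₁ * log z + b₁ + a₀ / z - ∑ n ∈ Icc 1 N, n * a n / z ^ (n + 1))
      (a₁ / z - a₀ / z ^ 2 + ∑ n ∈ Icc 1 N, n * (n + 1) * a n / z ^ (n + 2)) z := by
  have hz0 := slitPlane_ne_zero hz
  have h0 := hasDerivAt_div_pow a₀ 1 hz0
  have h1 := (((hasDerivAt_log hz).const_mul a₁).add_const b₁).add h0
  have h2 := h1.sub (HasDerivAt.fun_sum fun n (_ : n ∈ Icc 1 N) =>
    hasDerivAt_div_pow (n * a n) (n + 1) hz0)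
  have e : (fun z => a₁ * log z + b₁ + a₀ / z - ∑ n ∈ Icc 1 N, n * a n / z ^ (n + 1)) =
    (fun z => a₁ * log z + b₁ + a₀ / z ^ 1 - ∑ n ∈ Icc 1 N, n * a n / z ^ (n + 1)) := by
    simp only [pow_one]
  rw [e]
  refine h2.congr_deriv ?_
  rw [Finset.sum_neg_distrib, sub_neg_eq_add]
  congr 1
  · simp [div_eq_mul_inv]; ring
  · refine Finset.sum_congr rfl fun n _ => ?_
    push_cast
    ring

theorem ofReal_mem_slitPlane_of_pos {x : ℝ} (hx : 0 < x) : (x : ℂ) ∈ slitPlane := by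
  simpa using hx

theorem isBigO_comp_half_add {g : ℝ → ℂ} {k m : ℕ} (hkm : m ≤ k)
    (h : g =O[atTop] fun x : ℝ => (x ^ k)⁻¹) :
    (fun y : ℝ => g (1 / 2 + y)) =O[atTop] fun y : ℝ => (y ^ m)⁻¹ := by
  have h1 := h.comp_tendsto (tendsto_atTop_add_const_left atTop (1 / 2 : ℝ) tendsto_id)
  refine (h1.trans ?_).trans (isBigO_inv_pow_of_le hkm)
  refine IsBigO.of_bound 1 ?_
  filter_upwards [eventually_gt_atTop 0] with y hy
  simp only [Function.comp, id]
  rw [one_mul, Real.norm_of_nonneg (by positivity), Real.norm_of_nonneg (by positivity)]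
  gcongr
  linarith

section Stirling

variable {G logG : ℂ → ℂ} {a₁ b₁ a₀ b₀ : ℂ} {a : ℕ → ℂ}

theorem choose_mul_identity (n j : ℕ) (hj : 1 ≤ j) (hn : 1 ≤ n) :
    (j : ℂ) * (n.choose j : ℂ) = n * ((n - 1).choose (j - 1) : ℂ) := by
  obtain ⟨j, rfl⟩ := Nat.exists_eq_add_of_le' hj
  obtain ⟨n, rfl⟩ := Nat.exists_eq_add_of_le' hn
  have := Nat.add_one_mul_choose_eq n j
  simp only [Nat.add_sub_cancel]
  rw [mul_comm (((j + 1 : ℕ) : ℂ))]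
  exact_mod_cast this.symm

theorem neg_half_pow_sub {n j : ℕ} (h : j ≤ n) :
    (-(1 / 2 : ℂ)) ^ (n - j) = (-1) ^ n * (-1) ^ j * (1 / 2) ^ (n - j) := by
  obtain ⟨k, rfl⟩ := Nat.exists_eq_add_of_le h
  rw [Nat.add_sub_cancel_left, neg_pow, pow_add]
  congr 1
  have : ((-1 : ℂ) ^ j) * (-1) ^ j = 1 := by rw [← mul_pow]; simp
  linear_combination (-(-1 : ℂ) ^ k) * this

/-- Re-expanding the tail `∑ j a_j x^(-j-1)` at `x = 1/2 + y` produces exactly the sum in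
`tracePoly`; terms with `j > n` do not reach order `n`. -/
theorem sum_trace_coeff {n K : ℕ} (hn : n ≤ K) :
    ∑ j ∈ Icc 1 K, (j : ℂ) * a j * ((n.choose j : ℂ) * (-(1 / 2 : ℂ)) ^ (n - j)) =
      (-1) ^ n * (n * ∑ j ∈ Icc 1 n, (-1) ^ j * ((n - 1).choose (j - 1) : ℂ) * a j *
        (1 / 2) ^ (n - j)) := by
  have hsub : Icc 1 n ⊆ Icc 1 K := Finset.Icc_subset_Icc_right hn
  rw [← Finset.sum_subset hsub]
  · rw [Finset.mul_sum, Finset.mul_sum]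
    refine Finset.sum_congr rfl fun j hj => ?_
    rw [Finset.mem_Icc] at hj
    have h1 := choose_mul_identity n j hj.1 (hj.1.trans hj.2)
    rw [neg_half_pow_sub hj.2]
    linear_combination (a j * ((-1) ^ n * (-1) ^ j * (1 / 2) ^ (n - j))) * h1
  · intro j hjK hjn
    rw [Finset.mem_Icc] at hjK hjn
    rw [Nat.choose_eq_zero_of_lt (by omega)]
    simp

/-- Expansion of the logarithmic derivative of `G` about the centre `1 / 2`. -/
theorem hasInvExpansion_deriv_log
    (hlog : ∀ x : ℂ, 0 < x.re → AnalyticAt ℂ logG x)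
    (hasy : ∀ N p : ℕ, (fun x : ℝ =>
      iteratedDeriv p (fun z => -logG z - stirlingSum a₁ b₁ a₀ b₀ a N z) (x : ℂ))
        =O[atTop] fun x : ℝ => (x ^ (N + 1 + p))⁻¹) :
    HasInvExpansion (fun y : ℝ => -deriv logG (1 / 2 + y) - b₁ - a₁ * Real.log y)
      (fun n => (-1) ^ (n + 1) * tracePoly a₁ a₀ a n (1 / 2)) := by
  refine HasInvExpansion.of_approx fun K => ?_
  have h1 := (hasInvExpansion_log_add_sub (1 / 2) (by norm_num)).const_mul a₁
  have h2 := (hasInvExpansion_inv_add_pow (1 / 2) 0).const_mul a₀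
  have h3 := HasInvExpansion.sum (Icc 1 K) fun j _ =>
    (hasInvExpansion_inv_add_pow (1 / 2) j).const_mul (-(j * a j))
  refine ⟨_, _, (h1.add h2).add h3, fun n hn => ?_, ?_⟩
  · have h4 := sum_trace_coeff (a := a) hn.le
    simp only [neg_mul, Finset.sum_neg_distrib, tracePoly, h4, Nat.choose_zero_right, Nat.cast_one,
      Nat.sub_zero, one_mul]
    rw [neg_pow (1 / 2 : ℂ) n]
    push_cast
    ring
  · refine (isBigO_comp_half_add (k := K + 1 + 1) (by omega) (hasy K 1)).congr' ?_ EventuallyEq.rfl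
    filter_upwards [eventually_gt_atTop 0] with y hy
    have hx : 0 < 1 / 2 + y := by linarith
    have hxs := ofReal_mem_slitPlane_of_pos hx
    have h5 := ((hlog ((1 / 2 + y : ℝ) : ℂ)
      (by rw [ofReal_re]; exact hx)).differentiableAt.hasDerivAt.fun_neg).fun_sub
      (hasDerivAt_stirlingSum a₁ b₁ a₀ b₀ a K hxs)
    rw [iteratedDeriv_one, h5.deriv]
    push_cast
    simp only [div_eq_mul_inv, neg_mul, Finset.sum_neg_distrib, pow_one]
    ring

/-- The coefficients are those of the formal derivative of the previous expansion. Since asymptotic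
expansions cannot be differentiated in general, the case `p = 2` of the hypothesis is used instead.
-/
theorem hasInvExpansion_deriv_deriv_log
    (hlog : ∀ x : ℂ, 0 < x.re → AnalyticAt ℂ logG x)
    (hasy : ∀ N p : ℕ, (fun x : ℝ =>
      iteratedDeriv p (fun z => -logG z - stirlingSum a₁ b₁ a₀ b₀ a N z) (x : ℂ))
        =O[atTop] fun x : ℝ => (x ^ (N + 1 + p))⁻¹) :
    HasInvExpansion (fun y : ℝ => -deriv (deriv logG) (1 / 2 + y))
      (fun n => if n = 0 then a₁ else (-1) ^ (n - 1) * n * tracePoly a₁ a₀ a (n - 1) (1 / 2)) := by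
  refine HasInvExpansion.of_approx fun K => ?_
  have h1 := (hasInvExpansion_inv_add_pow (1 / 2) 0).const_mul a₁
  have h2 := (hasInvExpansion_inv_add_pow (1 / 2) 1).const_mul (-a₀)
  have h3 := HasInvExpansion.sum (Icc 1 K) fun j _ =>
    (hasInvExpansion_inv_add_pow (1 / 2) (j + 1)).const_mul (j * (j + 1) * a j)
  refine ⟨_, _, (h1.add h2).add h3, fun n hn => ?_, ?_⟩
  · cases n with
    | zero => simp
    | succ m =>
      have h4 := sum_trace_coeff (a := a) (show m ≤ K by omega)
      have h5 : ∑ j ∈ Icc 1 K, (j : ℂ) * (j + 1) * a j *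
          (((m + 1).choose (j + 1) : ℂ) * (-(1 / 2 : ℂ)) ^ (m + 1 - (j + 1))) =
          (m + 1) * ∑ j ∈ Icc 1 K, (j : ℂ) * a j * ((m.choose j : ℂ) * (-(1 / 2)) ^ (m - j)) := by
        rw [Finset.mul_sum]
        refine Finset.sum_congr rfl fun j _ => ?_
        have h6 : ((j : ℂ) + 1) * ((m + 1).choose (j + 1) : ℂ) = (m + 1) * (m.choose j : ℂ) := by
          have := choose_mul_identity (m + 1) (j + 1) (by omega) (by omega)
          simpa using this
        rw [Nat.add_sub_add_right]
        linear_combination (j * a j * (-(1 / 2 : ℂ)) ^ (m - j)) * h6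
      simp only [h5, h4, tracePoly, Nat.add_eq_zero_iff, one_ne_zero, and_false, if_false,
        Nat.add_sub_cancel, Nat.choose_zero_right, Nat.choose_one_right, Nat.sub_zero]
      rw [neg_pow (1 / 2 : ℂ) (m + 1), neg_pow (1 / 2 : ℂ) m]
      push_cast
      have : (m : ℂ) + 1 ≠ 0 := Nat.cast_add_one_ne_zero m
      field_simp
      ring
  · refine (isBigO_comp_half_add (k := K + 1 + 2) (by omega) (hasy K 2)).congr' ?_ EventuallyEq.rfl
    filter_upwards [eventually_gt_atTop 0] with y hy
    have hx : 0 < 1 / 2 + y := by linarith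
    have hxs := ofReal_mem_slitPlane_of_pos hx
    have hre : 0 < (((1 / 2 + y : ℝ) : ℂ)).re := by rw [ofReal_re]; exact hx
    have hev : deriv (fun z => -logG z - stirlingSum a₁ b₁ a₀ b₀ a K z) =ᶠ[𝓝 ((1 / 2 + y : ℝ) : ℂ)]
        fun z => -deriv logG z -
          (a₁ * log z + b₁ + a₀ / z - ∑ n ∈ Icc 1 K, n * a n / z ^ (n + 1)) := by
      filter_upwards [(isOpen_lt continuous_const continuous_re).mem_nhds hre] with w hw
      exact ((hlog w hw).differentiableAt.hasDerivAt.fun_neg.fun_sub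
        (hasDerivAt_stirlingSum a₁ b₁ a₀ b₀ a K (Or.inl hw))).deriv
    have h5 := ((hlog ((1 / 2 + y : ℝ) : ℂ) hre).deriv.differentiableAt.hasDerivAt.fun_neg).fun_sub
      (hasDerivAt_stirlingSum_deriv a₁ b₁ a₀ a K hxs)
    rw [iteratedDeriv_succ, iteratedDeriv_one, hev.deriv_eq, h5.deriv]
    push_cast
    simp only [div_eq_mul_inv, pow_one]
    ring

end Stirling

/-! ### Dirichlet-type series and their continuation. -/

theorem norm_cpow_le_mul_exp {z : ℂ} (hz : z ≠ 0) (s : ℂ) :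
    ‖z ^ s‖ ≤ ‖z‖ ^ s.re * Real.exp (Real.pi * |s.im|) := by
  rw [norm_cpow_of_ne_zero hz, div_eq_mul_inv, ← Real.exp_neg]
  gcongr
  calc -(arg z * s.im) ≤ |arg z * s.im| := neg_le_abs _
    _ = |arg z| * |s.im| := abs_mul _ _
    _ ≤ Real.pi * |s.im| := by gcongr; exact abs_arg_le_pi z

/-- A bound uniform over a vertical strip: the left edge dominates when `r ≥ 1`, the right edge when
`r ≤ 1`. -/
theorem rpow_neg_le_add {r x A B : ℝ} (hr : 0 < r) (hA : A ≤ x) (hB : x ≤ B) :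
    r ^ (-x) ≤ r ^ (-A) + r ^ (-B) := by
  rcases le_total 1 r with h | h
  · exact (Real.rpow_le_rpow_of_exponent_le h (by linarith)).trans
      (le_add_of_nonneg_right (by positivity))
  · exact (Real.rpow_le_rpow_of_exponent_ge hr h (by linarith)).trans
      (le_add_of_nonneg_left (by positivity))

section Series

variable {ι : Type*} {z : ι → ℂ} {s₀ : ℝ}

theorem summable_cpow_neg (hz : ∀ i, z i ≠ 0) {s : ℂ} (hs : Summable fun i => ‖z i‖ ^ (-s.re)) :
    Summable fun i => z i ^ (-s) := by
  refine Summable.of_norm_bounded (hs.mul_right (Real.exp (Real.pi * |s.im|))) fun i => ?_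
  simpa using norm_cpow_le_mul_exp (hz i) (-s)

/-- A bounded rectangle around a point. -/
theorem exists_rectangle {p : ℂ} (hp : s₀ < p.re) : ∃ A B T : ℝ, s₀ < A ∧ A < B ∧
    {s : ℂ | (A < s.re ∧ s.re < B) ∧ |s.im| < T} ∈ 𝓝 p ∧
    IsOpen {s : ℂ | (A < s.re ∧ s.re < B) ∧ |s.im| < T} := by
  obtain ⟨A, hA1, hA2⟩ := exists_between hp
  have ho : IsOpen {s : ℂ | (A < s.re ∧ s.re < p.re + 1) ∧ |s.im| < |p.im| + 1} :=
    ((isOpen_lt continuous_const continuous_re).inter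
      (isOpen_lt continuous_re continuous_const)).inter
      (isOpen_lt continuous_im.abs continuous_const)
  exact ⟨A, p.re + 1, |p.im| + 1, hA1, by linarith, ho.mem_nhds ⟨⟨hA2, by linarith⟩, by linarith⟩,
    ho⟩

theorem analyticAt_tsum_of_bound {f : ι → ℂ → ℂ} {U : Set ℂ} {u : ι → ℝ} {p : ℂ} (hU : IsOpen U)
    (hp : p ∈ U) (hu : Summable u) (hf : ∀ i, DifferentiableOn ℂ (f i) U)
    (hb : ∀ i, ∀ s ∈ U, ‖f i s‖ ≤ u i) : AnalyticAt ℂ (fun s => ∑' i, f i s) p :=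
  (differentiableOn_tsum_of_summable_norm hu hf hU hb).analyticAt (hU.mem_nhds hp)

theorem analyticAt_tsum_cpow_neg (hz : ∀ i, z i ≠ 0)
    (hs : ∀ x : ℝ, s₀ < x → Summable fun i => ‖z i‖ ^ (-x)) {p : ℂ} (hp : s₀ < p.re) :
    AnalyticAt ℂ (fun s => ∑' i, z i ^ (-s)) p := by
  obtain ⟨A, B, T, hA, hAB, hU, hUo⟩ := exists_rectangle hp
  refine analyticAt_tsum_of_bound hUo (mem_of_mem_nhds hU)
    (((hs A hA).add (hs B (hA.trans hAB))).mul_right (Real.exp (Real.pi * T)))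
    (fun i => ?_) fun i s hsU => ?_
  · exact fun s _ => (DifferentiableAt.const_cpow (by fun_prop)
      (Or.inl (hz i))).differentiableWithinAt
  · have h1 := norm_cpow_le_mul_exp (hz i) (-s)
    rw [neg_re, neg_im, abs_neg] at h1
    refine h1.trans ?_
    have hp := norm_pos_iff.2 (hz i)
    gcongr
    · exact rpow_neg_le_add hp hsU.1.1.le hsU.1.2.le
    · exact hsU.2.le

end Series

theorem AwayFromNegative.continuousOn_tsum_inv_pow {ι : Type*} {z : ι → ℂ}
    (h : AwayFromNegative z) (n : ℕ) (hs : Summable fun i => ‖z i‖ ^ (-(n : ℝ))) :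
    ContinuousOn (fun y : ℝ => ∑' i, ((z i + y) ^ n)⁻¹) (Set.Ici 0) ∧
      ∃ C : ℝ, ∀ y : ℝ, 0 ≤ y → ‖∑' i, ((z i + y) ^ n)⁻¹‖ ≤ C := by
  obtain ⟨C, hC, hb⟩ := h.norm_inv_le
  have hb' : ∀ i, ∀ y : ℝ, y ∈ Set.Ici 0 → ‖((z i + y) ^ n)⁻¹‖ ≤ C ^ n * ‖z i‖ ^ (-(n : ℝ)) := by
    intro i y hy
    have hp := norm_pos_iff.2 (slitPlane_ne_zero (h.1 i))
    have hy0 : 0 ≤ y := hy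
    refine (hb i y hy n).trans ?_
    rw [Real.rpow_neg hp.le, Real.rpow_natCast]
    gcongr
    linarith
  constructor
  · refine continuousOn_tsum (fun i => ?_) (hs.mul_left (C ^ n)) hb'
    exact ContinuousOn.inv₀ (by fun_prop) fun y hy => pow_ne_zero _ (add_ofReal_ne_zero (h.1 i) hy)
  · exact ⟨_, fun y hy => tsum_of_norm_bounded (hs.mul_left (C ^ n)).hasSum fun i => hb' i y hy⟩

theorem exists_glue {D E : ℂ → ℂ} {s₀ s₁ : ℝ}
    (hDE : ∀ s : ℂ, s₀ < s.re → s.re < s₁ → D s = E s) :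
    ∃ W : ℂ → ℂ, (∀ p : ℂ, s₀ < p.re → W =ᶠ[𝓝 p] D) ∧ ∀ p : ℂ, p.re < s₁ → W =ᶠ[𝓝 p] E := by
  classical
  refine ⟨fun s => if s₀ < s.re then D s else E s, fun p hp => ?_, fun p hp => ?_⟩
  · filter_upwards [(isOpen_lt continuous_const continuous_re).mem_nhds hp] with s hs
    exact if_pos hs
  · filter_upwards [(isOpen_lt continuous_re continuous_const).mem_nhds hp] with s hs
    by_cases h1 : s₀ < s.re
    · rw [if_pos h1, hDE s h1 hs]
    · rw [if_neg h1]

theorem cos_natCast_mul_pi (n : ℕ) : cos (n * Real.pi) = (-1) ^ n := by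
  exact_mod_cast congrArg ofReal (Real.cos_nat_mul_pi n)

/-- Continuation of `∑ z_i ^ (-s)`, `Re s > 1`, from the asymptotic expansion of
`∑ (z_i + y) ^ (-2)`. -/
theorem exists_zeta_of_inv_sq {ι : Type*} [Countable ι] {z : ι → ℂ} (h : AwayFromNegative z)
    (hs : ∀ x : ℝ, 1 < x → Summable fun i => ‖z i‖ ^ (-x)) {c : ℕ → ℂ}
    (hc : HasInvExpansion (fun y : ℝ => ∑' i, ((z i + y) ^ 2)⁻¹) c) :
    ∃ Z : ℂ → ℂ, (∀ s : ℂ, 1 < s.re → HasSum (fun i => z i ^ (-s)) (Z s)) ∧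
      (∀ s : ℂ, s ≠ 1 → AnalyticAt ℂ Z s) ∧ HasPolarPart Z 1 0 (c 0) ∧
      ∀ n : ℕ, Z (-n) = (-1) ^ n * c (n + 1) / (n + 1) := by
  have hz : ∀ i, z i ≠ 0 := fun i => slitPlane_ne_zero (h.1 i)
  have hpi : (Real.pi : ℂ) ≠ 0 := ofReal_ne_zero.2 Real.pi_ne_zero
  obtain ⟨hcont, B, hB⟩ := h.continuousOn_tsum_inv_pow 2 (hs _ (by norm_num))
  obtain ⟨M, hM1, hM2, hM3⟩ := exists_mellin_continuation (d := 0) (c := c)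
    (hcont.mono Set.Ioi_subset_Ici_self) (IsBigO.of_bound B (by
      filter_upwards [self_mem_nhdsWithin] with y hy
      simpa using hB y (le_of_lt hy))) (fun N => by simpa using hc N)
  simp only [ite_self] at hM3
  set ψ : ℂ → ℂ := fun s => sin (Real.pi * s) with hψ
  have hψd : Differentiable ℂ ψ := by fun_prop
  have hψ' : ∀ s, HasDerivAt ψ (Real.pi * cos (Real.pi * s)) s := fun s => by
    have := ((hasDerivAt_id s).const_mul (Real.pi : ℂ)).csin
    simpa [hψ, mul_comm] using this
  have hψ1 : ψ 1 = 0 := by simp [hψ]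
  -- This is `sin (πs) / (π (1 - s))`, the inverse of the Mellin factor at `S = 2 - s`, with its
  -- removable singularity at `s = 1` filled by `φ 1 = 1`.
  set φ : ℂ → ℂ := fun s => -(dslope ψ 1 s / Real.pi) with hφ
  have hdsl : Differentiable ℂ (dslope ψ 1) := by
    rw [← differentiableOn_univ]
    exact (Complex.differentiableOn_dslope (by simp)).2 hψd.differentiableOn
  have hφa : ∀ s, AnalyticAt ℂ φ s := fun s =>
    (((hdsl.analyticAt s)).div analyticAt_const hpi).neg
  have hφs : ∀ s, s ≠ 1 → φ s = ψ s / (Real.pi * (1 - s)) := by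
    intro s hs1
    have h1 : s - 1 ≠ 0 := sub_ne_zero.2 hs1
    have h2 : (1 : ℂ) - s ≠ 0 := sub_ne_zero.2 hs1.symm
    simp only [hφ]
    rw [dslope_of_ne _ hs1, slope_def_field, hψ1]
    field_simp
    ring
  have hφ1 : φ 1 = 1 := by
    simp only [hφ]
    rw [dslope_same, (hψ' 1).deriv]
    simp [hpi]
  -- The strip `1 < Re s < 2` is the image of the convergence strip `0 < Re S < 1` under `S = 2 -
  -- s`.
  have hDE : ∀ s : ℂ, 1 < s.re → s.re < 2 → ∑' i, z i ^ (-s) = φ s * M (2 - 1 * s) := by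
    intro s h1 h2
    have hS : 0 < (2 - s).re := by simp; linarith
    have hS' : (2 - s).re < 1 := by simp; linarith
    have hm := h.hasSum_mellin_inv_sq hS hS' (by
      convert hs s.re h1 using 3
      simp)
    have hne : s ≠ 1 := by rintro rfl; simp at h1
    have hsin : sin (Real.pi * (2 - s)) = -sin (Real.pi * s) := by
      rw [show (Real.pi : ℂ) * (2 - s) = 2 * Real.pi - Real.pi * s by ring, sin_two_pi_sub]
    have hsn : sin (Real.pi * s) ≠ 0 := by
      intro h0
      rw [sin_eq_zero_iff] at h0
      obtain ⟨k, hk⟩ := h0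
      have hk' : s = k := mul_left_cancel₀ hpi (by rw [hk]; ring)
      rw [hk', intCast_re] at h1 h2
      have e1 : (1 : ℤ) < k := by exact_mod_cast h1
      have e2 : k < (2 : ℤ) := by exact_mod_cast h2
      omega
    rw [one_mul, hM1 _ hS hS', ← hm.tsum_eq, tsum_mul_right, hsin, hφs s hne]
    have h3 : (1 : ℂ) - s ≠ 0 := sub_ne_zero.2 hne.symm
    have e : ∀ i, z i ^ (2 - s - 2) = z i ^ (-s) := fun i => by congr 1; ring
    simp only [e, hψ]
    generalize sin (Real.pi * s) = w at hsn ⊢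
    field_simp
    ring
  obtain ⟨W, hW1, hW2⟩ := exists_glue hDE
  have hana : ∀ p : ℂ, 1 < p.re → AnalyticAt ℂ (fun s => ∑' i, z i ^ (-s)) p := fun p hp =>
    analyticAt_tsum_cpow_neg hz hs hp
  have hlow : ∀ p A B : ℂ, HasPolarPart M (2 - 1 * p) A (-B) →
      HasPolarPart (fun s => M (2 - 1 * s)) p A B := by
    intro p A B hAB
    simpa using hAB.comp_affine one_ne_zero
  have hWpunct : ∀ p : ℂ, p.re < 2 → (fun s => φ s * M (2 - 1 * s)) =ᶠ[𝓝[≠] p] W := fun p hp =>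
    ((hW2 p hp).filter_mono nhdsWithin_le_nhds).symm
  -- The pole of `M` at `S = n + 2` lies over `s = -n`, where it is simple and is cancelled by the
  -- zero of the sine.
  have hval : ∀ n : ℕ, ∃ g : ℂ → ℂ, AnalyticAt ℂ g (-n) ∧
      g (-n) = (-1) ^ n * c (n + 1) / (n + 1) ∧ W =ᶠ[𝓝[≠] (-n : ℂ)] g := by
    intro n
    have hre : (-n : ℂ).re < 2 := by simp; linarith [Nat.cast_nonneg (α := ℝ) n]
    have h1 := hlow (-n) 0 (c (n + 1)) (by
      convert hM3 (n + 1) using 1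
      push_cast
      ring)
    have hn1 : (n : ℂ) + 1 ≠ 0 := Nat.cast_add_one_ne_zero n
    have hne : (-n : ℂ) ≠ 1 := fun h0 => hn1 (by linear_combination -h0)
    have hψn : ψ (-n) = 0 := by
      simp only [hψ]
      rw [mul_neg, sin_neg, mul_comm, sin_nat_mul_pi, neg_zero]
    have hφn : φ (-n) = 0 := by rw [hφs _ hne, hψn, zero_div]
    have hφd : deriv φ (-n) = (-1) ^ n / (n + 1) := by
      have hev : φ =ᶠ[𝓝 (-n : ℂ)] fun s => ψ s / (Real.pi * (1 - s)) := by
        filter_upwards [isOpen_ne.mem_nhds hne] with s hs1 using hφs s hs1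
      have hd : (Real.pi : ℂ) * (1 - (-n)) ≠ 0 :=
        mul_ne_zero hpi (by rw [sub_neg_eq_add, add_comm]; exact hn1)
      have hq := (hψ' (-n)).fun_div (((hasDerivAt_id' (-n : ℂ)).const_sub 1).const_mul
        (Real.pi : ℂ)) hd
      rw [hev.deriv_eq, hq.deriv, hψn, mul_neg (Real.pi : ℂ), cos_neg, mul_comm (Real.pi : ℂ) n,
        cos_natCast_mul_pi, sub_neg_eq_add, add_comm (1 : ℂ)]
      field_simp
      ring
    obtain ⟨g, hg, hgv, hgW⟩ := h1.analytic_value (hφa _) hφn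
    refine ⟨g, hg, ?_, (hWpunct _ hre).symm.trans hgW⟩
    rw [hgv, hφd]
    ring
  -- The product formula controls `W` only off the poles of `M`; filling in supplies the correct
  -- values at the cancelled ones.
  refine ⟨fillIn W, fun s hs1 => ?_, fun s hs1 => ?_, ?_, fun n => ?_⟩
  · rw [fillIn_apply ((hW1 s hs1).filter_mono nhdsWithin_le_nhds) (hana s hs1).continuousAt]
    exact (summable_cpow_neg hz (hs _ hs1)).hasSum
  · by_cases hre : 1 < s.re
    · exact analyticAt_fillIn ((hW1 s hre).filter_mono nhdsWithin_le_nhds) (hana s hre)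
    · by_cases hn : ∃ n : ℕ, s = -n
      · obtain ⟨n, rfl⟩ := hn
        obtain ⟨g, hg, -, hWg⟩ := hval n
        exact analyticAt_fillIn hWg hg
      · have hre2 : s.re < 2 := by linarith
        refine analyticAt_fillIn ((hW2 s hre2).filter_mono nhdsWithin_le_nhds)
          ((hφa s).mul ?_)
        have : AnalyticAt ℂ M (2 - 1 * s) := by
          refine hM2 _ (by simp; linarith) fun n hn' => ?_
          cases n with
          | zero => exact hs1 (by linear_combination -hn' + (by simp : ((0 : ℕ) : ℂ) = 0))
          | succ n => exact hn ⟨n, by push_cast at hn'; linear_combination -hn'⟩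
        exact this.comp_of_eq (f := fun s => 2 - 1 * s) (by fun_prop) rfl
  · have h1 := (hlow 1 0 (c 0) (by
      convert hM3 0 using 1
      push_cast
      ring)).mul_left (hφa 1)
    rw [hφ1, mul_zero, mul_zero, one_mul, zero_add] at h1
    exact (h1.congr (hWpunct 1 (by simp))).fillIn
  · obtain ⟨g, hg, hgv, hWg⟩ := hval n
    rw [fillIn_apply hWg hg.continuousAt, hgv]

theorem sin_pi_mul_half_sub (m : ℕ) : sin (Real.pi * (1 / 2 - m)) = (-1) ^ m := by
  rw [show (Real.pi : ℂ) * (1 / 2 - m) = Real.pi / 2 - m * Real.pi by ring, sin_pi_div_two_sub,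
    cos_natCast_mul_pi]

theorem cos_pi_mul_half_sub (m : ℕ) : cos (Real.pi * (1 / 2 - m)) = 0 := by
  rw [show (Real.pi : ℂ) * (1 / 2 - m) = Real.pi / 2 - m * Real.pi by ring, cos_pi_div_two_sub,
    sin_nat_mul_pi]

/-- Continuation of `∑ z_i ^ (-σ)`, `Re σ > 1 / 2`, from the asymptotic expansion of
`∑ (z_i + y ^ 2)⁻¹`. -/
theorem exists_zeta_of_inv {ι : Type*} [Countable ι] {z : ι → ℂ} (h : AwayFromNegative z)
    (hs : ∀ x : ℝ, 1 / 2 < x → Summable fun i => ‖z i‖ ^ (-x)) {d : ℂ} {c : ℕ → ℂ}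
    (hc : HasInvExpansion
      (fun y : ℝ => ∑' i, (z i + (y : ℂ) ^ 2)⁻¹ - d * (Real.log y / y)) c) :
    ∃ Z : ℂ → ℂ, (∀ s : ℂ, 1 / 2 < s.re → HasSum (fun i => z i ^ (-s)) (Z s)) ∧
      (∀ s : ℂ, (∀ m : ℕ, s ≠ 1 / 2 - m) → AnalyticAt ℂ Z s) ∧
      (∀ m : ℕ, HasPolarPart Z (1 / 2 - m) (if m = 0 then d / (2 * Real.pi) else 0)
        ((-1) ^ m * c (2 * m) / Real.pi)) ∧
      ∀ m : ℕ, Z (-m) = (-1) ^ m * c (2 * m + 1) := by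
  have hz : ∀ i, z i ≠ 0 := fun i => slitPlane_ne_zero (h.1 i)
  have hpi : (Real.pi : ℂ) ≠ 0 := ofReal_ne_zero.2 Real.pi_ne_zero
  obtain ⟨hcont, B, hB⟩ := h.continuousOn_tsum_inv_pow 1 (by simpa using hs 1 (by norm_num))
  simp only [pow_one] at hcont hB
  set R : ℝ → ℂ := fun w => ∑' i, (z i + (w : ℂ))⁻¹ with hR
  have hRsq : ∀ y : ℝ, ∑' i, (z i + (y : ℂ) ^ 2)⁻¹ = R (y ^ (2 : ℝ)) := by
    intro y
    simp only [hR, Real.rpow_two]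
    push_cast
    rfl
  have hmaps : Set.MapsTo (fun y : ℝ => y ^ (2 : ℝ)) (Set.Ioi 0) (Set.Ici 0) := fun y hy =>
    Real.rpow_nonneg (le_of_lt hy) _
  obtain ⟨M, hM1, hM2, hM3⟩ := exists_mellin_continuation (d := d) (c := c)
    (F := fun y : ℝ => ∑' i, (z i + (y : ℂ) ^ 2)⁻¹)
    (by
      simp only [hRsq]
      refine hcont.comp (fun y hy => ?_) hmaps
      exact (Real.continuousAt_rpow_const _ _ (Or.inr (by norm_num))).continuousWithinAt)
    (IsBigO.of_bound B (by
      filter_upwards [self_mem_nhdsWithin] with y hy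
      rw [hRsq]
      rw [norm_one, mul_one]
      exact hB _ (hmaps hy)))
    (fun N => by simpa only [sub_sub] using hc N)
  -- The factor 2 undoes the `1/2` produced by the substitution `w = y²` in the Mellin integral.
  set φ : ℂ → ℂ := fun s => 2 * sin (Real.pi * s) / Real.pi with hφ
  have hφd : ∀ s, HasDerivAt φ (2 * cos (Real.pi * s)) s := fun s => by
    have := ((((hasDerivAt_id' s).const_mul (Real.pi : ℂ)).csin).const_mul 2).div_const
      (Real.pi : ℂ)
    refine this.congr_deriv ?_
    field_simp
  have hφa : ∀ s, AnalyticAt ℂ φ s := fun s =>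
    Differentiable.analyticAt (fun s => (hφd s).differentiableAt) s
  have hDE : ∀ s : ℂ, 1 / 2 < s.re → s.re < 1 → ∑' i, z i ^ (-s) = φ s * M (2 - 2 * s) := by
    intro s h1 h2
    have hS : 0 < (1 - s).re := by simp; linarith
    have hS' : (1 - s).re < 1 := by simp; linarith
    have hm := h.hasSum_mellin_inv hS hS' (by
      convert hs s.re h1 using 3
      simp)
    have hmel : mellin (fun y : ℝ => ∑' i, (z i + (y : ℂ) ^ 2)⁻¹) (2 - 2 * s) =
        (1 / 2) * mellin R (1 - s) := by
      simp only [hRsq]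
      rw [mellin_comp_rpow, real_smul]
      congr 1
      · simp
      · congr 1
        push_cast
        ring
    have hsin : sin (Real.pi * (1 - s)) = sin (Real.pi * s) := by
      rw [mul_sub, mul_one, sin_pi_sub]
    have hsn : sin (Real.pi * s) ≠ 0 := by
      intro h0
      rw [sin_eq_zero_iff] at h0
      obtain ⟨k, hk⟩ := h0
      have hk' : s = k := mul_left_cancel₀ hpi (by rw [hk]; ring)
      rw [hk', intCast_re] at h1 h2
      have e1 : (0 : ℝ) < k := by linarith
      have e1' : (0 : ℤ) < k := by exact_mod_cast e1
      have e2 : k < (1 : ℤ) := by exact_mod_cast h2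
      omega
    rw [hM1 _ (by simp; linarith) (by simp; linarith), hmel, ← hm.tsum_eq, tsum_mul_right, hsin]
    have e : ∀ i, z i ^ (1 - s - 1) = z i ^ (-s) := fun i => by congr 1; ring
    simp only [e, hφ]
    generalize sin (Real.pi * s) = w at hsn ⊢
    field_simp
  obtain ⟨W, hW1, hW2⟩ := exists_glue hDE
  have hana : ∀ p : ℂ, 1 / 2 < p.re → AnalyticAt ℂ (fun s => ∑' i, z i ^ (-s)) p := fun p hp =>
    analyticAt_tsum_cpow_neg hz hs hp
  have hlow : ∀ p A B : ℂ, HasPolarPart M (2 - 2 * p) A B →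
      HasPolarPart (fun s => M (2 - 2 * s)) p (A / 4) (-B / 2) := by
    intro p A B hAB
    convert hAB.comp_affine two_ne_zero using 2
    norm_num
  have hWpunct : ∀ p : ℂ, p.re < 1 → (fun s => φ s * M (2 - 2 * s)) =ᶠ[𝓝[≠] p] W := fun p hp =>
    ((hW2 p hp).filter_mono nhdsWithin_le_nhds).symm
  -- With `S = 2 - 2s`, the pole at `S = k + 1` lies over `s = (1 - k)/2`: odd `k` falls on the
  -- zeros of the sine and gives values, even `k` gives the poles at `1/2 - m`.
  have hval : ∀ n : ℕ, ∃ g : ℂ → ℂ, AnalyticAt ℂ g (-n) ∧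
      g (-n) = (-1) ^ n * c (2 * n + 1) ∧ W =ᶠ[𝓝[≠] (-n : ℂ)] g := by
    intro n
    have hre : (-n : ℂ).re < 1 := by simp; linarith [Nat.cast_nonneg (α := ℝ) n]
    have h1 := hM3 (2 * n + 1)
    rw [if_neg (by omega), show ((2 * n + 1 : ℕ) : ℂ) + 1 = 2 - 2 * (-n) by push_cast; ring] at h1
    have h2 := hlow _ _ _ h1
    rw [zero_div] at h2
    have hφn : φ (-n) = 0 := by
      simp only [hφ]
      rw [mul_neg, sin_neg, mul_comm (Real.pi : ℂ), sin_nat_mul_pi]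
      simp
    obtain ⟨g, hg, hgv, hgW⟩ := h2.analytic_value (hφa _) hφn
    refine ⟨g, hg, ?_, (hWpunct _ hre).symm.trans hgW⟩
    rw [hgv, (hφd _).deriv, mul_neg, cos_neg, mul_comm (Real.pi : ℂ), cos_natCast_mul_pi]
    ring
  refine ⟨fillIn W, fun s hs1 => ?_, fun s hs1 => ?_, fun m => ?_, fun n => ?_⟩
  · rw [fillIn_apply ((hW1 s hs1).filter_mono nhdsWithin_le_nhds) (hana s hs1).continuousAt]
    exact (summable_cpow_neg hz (hs _ hs1)).hasSum
  · by_cases hre : 1 / 2 < s.re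
    · exact analyticAt_fillIn ((hW1 s hre).filter_mono nhdsWithin_le_nhds) (hana s hre)
    · by_cases hn : ∃ n : ℕ, s = -n
      · obtain ⟨n, rfl⟩ := hn
        obtain ⟨g, hg, -, hWg⟩ := hval n
        exact analyticAt_fillIn hWg hg
      · have hre2 : s.re < 1 := by linarith
        refine analyticAt_fillIn ((hW2 s hre2).filter_mono nhdsWithin_le_nhds)
          ((hφa s).mul ?_)
        have : AnalyticAt ℂ M (2 - 2 * s) := by
          refine hM2 _ (by simp; linarith) fun n hn' => ?_
          rcases Nat.even_or_odd' n with ⟨m, rfl | rfl⟩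
          · exact hs1 m (by push_cast at hn'; linear_combination (-1 / 2 : ℂ) * hn')
          · exact hn ⟨m, by push_cast at hn'; linear_combination (-1 / 2 : ℂ) * hn'⟩
        exact this.comp_of_eq (f := fun s => 2 - 2 * s) (by fun_prop) rfl
  · have hre : (1 / 2 - m : ℂ).re < 1 := by
      simp; linarith [Nat.cast_nonneg (α := ℝ) m]
    have h1 := hM3 (2 * m)
    rw [show ((2 * m : ℕ) : ℂ) + 1 = 2 - 2 * (1 / 2 - m) by push_cast; ring] at h1
    -- At `1/2 - m` the derivative of the sine vanishes, so the double pole makes no contribution to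
    -- the residue.
    have h2 := (hlow _ _ _ h1).mul_left (hφa _)
    rw [(hφd _).deriv, cos_pi_mul_half_sub, mul_zero, zero_mul, zero_add] at h2
    have hφm : φ (1 / 2 - m) = 2 * (-1) ^ m / Real.pi := by
      simp only [hφ]
      rw [sin_pi_mul_half_sub]
    rw [hφm] at h2
    convert (h2.congr (hWpunct _ hre)).fillIn using 1
    · by_cases hm : m = 0
      · subst hm
        simp
        field_simp
        norm_num
      · simp [hm]
    · field_simp
  · obtain ⟨g, hg, hgv, hWg⟩ := hval n
    rw [fillIn_apply hWg hg.continuousAt, hgv]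

/-! ### Generalized binomial coefficients and the binomial series. -/

theorem add_one_mul_ring_choose_succ (r : ℂ) (l : ℕ) :
    ((l : ℂ) + 1) * Ring.choose r (l + 1) = (r - l) * Ring.choose r l := by
  have key : ∀ k : ℕ, (descPochhammer ℂ k).eval r = k.factorial * Ring.choose r k := by
    intro k
    have h := Ring.descPochhammer_eq_factorial_smul_choose r k
    rwa [← Polynomial.aeval_eq_smeval, Polynomial.aeval_def, ← Polynomial.eval_map,
      descPochhammer_map, nsmul_eq_mul] at h
  have h1 := key (l + 1)
  rw [descPochhammer_succ_eval, key l, Nat.factorial_succ] at h1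
  have hf : (l.factorial : ℂ) ≠ 0 := by exact_mod_cast l.factorial_ne_zero
  push_cast at h1
  refine mul_left_cancel₀ hf ?_
  linear_combination -h1

theorem ring_choose_succ (r : ℂ) (l : ℕ) :
    Ring.choose r (l + 1) = (r - l) / (l + 1) * Ring.choose r l := by
  have h1 : (l : ℂ) + 1 ≠ 0 := Nat.cast_add_one_ne_zero l
  field_simp
  linear_combination add_one_mul_ring_choose_succ r l

theorem differentiable_ring_choose_neg (l : ℕ) :
    Differentiable ℂ fun s : ℂ => Ring.choose (-s) l := by
  induction l with
  | zero => simp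
  | succ l ih =>
    simp only [ring_choose_succ]
    fun_prop

/-- Factor by factor, `‖-s - l‖ ≤ A + l`, with equality at `s = A`. This makes binomial remainders
uniform for `s` in a bounded set. -/
theorem norm_ring_choose_neg_le {s : ℂ} {A : ℝ} (hs : ‖s‖ ≤ A) (l : ℕ) :
    ‖Ring.choose (-s) l‖ ≤ ‖Ring.choose (-(A : ℂ)) l‖ := by
  have hA : 0 ≤ A := (norm_nonneg s).trans hs
  induction l with
  | zero => simp
  | succ l ih =>
    rw [ring_choose_succ, ring_choose_succ, norm_mul, norm_mul, norm_div, norm_div]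
    gcongr
    have h1 : ‖-(A : ℂ) - l‖ = A + l := by
      rw [← neg_add', norm_neg]
      have : (A : ℂ) + l = ((A + l : ℝ) : ℂ) := by push_cast; rfl
      rw [this, norm_real, Real.norm_of_nonneg (by positivity)]
    rw [h1, ← neg_add', norm_neg]
    refine (norm_add_le _ _).trans ?_
    rw [norm_natCast]
    gcongr

theorem summable_norm_ring_choose (a : ℂ) {x : ℝ} (hx0 : 0 ≤ x) (hx : x < 1) :
    Summable fun l : ℕ => ‖Ring.choose a l‖ * x ^ l := by
  lift x to NNReal using hx0
  have h1 : (x : ENNReal) < (binomialSeries ℂ a).radius :=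
    lt_of_lt_of_le (by exact_mod_cast hx) binomialSeries_radius_ge_one
  have h2 := (binomialSeries ℂ a).summable_norm_mul_pow h1
  refine h2.congr fun l => ?_
  rw [binomialSeries, FormalMultilinearSeries.ofScalars_norm]

theorem summable_norm_ring_choose_add (a : ℂ) {x : ℝ} (hx0 : 0 ≤ x) (hx : x < 1) (N : ℕ) :
    Summable fun l : ℕ => ‖Ring.choose a (l + N)‖ * x ^ l := by
  rcases hx0.eq_or_lt with h0 | h0
  · rw [← h0]
    refine summable_of_ne_finset_zero (s := {0}) fun l hl => ?_
    rw [zero_pow (by simpa using hl), mul_zero]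
  · have h4 := ((summable_nat_add_iff N).2
      (summable_norm_ring_choose a hx0 hx)).mul_right ((x ^ N)⁻¹)
    refine h4.congr fun l => ?_
    rw [pow_add]
    field_simp

theorem hasSum_one_add_cpow (a : ℂ) {x : ℂ} (hx : ‖x‖ < 1) :
    HasSum (fun l : ℕ => Ring.choose a l * x ^ l) ((1 + x) ^ a) := by
  have hx' : x ∈ Metric.eball (0 : ℂ) 1 := by
    rw [Metric.mem_eball, edist_zero_right, ← ofReal_norm, ENNReal.ofReal_lt_one]
    exact hx
  have h1 := (one_add_cpow_hasFPowerSeriesOnBall_zero (a := a)).hasSum hx'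
  rw [zero_add] at h1
  have h2 : (fun l : ℕ => Ring.choose a l * x ^ l) =
      fun l => (binomialSeries ℂ a l) fun _ => x := by
    funext l
    simp [binomialSeries, FormalMultilinearSeries.coeff_ofScalars, mul_comm]
  rwa [h2]

/-- Uniform bound for the remainder of the binomial series. -/
theorem norm_one_add_cpow_sub_le {s x : ℂ} {A ρ : ℝ} (hs : ‖s‖ ≤ A) (hx : ‖x‖ ≤ ρ) (hρ : ρ < 1)
    (N : ℕ) : ‖(1 + x) ^ (-s) - ∑ l ∈ range N, Ring.choose (-s) l * x ^ l‖ ≤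
      ‖x‖ ^ N * ∑' l : ℕ, ‖Ring.choose (-(A : ℂ)) (l + N)‖ * ρ ^ l := by
  have hρ0 : 0 ≤ ρ := (norm_nonneg x).trans hx
  have h1 := hasSum_one_add_cpow (-s) (hx.trans_lt hρ)
  have h2 := (hasSum_nat_add_iff' N).2 h1
  rw [← h2.tsum_eq]
  have h3 := summable_norm_ring_choose_add (-(A : ℂ)) hρ0 hρ N
  refine tsum_of_norm_bounded (h3.hasSum.mul_left (‖x‖ ^ N)) fun l => ?_
  rw [norm_mul, norm_pow, pow_add]
  calc ‖Ring.choose (-s) (l + N)‖ * (‖x‖ ^ l * ‖x‖ ^ N)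
      ≤ ‖Ring.choose (-(A : ℂ)) (l + N)‖ * (ρ ^ l * ‖x‖ ^ N) := by
        gcongr
        exact norm_ring_choose_neg_le hs _
    _ = _ := by ring

/-- Along the segment from `z` to `z + v` both sides have the same derivative and they agree at its
start; the hypotheses keep every logarithm off its cut. -/
theorem log_add_eq {z v : ℂ} (hv : ‖v‖ < ‖z‖)
    (hseg : ∀ t : ℝ, 0 ≤ t → t ≤ 1 → z + t * v ∈ slitPlane) :
    log (z + v) = log z + log (1 + v / z) := by
  have hz : z ≠ 0 := norm_pos_iff.1 ((norm_nonneg v).trans_lt hv)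
  have hz' : 0 < ‖z‖ := norm_pos_iff.2 hz
  have h1 : ∀ t ∈ Set.Icc (0 : ℝ) 1, 1 + t * v / z ∈ slitPlane := by
    intro t ht
    refine mem_slitPlane_of_norm_lt_one ?_
    rw [norm_div, norm_mul, norm_real, Real.norm_of_nonneg ht.1, div_lt_one hz']
    exact (mul_le_of_le_one_left (norm_nonneg v) ht.2).trans_lt hv
  have hder : ∀ t ∈ Set.Icc (0 : ℝ) 1,
      HasDerivAt (fun t : ℝ => log (z + t * v) - log (1 + t * v / z)) 0 t := by
    intro t ht
    have hlin : HasDerivAt (fun t : ℝ => (t : ℂ) * v) v t := by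
      simpa using (ofRealCLM.hasDerivAt (x := t)).mul_const v
    have h2 := (hlin.const_add z).clog_real (hseg t ht.1 ht.2)
    have h3 := ((hlin.div_const z).const_add 1).clog_real (h1 t ht)
    refine (h2.fun_sub h3).congr_deriv ?_
    have e1 := slitPlane_ne_zero (hseg t ht.1 ht.2)
    have e2 := slitPlane_ne_zero (h1 t ht)
    have e3 : 1 + t * v / z = (z + t * v) / z := by field_simp
    rw [e3]
    field_simp
    ring
  have := constant_of_has_deriv_right_zero (f := fun t : ℝ => log (z + t * v) - log (1 + t * v / z))
    (a := 0) (b := 1) (fun t ht => (hder t ht).continuousAt.continuousWithinAt)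
    (fun t ht => (hder t ⟨ht.1, ht.2.le⟩).hasDerivWithinAt) 1 (by simp)
  simp at this
  linear_combination this

theorem cpow_add_eq {z v : ℂ} (hv : ‖v‖ < ‖z‖)
    (hseg : ∀ t : ℝ, 0 ≤ t → t ≤ 1 → z + t * v ∈ slitPlane) (s : ℂ) :
    (z + v) ^ s = z ^ s * (1 + v / z) ^ s := by
  have hz : z ≠ 0 := norm_pos_iff.1 ((norm_nonneg v).trans_lt hv)
  have hzv : z + v ≠ 0 := slitPlane_ne_zero (by simpa using hseg 1 zero_le_one le_rfl)
  have h1 : 1 + v / z ≠ 0 := by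
    intro h0
    apply hzv
    field_simp at h0
    linear_combination h0
  rw [cpow_def_of_ne_zero hz, cpow_def_of_ne_zero hzv, cpow_def_of_ne_zero h1, ← exp_add,
    log_add_eq hv hseg]
  ring_nf

/-! ### Continuation of the shifted zeta function. -/

/-- The remainder of order `N` in the expansion of `(z + v) ^ (-s)` in powers of `v`. -/
def shiftTerm (z v : ℂ) (N : ℕ) (s : ℂ) : ℂ :=
  (z + v) ^ (-s) - ∑ l ∈ range N, Ring.choose (-s) l * z ^ (-(s + l)) * v ^ l

theorem cpow_neg_add_natCast {z : ℂ} (hz : z ≠ 0) (s : ℂ) (l : ℕ) :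
    z ^ (-(s + l)) = z ^ (-s) / z ^ l := by
  rw [neg_add, ← sub_eq_add_neg, cpow_sub _ _ hz, cpow_natCast]

theorem shiftTerm_eq_mul {z v : ℂ} (hv : ‖v‖ < ‖z‖)
    (hseg : ∀ t : ℝ, 0 ≤ t → t ≤ 1 → z + t * v ∈ slitPlane) (N : ℕ) (s : ℂ) :
    shiftTerm z v N s = z ^ (-s) *
      ((1 + v / z) ^ (-s) - ∑ l ∈ range N, Ring.choose (-s) l * (v / z) ^ l) := by
  have hz : z ≠ 0 := norm_pos_iff.1 ((norm_nonneg v).trans_lt hv)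
  rw [shiftTerm, cpow_add_eq hv hseg, mul_sub, mul_sum]
  congr 1
  refine sum_congr rfl fun l _ => ?_
  rw [cpow_neg_add_natCast hz, div_pow]
  field_simp

theorem differentiable_shiftTerm {z v : ℂ} (hz : z ≠ 0) (hzv : z + v ≠ 0) (N : ℕ) :
    Differentiable ℂ (shiftTerm z v N) := by
  have h1 : ∀ w : ℂ, w ≠ 0 → ∀ l : ℂ, Differentiable ℂ fun s : ℂ => w ^ (-(s + l)) :=
    fun w hw l s => DifferentiableAt.const_cpow (by fun_prop) (Or.inl hw)
  refine Differentiable.sub (by simpa using h1 _ hzv 0) ?_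
  refine Differentiable.fun_sum fun l _ => ?_
  exact ((differentiable_ring_choose_neg l).mul (h1 z hz l)).mul_const _

/-- When `Re z > 2‖v‖`, the segment from `z` to `z + v` stays in the right half-plane and `‖v / z‖ ≤
1/2`; removing `N` terms gains a factor `‖z‖^(-N)`. -/
theorem norm_shiftTerm_le {z v s : ℂ} {R T A B : ℝ} (hv : 2 * ‖v‖ < z.re) (hR : ‖s‖ ≤ R)
    (hT : |s.im| ≤ T) (hA : A ≤ s.re) (hB : s.re ≤ B) (N : ℕ) :
    ‖shiftTerm z v N s‖ ≤ (‖z‖ ^ (-(A + N)) + ‖z‖ ^ (-(B + N))) *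
      (Real.exp (Real.pi * T) *
        (‖v‖ ^ N * ∑' l : ℕ, ‖Ring.choose (-(R : ℂ)) (l + N)‖ * (1 / 2) ^ l)) := by
  have hv0 := norm_nonneg v
  have hre : z.re ≤ ‖z‖ := re_le_norm z
  have hp : 0 < ‖z‖ := by linarith
  have hz : z ≠ 0 := norm_pos_iff.1 hp
  have hseg : ∀ t : ℝ, 0 ≤ t → t ≤ 1 → z + t * v ∈ slitPlane := by
    intro t ht0 ht1
    refine Or.inl ?_
    have h1 : |((t : ℂ) * v).re| ≤ ‖v‖ := by
      refine (abs_re_le_norm _).trans ?_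
      rw [norm_mul, norm_real, Real.norm_of_nonneg ht0]
      exact mul_le_of_le_one_left hv0 ht1
    rw [add_re]
    linarith [neg_abs_le ((t : ℂ) * v).re]
  rw [shiftTerm_eq_mul (by linarith) hseg, norm_mul]
  have h1 : ‖v / z‖ ≤ 1 / 2 := by
    rw [norm_div, div_le_iff₀ hp]
    linarith
  have h2 := norm_one_add_cpow_sub_le hR h1 (by norm_num) N
  have h3 := norm_cpow_le_mul_exp hz (-s)
  rw [neg_re, neg_im, abs_neg] at h3
  set K := ∑' l : ℕ, ‖Ring.choose (-(R : ℂ)) (l + N)‖ * (1 / 2 : ℝ) ^ l with hK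
  have hK0 : 0 ≤ K := tsum_nonneg fun l => by positivity
  calc _ ≤ (‖z‖ ^ (-s.re) * Real.exp (Real.pi * |s.im|)) * (‖v / z‖ ^ N * K) := by gcongr
    _ = ‖z‖ ^ (-(s.re + N)) * (Real.exp (Real.pi * |s.im|) * (‖v‖ ^ N * K)) := by
        rw [norm_div, div_pow, neg_add, Real.rpow_add hp, Real.rpow_neg hp.le (N : ℝ),
          Real.rpow_natCast]
        field_simp
    _ ≤ _ := by
        gcongr
        exact rpow_neg_le_add hp (by linarith) (by linarith)

section Shift

variable {ι : Type*} {z : ι → ℂ} {v : ℂ}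

/-- The estimate for large `Re z` covers all but finitely many indices. Each exceptional remainder
is entire in `s`, hence bounded on a compact disk, whatever branches occur. -/
theorem exists_summable_bound_shiftTerm (hz : ∀ i, z i ≠ 0) (hzv : ∀ i, z i + v ≠ 0)
    (hs : ∀ x : ℝ, 1 / 2 < x → Summable fun i => ‖z i‖ ^ (-x))
    (hre : ∀ C : ℝ, ∀ᶠ i in cofinite, C < (z i).re) {N : ℕ} {p : ℂ} (hp : 1 / 2 < p.re + N) :
    ∃ δ > 0, ∃ u : ι → ℝ, Summable u ∧
      ∀ i, ∀ s ∈ Metric.ball p δ, ‖shiftTerm (z i) v N s‖ ≤ u i := by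
  obtain ⟨δ, hδ, hδp⟩ : ∃ δ > 0, 1 / 2 < p.re - δ + N :=
    ⟨(p.re + N - 1 / 2) / 2, by linarith, by linarith⟩
  have hbd : ∀ i, ∃ C : ℝ, ∀ s ∈ Metric.closedBall p δ, ‖shiftTerm (z i) v N s‖ ≤ C := fun i =>
    (isCompact_closedBall p δ).exists_bound_of_continuousOn
      (differentiable_shiftTerm (hz i) (hzv i) N).continuous.continuousOn
  choose C hC using hbd
  classical
  set K : ℝ := Real.exp (Real.pi * (|p.im| + δ)) *
    (‖v‖ ^ N * ∑' l : ℕ, ‖Ring.choose (-((‖p‖ + δ : ℝ) : ℂ)) (l + N)‖ * (1 / 2) ^ l)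
  set u₀ : ι → ℝ := fun i =>
    (‖z i‖ ^ (-(p.re - δ + N)) + ‖z i‖ ^ (-(p.re + δ + N))) * K with hu₀
  have hu : Summable u₀ := ((hs _ hδp).add (hs _ (by linarith))).mul_right K
  refine ⟨δ, hδ, fun i => if 2 * ‖v‖ < (z i).re then u₀ i else C i, ?_, fun i s hsb => ?_⟩
  · refine hu.congr_cofinite ?_
    filter_upwards [hre (2 * ‖v‖)] with i hi
    rw [if_pos hi]
  · dsimp only
    split_ifs with hi
    · have h1 : ‖s - p‖ < δ := by simpa [dist_eq_norm] using hsb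
      have h2 := (abs_re_le_norm (s - p)).trans h1.le
      have h3 := (abs_im_le_norm (s - p)).trans h1.le
      rw [sub_re, abs_le] at h2
      rw [sub_im] at h3
      refine norm_shiftTerm_le hi ?_ ?_ (by linarith) (by linarith) N
      · linarith [norm_sub_norm_le s p]
      · linarith [abs_sub_abs_le_abs_sub s.im p.im]
    · exact hC i s (Metric.ball_subset_closedBall hsb)

theorem summable_shiftTerm (hz : ∀ i, z i ≠ 0) (hzv : ∀ i, z i + v ≠ 0)
    (hs : ∀ x : ℝ, 1 / 2 < x → Summable fun i => ‖z i‖ ^ (-x))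
    (hre : ∀ C : ℝ, ∀ᶠ i in cofinite, C < (z i).re) {N : ℕ} {p : ℂ} (hp : 1 / 2 < p.re + N) :
    Summable fun i => shiftTerm (z i) v N p := by
  obtain ⟨δ, hδ, u, hu, hb⟩ := exists_summable_bound_shiftTerm hz hzv hs hre hp
  exact Summable.of_norm_bounded hu fun i => hb i p (Metric.mem_ball_self hδ)

theorem analyticAt_tsum_shiftTerm (hz : ∀ i, z i ≠ 0) (hzv : ∀ i, z i + v ≠ 0)
    (hs : ∀ x : ℝ, 1 / 2 < x → Summable fun i => ‖z i‖ ^ (-x))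
    (hre : ∀ C : ℝ, ∀ᶠ i in cofinite, C < (z i).re) {N : ℕ} {p : ℂ} (hp : 1 / 2 < p.re + N) :
    AnalyticAt ℂ (fun s => ∑' i, shiftTerm (z i) v N s) p := by
  obtain ⟨δ, hδ, u, hu, hb⟩ := exists_summable_bound_shiftTerm hz hzv hs hre hp
  exact analyticAt_tsum_of_bound Metric.isOpen_ball (Metric.mem_ball_self hδ) hu
    (fun i => (differentiable_shiftTerm (hz i) (hzv i) N).differentiableOn) hb

/-- The candidate for the continuation of `∑ (z i + v) ^ (-s)` to `Re s > 1 / 2 - N`, where `Z`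
is the continuation of `∑ (z i) ^ (-s)`. -/
def shiftZetaAux (z : ι → ℂ) (Z : ℂ → ℂ) (v : ℂ) (N : ℕ) (s : ℂ) : ℂ :=
  ∑ l ∈ range N, Ring.choose (-s) l * v ^ l * Z (s + l) + ∑' i, shiftTerm (z i) v N s

/-- The continuation of `∑ (z i + v) ^ (-s)`, where `Z` is the continuation of
`∑ (z i) ^ (-s)`. -/
def shiftZeta (z : ι → ℂ) (Z : ℂ → ℂ) (v s : ℂ) : ℂ := shiftZetaAux z Z v ⌈1 - s.re⌉₊ s

variable {Z : ℂ → ℂ}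

/-- Raising the truncation moves one term out of every remainder; as `Re (s + N) > 1/2`, these terms
sum to the matching multiple of `Z (s + N)`. -/
theorem shiftZetaAux_eq_succ (hz : ∀ i, z i ≠ 0) (hzv : ∀ i, z i + v ≠ 0)
    (hs : ∀ x : ℝ, 1 / 2 < x → Summable fun i => ‖z i‖ ^ (-x))
    (hre : ∀ C : ℝ, ∀ᶠ i in cofinite, C < (z i).re)
    (hZ : ∀ s : ℂ, 1 / 2 < s.re → HasSum (fun i => z i ^ (-s)) (Z s)) {N : ℕ} {s : ℂ}
    (hN : 1 / 2 < s.re + N) : shiftZetaAux z Z v (N + 1) s = shiftZetaAux z Z v N s := by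
  have h1 := (hZ (s + N) (by simpa using hN)).mul_left (Ring.choose (-s) N * v ^ N)
  have h2 := (summable_shiftTerm hz hzv hs hre hN).hasSum.sub h1
  have h3 : ∀ i, shiftTerm (z i) v (N + 1) s =
      shiftTerm (z i) v N s - Ring.choose (-s) N * v ^ N * z i ^ (-(s + N)) := by
    intro i
    rw [shiftTerm, shiftTerm, sum_range_succ]
    ring
  rw [shiftZetaAux, shiftZetaAux, sum_range_succ, tsum_congr h3, h2.tsum_eq]
  ring

theorem shiftZetaAux_eq_of_le (hz : ∀ i, z i ≠ 0) (hzv : ∀ i, z i + v ≠ 0)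
    (hs : ∀ x : ℝ, 1 / 2 < x → Summable fun i => ‖z i‖ ^ (-x))
    (hre : ∀ C : ℝ, ∀ᶠ i in cofinite, C < (z i).re)
    (hZ : ∀ s : ℂ, 1 / 2 < s.re → HasSum (fun i => z i ^ (-s)) (Z s)) {N M : ℕ} (hNM : N ≤ M)
    {s : ℂ} (hN : 1 / 2 < s.re + N) : shiftZetaAux z Z v M s = shiftZetaAux z Z v N s := by
  induction M, hNM using Nat.le_induction with
  | base => rfl
  | succ M hM ih =>
    rw [shiftZetaAux_eq_succ hz hzv hs hre hZ, ih]
    have : (N : ℝ) ≤ M := by exact_mod_cast hM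
    linarith

theorem shiftZeta_eq (hz : ∀ i, z i ≠ 0) (hzv : ∀ i, z i + v ≠ 0)
    (hs : ∀ x : ℝ, 1 / 2 < x → Summable fun i => ‖z i‖ ^ (-x))
    (hre : ∀ C : ℝ, ∀ᶠ i in cofinite, C < (z i).re)
    (hZ : ∀ s : ℂ, 1 / 2 < s.re → HasSum (fun i => z i ^ (-s)) (Z s)) {N : ℕ} {s : ℂ}
    (hN : 1 / 2 < s.re + N) : shiftZeta z Z v s = shiftZetaAux z Z v N s := by
  -- The ceiling gives `Re s + N ≥ 1`, comfortably inside the convergence region.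
  have h0 : 1 / 2 < s.re + (⌈1 - s.re⌉₊ : ℝ) := by linarith [Nat.le_ceil (1 - s.re)]
  rw [shiftZeta, ← shiftZetaAux_eq_of_le hz hzv hs hre hZ (le_max_left _ N) h0,
    shiftZetaAux_eq_of_le hz hzv hs hre hZ (le_max_right _ N) hN]

theorem shiftZeta_eventuallyEq (hz : ∀ i, z i ≠ 0) (hzv : ∀ i, z i + v ≠ 0)
    (hs : ∀ x : ℝ, 1 / 2 < x → Summable fun i => ‖z i‖ ^ (-x))
    (hre : ∀ C : ℝ, ∀ᶠ i in cofinite, C < (z i).re)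
    (hZ : ∀ s : ℂ, 1 / 2 < s.re → HasSum (fun i => z i ^ (-s)) (Z s)) {N : ℕ} {p : ℂ}
    (hN : 1 / 2 < p.re + N) : shiftZeta z Z v =ᶠ[𝓝 p] shiftZetaAux z Z v N := by
  have ho : IsOpen {s : ℂ | 1 / 2 < s.re + N} := isOpen_lt continuous_const (by fun_prop)
  filter_upwards [ho.mem_nhds hN] with s hs' using shiftZeta_eq hz hzv hs hre hZ hs'

theorem hasSum_shiftZeta (hz : ∀ i, z i ≠ 0) (hzv : ∀ i, z i + v ≠ 0)
    (hs : ∀ x : ℝ, 1 / 2 < x → Summable fun i => ‖z i‖ ^ (-x))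
    (hre : ∀ C : ℝ, ∀ᶠ i in cofinite, C < (z i).re)
    (hZ : ∀ s : ℂ, 1 / 2 < s.re → HasSum (fun i => z i ^ (-s)) (Z s)) {s : ℂ}
    (h : 1 / 2 < s.re) : HasSum (fun i => (z i + v) ^ (-s)) (shiftZeta z Z v s) := by
  have h0 : 1 / 2 < s.re + ((0 : ℕ) : ℝ) := by simpa using h
  rw [shiftZeta_eq hz hzv hs hre hZ h0]
  have h1 := (summable_shiftTerm hz hzv hs hre h0).hasSum
  simpa [shiftZetaAux, shiftTerm] using h1

theorem shiftZeta_zero (hz : ∀ i, z i ≠ 0)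
    (hs : ∀ x : ℝ, 1 / 2 < x → Summable fun i => ‖z i‖ ^ (-x))
    (hre : ∀ C : ℝ, ∀ᶠ i in cofinite, C < (z i).re)
    (hZ : ∀ s : ℂ, 1 / 2 < s.re → HasSum (fun i => z i ^ (-s)) (Z s)) (s : ℂ) :
    shiftZeta z Z 0 s = Z s := by
  -- The extra 1 makes the truncation positive, so that the `l = 0` term `Z s` is present.
  have h0 : 1 / 2 < s.re + ((⌈1 - s.re⌉₊ + 1 : ℕ) : ℝ) := by
    push_cast
    linarith [Nat.le_ceil (1 - s.re)]
  rw [shiftZeta_eq hz (by simpa using hz) hs hre hZ h0, shiftZetaAux]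
  simp [shiftTerm, sum_range_succ']

theorem analyticAt_shiftZeta (hz : ∀ i, z i ≠ 0) (hzv : ∀ i, z i + v ≠ 0)
    (hs : ∀ x : ℝ, 1 / 2 < x → Summable fun i => ‖z i‖ ^ (-x))
    (hre : ∀ C : ℝ, ∀ᶠ i in cofinite, C < (z i).re)
    (hZ : ∀ s : ℂ, 1 / 2 < s.re → HasSum (fun i => z i ^ (-s)) (Z s))
    (hZa : ∀ s : ℂ, (∀ m : ℕ, s ≠ 1 / 2 - m) → AnalyticAt ℂ Z s) {p : ℂ}
    (hp : ∀ m : ℕ, p ≠ 1 / 2 - m) : AnalyticAt ℂ (shiftZeta z Z v) p := by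
  obtain ⟨N, hN⟩ : ∃ N : ℕ, 1 / 2 < p.re + N := by
    obtain ⟨N, hN⟩ := exists_nat_gt (1 / 2 - p.re)
    exact ⟨N, by linarith⟩
  refine AnalyticAt.congr ?_ (shiftZeta_eventuallyEq hz hzv hs hre hZ hN).symm
  refine AnalyticAt.add ?_ (analyticAt_tsum_shiftTerm hz hzv hs hre hN)
  refine Finset.analyticAt_fun_sum _ fun l _ => ?_
  have h1 : AnalyticAt ℂ Z (p + l) := hZa _ fun m hm => hp (m + l) (by
    push_cast
    linear_combination hm)
  exact (((differentiable_ring_choose_neg l).mul_const _).analyticAt p).mul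
    (h1.comp_of_eq (f := fun s : ℂ => s + l) (by fun_prop) rfl)

end Shift

/-! ### Polar parts, special values and power series of the shifted zeta function. -/

section ShiftPoles

variable {ι : Type*} {z : ι → ℂ} {v : ℂ} {Z : ℂ → ℂ}

/-- Near `1/2 - m`, the term `Z (s + l)` sees the pole of `Z` at `1/2 - (m - l)`. Only `l = m`
reaches the double pole, which also picks up the derivative of its binomial coefficient. -/
theorem hasPolarPart_shiftZeta (hz : ∀ i, z i ≠ 0) (hzv : ∀ i, z i + v ≠ 0)
    (hs : ∀ x : ℝ, 1 / 2 < x → Summable fun i => ‖z i‖ ^ (-x))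
    (hre : ∀ C : ℝ, ∀ᶠ i in cofinite, C < (z i).re)
    (hZ : ∀ s : ℂ, 1 / 2 < s.re → HasSum (fun i => z i ^ (-s)) (Z s)) {A : ℂ} {B : ℕ → ℂ}
    (hp : ∀ m : ℕ, HasPolarPart Z (1 / 2 - m) (if m = 0 then A else 0) (B m)) (m : ℕ) :
    HasPolarPart (shiftZeta z Z v) (1 / 2 - m) (Ring.choose (m - 1 / 2 : ℂ) m * v ^ m * A)
      (deriv (fun s : ℂ => Ring.choose (-s) m * v ^ m) (1 / 2 - m) * A +
        ∑ l ∈ range (m + 1), Ring.choose (m - 1 / 2 : ℂ) l * v ^ l * B (m - l)) := by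
  have hN : 1 / 2 < (1 / 2 - m : ℂ).re + ((m + 1 : ℕ) : ℝ) := by simp; linarith
  have hφ : ∀ l : ℕ, AnalyticAt ℂ (fun s : ℂ => Ring.choose (-s) l * v ^ l) (1 / 2 - m) :=
    fun l => ((differentiable_ring_choose_neg l).mul_const _).analyticAt _
  have h1 : ∀ l ∈ range (m + 1), HasPolarPart
      (fun s : ℂ => Ring.choose (-s) l * v ^ l * Z (s + l)) (1 / 2 - m)
      (Ring.choose (m - 1 / 2 : ℂ) l * v ^ l * (if m - l = 0 then A else 0))
      (deriv (fun s : ℂ => Ring.choose (-s) l * v ^ l) (1 / 2 - m) *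
        (if m - l = 0 then A else 0) + Ring.choose (m - 1 / 2 : ℂ) l * v ^ l * B (m - l)) := by
    intro l hl
    have hlm : l ≤ m := Nat.lt_succ_iff.1 (mem_range.1 hl)
    have h2 := hp (m - l)
    -- The translation `s + l` is put in the form `α - β s` with `β = -1`, as `comp_affine`
    -- requires.
    have h3 : (1 / 2 - ((m - l : ℕ) : ℂ)) = (l : ℂ) - (-1) * (1 / 2 - m) := by
      push_cast [hlm]
      ring
    rw [h3] at h2
    have h4 := (h2.comp_affine (neg_ne_zero.2 one_ne_zero)).mul_left (hφ l)
    have h5 : -(1 / 2 - m : ℂ) = m - 1 / 2 := by ring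
    simp only [h5] at h4
    convert h4 using 1
    · funext s
      congr 2
      ring
    · simp
    · simp
  have h2 := (HasPolarPart.sum _ h1).add
    (HasPolarPart.of_analyticAt (analyticAt_tsum_shiftTerm hz hzv hs hre hN))
  have h3 := h2.congr (f' := shiftZeta z Z v)
    ((shiftZeta_eventuallyEq hz hzv hs hre hZ hN).symm.filter_mono nhdsWithin_le_nhds)
  have h4 : ∀ l ∈ range m, m - l ≠ 0 := fun l hl => by
    have := mem_range.1 hl
    omega
  convert h3 using 1
  · rw [sum_range_succ, sum_eq_zero fun l hl => by rw [if_neg (h4 l hl), mul_zero]]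
    simp
  · rw [sum_add_distrib, sum_range_succ (fun l => deriv _ _ * _),
      sum_eq_zero (s := range m) fun l hl => by rw [if_neg (h4 l hl), mul_zero]]
    simp

/-- At `s = -m` the binomial formula terminates, so with `m + 1` terms every remainder is zero. -/
theorem shiftZeta_neg_natCast (hz : ∀ i, z i ≠ 0) (hzv : ∀ i, z i + v ≠ 0)
    (hs : ∀ x : ℝ, 1 / 2 < x → Summable fun i => ‖z i‖ ^ (-x))
    (hre : ∀ C : ℝ, ∀ᶠ i in cofinite, C < (z i).re)
    (hZ : ∀ s : ℂ, 1 / 2 < s.re → HasSum (fun i => z i ^ (-s)) (Z s)) (m : ℕ) :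
    shiftZeta z Z v (-m) = ∑ l ∈ range (m + 1), (m.choose l : ℂ) * Z (-m + l) * v ^ l := by
  have hN : 1 / 2 < (-m : ℂ).re + ((m + 1 : ℕ) : ℝ) := by simp; norm_num
  rw [shiftZeta_eq hz hzv hs hre hZ hN, shiftZetaAux]
  have h1 : ∀ i, shiftTerm (z i) v (m + 1) (-m) = 0 := by
    intro i
    rw [shiftTerm, neg_neg, cpow_natCast, add_comm, add_pow, sub_eq_zero]
    refine sum_congr rfl fun l hl => ?_
    have hlm : l ≤ m := Nat.lt_succ_iff.1 (mem_range.1 hl)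
    have h2 : -(-(m : ℂ) + l) = ((m - l : ℕ) : ℂ) := by
      push_cast [hlm]
      ring
    rw [h2, cpow_natCast, Ring.choose_natCast]
    ring
  rw [tsum_congr h1, tsum_zero, add_zero]
  refine sum_congr rfl fun l _ => ?_
  rw [neg_neg, Ring.choose_natCast]
  ring

theorem ring_choose_sub_half (m l : ℕ) : Ring.choose (m - 1 / 2 : ℂ) l =
    Gamma (m + 1 / 2) / (l.factorial * Gamma (m + 1 / 2 - l)) := by
  have h := choose_neg_eq_gamma (1 / 2 - m) (fun n hn => ?_) l
  · convert h using 2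
    · ring
    · ring_nf
    · ring_nf
  · have h1 := congrArg re hn
    have h2 : ((m + n : ℕ) : ℝ) = -(1 / 2) := by
      simp at h1
      push_cast
      linarith
    linarith [(m + n).cast_nonneg (α := ℝ)]

/-- Logarithmic differentiation of the product gives `-∑ 1/(m - 1/2 - l)` over `l < m`; the
substitution `l = m - j` turns the summands into `2/(2j - 1)`. -/
theorem deriv_ring_choose_neg (m : ℕ) :
    deriv (fun s : ℂ => Ring.choose (-s) m) (1 / 2 - m) =
      -(2 * ∑ j ∈ Icc 1 m, 1 / (2 * (j : ℂ) - 1)) * Ring.choose (m - 1 / 2 : ℂ) m := by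
  have hne : ∀ j : ℕ, 2 * (j : ℂ) - 1 ≠ 0 := by
    intro j hj
    have : (2 * (j : ℤ) - 1 : ℤ) = 0 := by exact_mod_cast hj
    omega
  have key : ∀ k ≤ m, deriv (fun s : ℂ => Ring.choose (-s) k) (1 / 2 - m) =
      -(∑ l ∈ range k, 1 / ((m : ℂ) - 1 / 2 - l)) * Ring.choose (m - 1 / 2 : ℂ) k := by
    intro k
    induction k with
    | zero => simp
    | succ k ih =>
      intro hk
      have h1 : (m : ℂ) - 1 / 2 - k ≠ 0 := by
        have h2 := hne (m - k)
        have hkm : k ≤ m := by omega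
        push_cast [hkm] at h2
        intro h3
        apply h2
        linear_combination 2 * h3
      have hd := ((hasDerivAt_id (1 / 2 - m : ℂ)).neg.sub_const (k : ℂ)).div_const ((k : ℂ) + 1)
        |>.mul (differentiable_ring_choose_neg k (1 / 2 - m)).hasDerivAt
      simp only [ring_choose_succ]
      rw [show (fun s : ℂ => (-s - k) / (k + 1) * Ring.choose (-s) k) =
        (fun s : ℂ => (-s - k) / (k + 1)) * fun s : ℂ => Ring.choose (-s) k from rfl]
      refine (HasDerivAt.deriv hd).trans ?_
      rw [ih (by omega), sum_range_succ]
      have h4 : -(1 / 2 - m : ℂ) = m - 1 / 2 := by ring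
      have h5 : (k : ℂ) + 1 ≠ 0 := Nat.cast_add_one_ne_zero k
      simp only [Pi.neg_apply, id, h4]
      generalize (∑ l ∈ range k, 1 / ((m : ℂ) - 1 / 2 - l)) = S
      generalize (m : ℂ) - 1 / 2 - k = d at h1 ⊢
      field_simp
      ring
  rw [key m le_rfl]
  congr 2
  rw [mul_sum, ← sum_range_reflect, ← Finset.Ico_add_one_right_eq_Icc, sum_Ico_eq_sum_range,
    Nat.add_sub_cancel]
  refine sum_congr rfl fun j hj => ?_
  have h1 := mem_range.1 hj
  have h2 : ((m - 1 - j : ℕ) : ℂ) = m - 1 - j := by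
    rw [Nat.cast_sub (by omega), Nat.cast_sub (by omega)]
    simp
  have h3 := hne (1 + j)
  rw [h2, show (m : ℂ) - 1 / 2 - (m - 1 - j) = (2 * ((1 + j : ℕ) : ℂ) - 1) / 2 by
    push_cast; ring]
  field_simp

/-- Strict pointwise inequalities become uniform: the tail has ratio at most `1/2`, and finitely
many indices remain. -/
theorem exists_norm_div_le (hre : ∀ C : ℝ, ∀ᶠ i in cofinite, C < (z i).re)
    (hv : ∀ i, ‖v‖ < ‖z i‖) : ∃ ρ < 1, ∀ i, ‖v / z i‖ ≤ ρ := by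
  have hfin : {i | ¬ 2 * ‖v‖ < (z i).re}.Finite := hre (2 * ‖v‖)
  have hlt : ∀ i, ‖v / z i‖ < 1 := fun i => by
    rw [norm_div, div_lt_one ((norm_nonneg v).trans_lt (hv i))]
    exact hv i
  have h1 : ∀ᶠ ρ : ℝ in 𝓝[<] 1, ∀ i ∈ {i | ¬ 2 * ‖v‖ < (z i).re}, ‖v / z i‖ ≤ ρ :=
    (eventually_all_finite hfin).2 fun i _ =>
      (eventually_ge_nhds (hlt i)).filter_mono nhdsWithin_le_nhds
  have h2 : ∀ᶠ ρ : ℝ in 𝓝[<] 1, 1 / 2 < ρ :=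
    (eventually_gt_nhds (by norm_num)).filter_mono nhdsWithin_le_nhds
  obtain ⟨ρ, h1, h2, h3⟩ := (h1.and (h2.and eventually_mem_nhdsWithin)).exists
  refine ⟨ρ, h3, fun i => ?_⟩
  by_cases hi : 2 * ‖v‖ < (z i).re
  · refine le_trans ?_ h2.le
    rw [norm_div, div_le_iff₀ ((norm_nonneg v).trans_lt (hv i))]
    linarith [re_le_norm (z i)]
  · exact h1 i hi

/-- The expansion of the shifted zeta function in powers of the shift. -/
theorem hasSum_shiftZeta_pow
    (hs : ∀ x : ℝ, 1 / 2 < x → Summable fun i => ‖z i‖ ^ (-x))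
    (hre : ∀ C : ℝ, ∀ᶠ i in cofinite, C < (z i).re)
    (hZ : ∀ s : ℂ, 1 / 2 < s.re → HasSum (fun i => z i ^ (-s)) (Z s))
    (hv : ∀ i, ‖v‖ < ‖z i‖)
    (hseg : ∀ t : ℝ, 0 ≤ t → t ≤ 1 → ∀ i, z i + t * v ∈ slitPlane) (s : ℂ) :
    HasSum (fun l : ℕ => Ring.choose (-s) l * Z (s + l) * v ^ l) (shiftZeta z Z v s) := by
  have hz0 : ∀ i, 0 < ‖z i‖ := fun i => (norm_nonneg v).trans_lt (hv i)
  have hz : ∀ i, z i ≠ 0 := fun i => norm_pos_iff.1 (hz0 i)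
  have hzv : ∀ i, z i + v ≠ 0 := fun i =>
    slitPlane_ne_zero (by simpa using hseg 1 zero_le_one le_rfl i)
  obtain ⟨ρ, hρ1, hρ⟩ := exists_norm_div_le hre hv
  obtain ⟨N, hN⟩ : ∃ N : ℕ, 1 / 2 < s.re + N := by
    obtain ⟨N, hN⟩ := exists_nat_gt (1 / 2 - s.re)
    exact ⟨N, by linarith⟩
  -- The first `N` terms match those of `shiftZetaAux`. What remains involves only `Z` in its
  -- half-plane of convergence, so `Z` can be replaced by its series.
  rw [← hasSum_nat_add_iff' N, shiftZeta_eq hz hzv hs hre hZ hN, shiftZetaAux]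
  have e1 : ∀ T : ℂ, ∑ l ∈ range N, Ring.choose (-s) l * v ^ l * Z (s + l) + T -
      ∑ l ∈ range N, Ring.choose (-s) l * Z (s + l) * v ^ l = T := by
    intro T
    rw [sum_congr rfl fun l _ => mul_right_comm (Ring.choose (-s) l) (v ^ l) (Z (s + l))]
    ring
  rw [e1]
  -- An index is needed to know `ρ ≥ 0`; for an empty family both sides vanish.
  rcases isEmpty_or_nonempty ι with hι | ⟨⟨i₀⟩⟩
  · have hZ0 : ∀ w : ℂ, 1 / 2 < w.re → Z w = 0 := fun w hw => (hZ w hw).unique hasSum_empty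
    rw [tsum_empty]
    convert hasSum_zero with l
    rw [hZ0, mul_zero, zero_mul]
    simp only [add_re, natCast_re]
    push_cast
    linarith [l.cast_nonneg (α := ℝ)]
  have hρ0 : 0 ≤ ρ := (norm_nonneg _).trans (hρ i₀)
  -- This double family is absolutely summable. Summing first over `l` gives the remainders, first
  -- over `i` gives the coefficients of the power series.
  set F : ι × ℕ → ℂ := fun x =>
    Ring.choose (-s) (x.2 + N) * v ^ (x.2 + N) * z x.1 ^ (-(s + (x.2 + N : ℕ))) with hF
  have hc : Summable fun l : ℕ => ‖Ring.choose (-s) (l + N)‖ * ρ ^ l :=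
    summable_norm_ring_choose_add (-s) hρ0 hρ1 N
  have hsum : Summable F := by
    refine Summable.of_norm_bounded
      ((((hs _ hN).mul_right (Real.exp (Real.pi * |s.im|) * ‖v‖ ^ N)).mul_of_nonneg hc
        (fun i => by positivity) fun l => by positivity)) fun x => ?_
    obtain ⟨i, l⟩ := x
    have h1 := norm_cpow_le_mul_exp (hz i) (-(s + N))
    have h2 : ‖z i ^ (-(s + (l + N : ℕ)))‖ = ‖z i ^ (-(s + N))‖ / ‖z i‖ ^ l := by
      rw [← norm_pow, ← norm_div, ← cpow_neg_add_natCast (hz i)]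
      congr 3
      push_cast
      ring
    simp only [neg_re, neg_im, add_re, add_im, natCast_re, natCast_im, add_zero, abs_neg] at h1
    have h3 := hρ i
    rw [norm_div, div_le_iff₀ (hz0 i)] at h3
    calc ‖F (i, l)‖ = ‖Ring.choose (-s) (l + N)‖ * (‖v‖ ^ l * ‖v‖ ^ N) *
          (‖z i ^ (-(s + N))‖ / ‖z i‖ ^ l) := by
          rw [hF]
          simp only [norm_mul, norm_pow, h2, pow_add]
      _ ≤ ‖Ring.choose (-s) (l + N)‖ * ((ρ * ‖z i‖) ^ l * ‖v‖ ^ N) *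
          ((‖z i‖ ^ (-(s.re + N)) * Real.exp (Real.pi * |s.im|)) / ‖z i‖ ^ l) := by gcongr
      _ = _ := by
          have := (pow_pos (hz0 i) l).ne'
          rw [mul_pow]
          field_simp
  have hrow : ∀ i, HasSum (fun l => F (i, l)) (shiftTerm (z i) v N s) := by
    intro i
    rw [shiftTerm_eq_mul (hv i) fun t h0 h1 => hseg t h0 h1 i]
    have h1 := (hasSum_nat_add_iff' N).2
      (hasSum_one_add_cpow (-s) ((hρ i).trans_lt hρ1))
    have h2 : (fun l => F (i, l)) = fun l =>
        z i ^ (-s) * (Ring.choose (-s) (l + N) * (v / z i) ^ (l + N)) := by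
      funext l
      rw [hF]
      dsimp only
      rw [cpow_neg_add_natCast (hz i), div_pow]
      ring
    rw [h2]
    exact h1.mul_left (z i ^ (-s))
  have hcol : ∀ l, HasSum (fun i => F (i, l))
      (Ring.choose (-s) (l + N) * Z (s + (l + N : ℕ)) * v ^ (l + N)) := by
    intro l
    have h1 : 1 / 2 < (s + (l + N : ℕ)).re := by
      simp only [add_re, natCast_re]
      push_cast
      linarith [l.cast_nonneg (α := ℝ)]
    rw [mul_right_comm]
    exact (hZ _ h1).mul_left (Ring.choose (-s) (l + N) * v ^ (l + N))
  have h1 := hsum.hasSum.prod_fiberwise hrow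
  rw [h1.tsum_eq]
  exact ((Equiv.prodComm ℕ ι).hasSum_iff.2 hsum.hasSum).prod_fiberwise hcol

end ShiftPoles

/-- The `a₁` term is the derivative of the binomial coefficient times the double-pole coefficient,
the `b₁` term is `l = m`, and `j = m - l` reindexes the others. -/
theorem residuePoly_eq {a₁ b₁ : ℂ} {q : ℕ} {Zt : ℂ → ℂ} {B : ℕ → ℂ}
    (h0 : B 0 = b₁ / (2 * Real.pi)) (hB : ∀ j : ℕ, 1 ≤ j → B j = basicResidue q Zt j) (m : ℕ)
    (v : ℂ) : residuePoly a₁ b₁ q Zt m v =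
      deriv (fun s : ℂ => Ring.choose (-s) m * v ^ m) (1 / 2 - m) * (a₁ / (4 * Real.pi)) +
        ∑ l ∈ range (m + 1), Ring.choose (m - 1 / 2 : ℂ) l * v ^ l * B (m - l) := by
  have hpi : (Real.pi : ℂ) ≠ 0 := ofReal_ne_zero.2 Real.pi_ne_zero
  have hm : (m : ℂ) + 1 / 2 - m = 1 / 2 := by ring
  rw [deriv_mul_const (differentiable_ring_choose_neg m _), deriv_ring_choose_neg, residuePoly,
    sum_range_succ, Nat.sub_self, h0, ring_choose_sub_half m m, hm]
  have h1 : ∑ l ∈ range m, Ring.choose (m - 1 / 2 : ℂ) l * v ^ l * B (m - l) =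
      ∑ j ∈ Icc 1 m, Gamma (1 / 2 + m) / ((m - j).factorial * Gamma (1 / 2 + j)) *
        basicResidue q Zt j * v ^ (m - j) := by
    rw [← sum_range_reflect, ← Finset.Ico_add_one_right_eq_Icc, sum_Ico_eq_sum_range,
      Nat.add_sub_cancel]
    refine sum_congr rfl fun j hj => ?_
    have h2 := mem_range.1 hj
    have h3 : m - 1 - j = m - (1 + j) := by omega
    have h4 : m - (m - (1 + j)) = 1 + j := by omega
    have h5 : (m : ℂ) + 1 / 2 - ((m - (1 + j) : ℕ) : ℂ) = 1 / 2 + ((1 + j : ℕ) : ℂ) := by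
      rw [Nat.cast_sub (by omega)]
      ring
    rw [h3, h4, hB _ (by omega), ring_choose_sub_half, h5, add_comm (m : ℂ) (1 / 2)]
    ring
  rw [h1]
  generalize Gamma (m + 1 / 2) / (m.factorial * Gamma (1 / 2)) = K
  generalize ∑ j ∈ Icc 1 m, 1 / (2 * (j : ℂ) - 1) = S
  field_simp
  ring

/-! ### The zeta function over the zeros of `G`. -/

/-- The slack between an admissible exponent `r' < r` and `r` absorbs the translation, since `2^r' ≤
‖z‖^(r - r')` for large `z`. -/
theorem HasGrowthOrder.isBigO_comp_const_add {f : ℂ → ℂ} {μ r : ℝ} (h : HasGrowthOrder f μ)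
    (hr : μ < r) (c : ℂ) :
    (fun z => f (c + z)) =O[cocompact ℂ] fun z : ℂ => Real.exp (‖z‖ ^ r) := by
  obtain ⟨r', ⟨hr'0, hf⟩, hr'⟩ := (isGLB_lt_iff h).1 hr
  have h1 := hf.comp_tendsto (Homeomorph.addLeft c).isClosedEmbedding.tendsto_cocompact
  refine h1.trans (IsBigO.of_bound 1 ?_)
  have h2 := (tendsto_rpow_atTop (sub_pos.2 hr')).comp (tendsto_norm_cocompact_atTop (E := ℂ))
  filter_upwards [h2.eventually_ge_atTop ((2 : ℝ) ^ r'),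
    (tendsto_norm_cocompact_atTop (E := ℂ)).eventually_ge_atTop (‖c‖ + 1)] with z hz1 hz2
  have hc := norm_nonneg c
  have hz : 0 < ‖z‖ := by linarith
  simp only [Function.comp, Homeomorph.coe_addLeft] at hz1 ⊢
  rw [one_mul, Real.norm_of_nonneg (Real.exp_nonneg _), Real.norm_of_nonneg (Real.exp_nonneg _)]
  refine Real.exp_le_exp.2 ?_
  calc ‖c + z‖ ^ r' ≤ (2 * ‖z‖) ^ r' := by
        gcongr
        linarith [norm_add_le c z]
    _ = (2 : ℝ) ^ r' * ‖z‖ ^ r' := Real.mul_rpow (by norm_num) hz.le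
    _ ≤ ‖z‖ ^ (r - r') * ‖z‖ ^ r' := by gcongr
    _ = ‖z‖ ^ r := by rw [← Real.rpow_add hz]; ring_nf

namespace IsZeroFamily

theorem comp_const_add {ι : Type*} {f : ℂ → ℂ} {ρ : ι → ℂ} (h : IsZeroFamily f ρ) (c : ℂ) :
    IsZeroFamily (fun z => f (c + z)) (fun i => ρ i - c) := by
  intro z
  have h1 : analyticOrderAt (f ∘ fun z => c + z) z = analyticOrderAt f (c + z) :=
    analyticOrderAt_comp_of_deriv_ne_zero (by fun_prop) (by simp)
  refine h1.trans ((h _).trans ?_)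
  congr 1
  ext i
  simp only [Set.mem_ofPred_eq, sub_eq_iff_eq_add, add_comm c]

/-- Nonvanishing at one point excludes infinite order everywhere, so `Fin` of the order has the
right number of copies of each zero. -/
theorem sigma {f : ℂ → ℂ} (hf : Differentiable ℂ f) {w : ℂ} (hw : f w ≠ 0) :
    IsZeroFamily f fun i : Σ ξ : ℂ, Fin (analyticOrderNatAt f ξ) => i.1 := by
  intro z
  have h1 : analyticOrderAt f z ≠ ⊤ := by
    refine AnalyticOnNhd.analyticOrderAt_ne_top_of_isPreconnected (x := w) (U := Set.univ)
      (fun x _ => hf.analyticAt x) isPreconnected_univ trivial trivial ?_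
    rw [(hf.analyticAt w).analyticOrderAt_eq_zero.2 hw]
    exact ENat.zero_ne_top
  have h2 : {i : Σ ξ : ℂ, Fin (analyticOrderNatAt f ξ) | i.1 = z} =
      Set.range (Sigma.mk z) := by
    ext ⟨ξ, k⟩
    constructor
    · rintro rfl
      exact ⟨k, rfl⟩
    · rintro ⟨j, hj⟩
      exact (congrArg Sigma.fst hj).symm
  rw [h2, ← Set.image_univ, sigma_mk_injective.encard_image, Set.encard_univ,
    ENat.card_eq_coe_fintype_card, Fintype.card_fin, Nat.cast_analyticOrderNatAt h1]

theorem countable {ι : Type*} {f : ℂ → ℂ} {ρ : ι → ℂ} (h : IsZeroFamily f ρ)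
    (hf : Differentiable ℂ f) (h0 : f 0 ≠ 0) {r : ℝ} (hr : 0 < r)
    (hg : f =O[cocompact ℂ] fun z : ℂ => Real.exp (‖z‖ ^ r)) : Countable ι := by
  rw [← Set.countable_univ_iff]
  have h1 : (Set.univ : Set ι) = ⋃ n : ℕ, {i | ‖ρ i‖ ≤ n} := by
    ext i
    simpa using exists_nat_ge ‖ρ i‖
  rw [h1]
  exact Set.countable_iUnion fun n => (h.finite_norm_le hf h0 hr hg n).countable

end IsZeroFamily

theorem awayFromNegative_of_eventually {ι : Type*} {z : ι → ℂ} (hz : ∀ i, z i ∈ slitPlane)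
    (hre : ∀ᶠ i in cofinite, 0 ≤ (z i).re) : AwayFromNegative z := by
  have hz0 : ∀ i, 0 < ‖z i‖ := fun i => norm_pos_iff.2 (slitPlane_ne_zero (hz i))
  obtain ⟨κ, hκ, hκ1, hκ0⟩ : ∃ κ : ℝ, (∀ i ∈ {i | ¬ 0 ≤ (z i).re}, κ ≤ (‖z i‖ + (z i).re) / ‖z i‖)
      ∧ κ ≤ 1 ∧ 0 < κ := by
    have h1 : ∀ᶠ κ : ℝ in 𝓝[>] 0, ∀ i ∈ {i | ¬ 0 ≤ (z i).re}, κ ≤ (‖z i‖ + (z i).re) / ‖z i‖ :=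
      (eventually_all_finite hre).2 fun i _ =>
        (eventually_le_nhds (div_pos (norm_add_re_pos (hz i)) (hz0 i))).filter_mono
          nhdsWithin_le_nhds
    exact (h1.and (((eventually_le_nhds one_pos).filter_mono nhdsWithin_le_nhds).and
      eventually_mem_nhdsWithin)).exists
  have hκ' : ∀ i, κ * ‖z i‖ ≤ ‖z i‖ + (z i).re := by
    intro i
    by_cases hi : 0 ≤ (z i).re
    · linarith [mul_le_of_le_one_left (hz0 i).le hκ1]
    · exact (le_div_iff₀ (hz0 i)).1 (hκ i hi)
  -- From `κ (‖z‖ + y)² ≤ 2 ‖z + y‖²`; as `κ ≤ 1`, the constant `(2/κ)²` exceeds the required `2/κ`,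
  -- and no square root is needed.
  refine ⟨hz, 2 / κ, by positivity, fun i y hy => ?_⟩
  have h1 := norm_add_ofReal_sq_ge (z i) (y := y)
  have h2 : κ * (‖z i‖ + y) ^ 2 ≤ 2 * ‖z i + y‖ ^ 2 := by
    have h3 := (mul_le_mul_of_nonneg_right (hκ' i) (sq_nonneg (‖z i‖ + y))).trans h1
    refine le_of_mul_le_mul_left ?_ (hz0 i)
    linarith
  refine le_of_sq_le_sq ?_ (by positivity)
  rw [mul_pow, div_pow, div_mul_eq_mul_div, le_div_iff₀ (by positivity)]
  have h4 := mul_le_mul_of_nonneg_left h2 hκ0.le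
  have h5 : κ * ‖z i + y‖ ^ 2 ≤ ‖z i + y‖ ^ 2 := mul_le_of_le_one_left (sq_nonneg _) hκ1
  nlinarith

theorem logDeriv_eq_deriv_of_exp {f g : ℂ → ℂ} {x : ℂ} (hg : AnalyticAt ℂ g x)
    (h : ∀ᶠ w in 𝓝 x, exp (g w) = f w) : logDeriv f x = deriv g x := by
  have h1 : f =ᶠ[𝓝 x] fun w => exp (g w) := h.mono fun w hw => hw.symm
  rw [logDeriv_apply, h1.deriv_eq, h1.eq_of_nhds, deriv_cexp hg.differentiableAt]
  field_simp

/-- The continuation of the zeta function over the zeros of `G`, with its pole and its values at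
the nonpositive integers. -/
theorem exists_shadowZeta {G : ℂ → ℂ} {a₁ b₁ a₀ b₀ : ℂ} {a : ℕ → ℂ} (hG : Differentiable ℂ G)
    (hord : HasGrowthOrder G 1) (hzeros : ∀ x : ℂ, G x = 0 → x.re ≤ 0)
    (hasy : HasStirlingExpansion G a₁ b₁ a₀ b₀ a) :
    ∃ Zt : ℂ → ℂ, (∀ s : ℂ, 1 < s.re →
        HasSum (fun ξ : ℂ => (analyticOrderNatAt G ξ : ℂ) * (1 / 2 - ξ) ^ (-s)) (Zt s)) ∧
      (∀ s : ℂ, s ≠ 1 → AnalyticAt ℂ Zt s) ∧ HasPolarPart Zt 1 0 a₁ ∧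
      ∀ n : ℕ, Zt (-n) = tracePoly a₁ a₀ a n (1 / 2) := by
  obtain ⟨logG, hlog, hasy⟩ := hasy
  have hlog1 : ∀ x : ℂ, 0 < x.re → AnalyticAt ℂ logG x := fun x hx => (hlog x hx).1
  have hne : ∀ x : ℂ, 0 < x.re → G x ≠ 0 := fun x hx h0 => (hzeros x h0).not_gt hx
  set f : ℂ → ℂ := fun z => G (1 / 2 + z) with hf
  have hfd : Differentiable ℂ f := by fun_prop
  have hf0 : f 0 ≠ 0 := hne _ (by simp)
  have hgr : ∀ r : ℝ, 1 < r → f =O[cocompact ℂ] fun z : ℂ => Real.exp (‖z‖ ^ r) := fun r hr =>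
    hord.isBigO_comp_const_add hr _
  have hfam := (IsZeroFamily.sigma hG (hne (1 / 2) (by simp))).comp_const_add (1 / 2)
  have hcount := hfam.countable hfd hf0 (by norm_num) (hgr 2 (by norm_num))
  set z : (Σ ξ : ℂ, Fin (analyticOrderNatAt G ξ)) → ℂ := fun i => 1 / 2 - i.1 with hz
  have hzre : ∀ i, 1 / 2 ≤ (z i).re := by
    intro i
    have h1 : G i.1 = 0 := by
      by_contra h0
      have h2 : analyticOrderNatAt G i.1 = 0 := by
        rw [analyticOrderNatAt, (hG.analyticAt _).analyticOrderAt_eq_zero.2 h0]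
        rfl
      exact (h2 ▸ i.2).elim0
    have := hzeros _ h1
    simp [hz]
    linarith
  have haway : AwayFromNegative z := awayFromNegative_of_eventually
    (fun i => Or.inl (by linarith [hzre i])) (Eventually.of_forall fun i => by linarith [hzre i])
  have hs : ∀ x : ℝ, 1 < x → Summable fun i => ‖z i‖ ^ (-x) := by
    intro x hx
    obtain ⟨r, hr1, hrx⟩ := exists_between hx
    refine (hfam.summable_rpow hfd hf0 (by linarith) hrx (hgr r hr1)).congr fun i => ?_
    rw [norm_sub_rev]
  -- The sum is `-(log G)''(1/2 + y)`: the family used here has zeros `x_k - 1/2`, so `y - (x_k -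
  -- 1/2) = z i + y`.
  have hc : HasInvExpansion (fun y : ℝ => ∑' i, ((z i + y) ^ 2)⁻¹)
      (fun n => if n = 0 then a₁ else
        (-1) ^ (n - 1) * n * tracePoly a₁ a₀ a (n - 1) (1 / 2)) := by
    refine (hasInvExpansion_deriv_deriv_log hlog1 hasy).congr ?_
    filter_upwards [eventually_gt_atTop 0] with y hy
    have hre : 0 < (1 / 2 + y : ℂ).re := by simp; linarith
    have ho : ∀ᶠ w : ℂ in 𝓝 (y : ℂ), 0 < (1 / 2 + w).re :=
      (isOpen_lt continuous_const (by fun_prop) :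
        IsOpen {w : ℂ | 0 < (1 / 2 + w).re}).mem_nhds hre
    have h1 := hfam.hasSum_one_div_sub_sq hfd hf0 (r := 3 / 2) (by norm_num) (by norm_num)
      (hgr _ (by norm_num)) (z := y) (hne _ hre)
    have h2 : logDeriv f =ᶠ[𝓝 (y : ℂ)] fun w => deriv logG (1 / 2 + w) := by
      filter_upwards [ho] with w hw
      have ho' : ∀ᶠ u : ℂ in 𝓝 w, 0 < (1 / 2 + u).re :=
        (isOpen_lt continuous_const (by fun_prop) :
          IsOpen {w : ℂ | 0 < (1 / 2 + w).re}).mem_nhds hw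
      rw [logDeriv_eq_deriv_of_exp (g := fun u => logG (1 / 2 + u))
        ((hlog1 _ hw).comp_of_eq (f := fun u : ℂ => 1 / 2 + u) (by fun_prop) rfl)
        (ho'.mono fun u hu => (hlog _ hu).2), deriv_comp_const_add]
    rw [h2.deriv_eq, deriv_comp_const_add] at h1
    rw [← h1.tsum_eq]
    refine tsum_congr fun i => ?_
    rw [hz, one_div]
    ring_nf
  obtain ⟨Zt, h1, h2, h3, h4⟩ := exists_zeta_of_inv_sq haway hs hc
  refine ⟨Zt, fun s hs1 => ?_, h2, by simpa using h3, fun n => ?_⟩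
  -- Summing over the copies of each zero produces its multiplicity as a coefficient.
  · have h5 := (h1 s hs1).sigma (g := fun ξ : ℂ =>
      (analyticOrderNatAt G ξ : ℂ) * (1 / 2 - ξ) ^ (-s)) fun ξ => ?_
    · exact h5
    · have h6 := hasSum_fintype fun _ : Fin (analyticOrderNatAt G ξ) => (1 / 2 - ξ) ^ (-s)
      simpa [hz] using h6
  · have h5 : ((-1 : ℂ) ^ n) * (-1) ^ n = 1 := by rw [← mul_pow]; simp
    have h6 : (n : ℂ) + 1 ≠ 0 := Nat.cast_add_one_ne_zero n
    rw [h4, if_neg n.succ_ne_zero, Nat.add_sub_cancel]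
    push_cast
    field_simp
    linear_combination tracePoly a₁ a₀ a n (1 / 2) * h5

/-! ### The completed function and the expansion of `∑ (τ_k² + y²)⁻¹`. -/

/-- Applied to `Ξ` centred at `1/2`, this eliminates the unknown constant in the partial fraction
formula. -/
theorem logDeriv_zero_of_even {f : ℂ → ℂ} (h : ∀ z, f (-z) = f z) :
    logDeriv f 0 = 0 := by
  have h1 := deriv_comp_neg (f := f) (x := 0)
  rw [funext h, neg_zero] at h1
  rw [logDeriv_apply, self_eq_neg.1 h1, zero_div]

theorem logDeriv_completed {L G Ξ : ℂ → ℂ} {q : ℕ} (hL : IsPrimary L G Ξ q)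
    {logL logG : ℂ → ℂ} (hlogL : ∀ x : ℂ, 1 < x.re → AnalyticAt ℂ logL x ∧ exp (logL x) = L x)
    (hlogG : ∀ x : ℂ, 0 < x.re → AnalyticAt ℂ logG x ∧ exp (logG x) = G x) {x : ℂ}
    (hx : 1 < x.re) :
    logDeriv Ξ x = q * (x - 1)⁻¹ + deriv logL x - deriv logG x := by
  have ho : ∀ᶠ w : ℂ in 𝓝 x, 1 < w.re := (isOpen_lt continuous_const continuous_re).mem_nhds hx
  have hne : ∀ w : ℂ, 1 < w.re → w ≠ 1 := fun w hw h => by simp [h] at hw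
  have hx1 : x - 1 ≠ 0 := sub_ne_zero.2 (hne x hx)
  have hGx : G x ≠ 0 := fun h0 => by linarith [hL.zeros_G x h0]
  have hΞx : Ξ x ≠ 0 := fun h0 => by linarith [(hL.zeros_Xi x h0).2.1]
  have hLd : DifferentiableAt ℂ L x := (hL.analytic_off_one x (hne x hx)).differentiableAt
  have h1 : (fun w => G w * Ξ w) =ᶠ[𝓝 x] fun w => (w - 1) ^ q * L w := by
    filter_upwards [ho] with w hw using hL.factorization w (hne w hw)
  have h2 : logDeriv (fun w => G w * Ξ w) x = logDeriv (fun w => (w - 1) ^ q * L w) x := by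
    rw [logDeriv_apply, logDeriv_apply, h1.deriv_eq, h1.eq_of_nhds]
  rw [logDeriv_mul x hGx hΞx hL.entire_G.differentiableAt hL.entire_Xi.differentiableAt,
    logDeriv_mul (f := fun w => (w - 1) ^ q) x (pow_ne_zero _ hx1) (hL.ne_zero x hx) (by fun_prop) hLd,
    logDeriv_fun_pow (by fun_prop), logDeriv_eq_deriv_of_exp (hlogL x hx).1
      (ho.mono fun w hw => (hlogL w hw).2),
    logDeriv_eq_deriv_of_exp (hlogG x (by linarith)).1
      (ho.mono fun w hw => (hlogG w (by linarith)).2)] at h2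
  have h3 : logDeriv (fun w : ℂ => w - 1) x = (x - 1)⁻¹ := by
    rw [logDeriv_apply, deriv_sub_const, deriv_id'', one_div]
  rw [h3] at h2
  linear_combination h2

namespace IsZeroSequence

variable {Ξ : ℂ → ℂ} {τ : ℕ → ℂ}

theorem isZeroFamily (h : IsZeroSequence Ξ τ) :
    IsZeroFamily (fun z => Ξ (1 / 2 + z))
      (Sum.elim (fun k => I * τ k) fun k => -(I * τ k) : ℕ ⊕ ℕ → ℂ) := by
  have h1 : IsZeroFamily Ξ
      (Sum.elim (fun k => 1 / 2 + I * τ k) fun k => 1 / 2 - I * τ k : ℕ ⊕ ℕ → ℂ) := by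
    intro z
    have h2 : {i : ℕ ⊕ ℕ | (Sum.elim (fun k => 1 / 2 + I * τ k) fun k => 1 / 2 - I * τ k) i = z}
        = Sum.inl '' {k : ℕ | 1 / 2 + I * τ k = z} ∪ Sum.inr '' {k : ℕ | 1 / 2 - I * τ k = z} := by
      ext (k | k) <;> simp
    rw [h.multiplicity z, h2, Set.encard_union_eq, Sum.inl_injective.encard_image,
      Sum.inr_injective.encard_image]
    rw [Set.disjoint_left]
    rintro _ ⟨j, -, rfl⟩ ⟨k, -, hk⟩
    exact Sum.inr_ne_inl hk
  have h2 : (Sum.elim (fun k => I * τ k) fun k => -(I * τ k) : ℕ ⊕ ℕ → ℂ) = fun i =>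
      Sum.elim (fun k => 1 / 2 + I * τ k) (fun k => 1 / 2 - I * τ k) i - 1 / 2 := by
    funext i
    cases i <;> simp
  rw [h2]
  exact h1.comp_const_add (1 / 2)

/-- The real part of `1/2 + i τ_k` is `1/2 - Im τ_k`, and it lies between 0 and 1. -/
theorem abs_im_lt (h : IsZeroSequence Ξ τ) (hΞ : Differentiable ℂ Ξ)
    (hz : ∀ x : ℂ, Ξ x = 0 → 0 < x.re ∧ x.re < 1 ∧ x.im ≠ 0) (k : ℕ) : |(τ k).im| < 1 / 2 := by
  have h1 : Ξ (1 / 2 + I * τ k) = 0 := by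
    by_contra h0
    have h2 := (hΞ.analyticAt _).analyticOrderAt_eq_zero.2 h0
    rw [h.multiplicity, add_eq_zero, Set.encard_eq_zero] at h2
    exact (Set.eq_empty_iff_forall_notMem.1 h2.1 k) rfl
  have h2 := hz _ h1
  rw [abs_lt]
  simp at h2
  constructor <;> linarith

theorem sq_mem_slitPlane (h : IsZeroSequence Ξ τ) (k : ℕ) : τ k ^ 2 ∈ slitPlane := by
  have h0 := h.re_pos k
  by_cases hi : (τ k).im = 0
  · left
    simp only [sq, mul_re, hi]
    nlinarith
  · right
    simp only [sq, mul_im]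
    have : (τ k).re * (τ k).im ≠ 0 := mul_ne_zero h0.ne' hi
    intro h1
    apply this
    linarith

theorem summable_norm_sq_rpow (h : IsZeroSequence Ξ τ) (hΞ : Differentiable ℂ Ξ)
    (hord : HasGrowthOrder Ξ 1) (hz : ∀ x : ℂ, Ξ x = 0 → 0 < x.re ∧ x.re < 1 ∧ x.im ≠ 0)
    {x : ℝ} (hx : 1 / 2 < x) :
    Summable fun k => ‖τ k ^ 2‖ ^ (-x) := by
  have h0 : Ξ (1 / 2 + 0) ≠ 0 := fun h0 => (hz _ h0).2.2 (by simp)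
  obtain ⟨r, hr1, hrx⟩ := exists_between (show 1 < 2 * x by linarith)
  have h1 := (h.isZeroFamily.summable_rpow (by fun_prop) h0 (by linarith) hrx
    (hord.isBigO_comp_const_add hr1 _)).comp_injective Sum.inl_injective
  refine h1.congr fun k => ?_
  simp only [Function.comp, Sum.elim_inl, norm_mul, norm_I, one_mul, norm_pow]
  rw [← Real.rpow_natCast, ← Real.rpow_mul (norm_nonneg _)]
  norm_num

/-- `Re τ² = ‖τ‖² - 2 (Im τ)²`, where `Im τ` is bounded and `‖τ_k‖` tends to infinity. -/
theorem eventually_lt_re_sq (h : IsZeroSequence Ξ τ) (hΞ : Differentiable ℂ Ξ)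
    (hord : HasGrowthOrder Ξ 1) (hz : ∀ x : ℂ, Ξ x = 0 → 0 < x.re ∧ x.re < 1 ∧ x.im ≠ 0)
    (C : ℝ) : ∀ᶠ k in cofinite, C < (τ k ^ 2).re := by
  have h0 : Ξ (1 / 2 + 0) ≠ 0 := fun h0 => (hz _ h0).2.2 (by simp)
  have h1 := Sum.inl_injective.tendsto_cofinite.eventually
    (h.isZeroFamily.eventually_norm_ge (by fun_prop) h0 (by norm_num)
      (hord.isBigO_comp_const_add (show (1 : ℝ) < 2 by norm_num) _) (|C| + 1))
  filter_upwards [h1] with k hk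
  simp only [Sum.elim_inl, norm_mul, norm_I, one_mul] at hk
  have h2 := abs_lt.1 (h.abs_im_lt hΞ hz k)
  have h3 : ‖τ k‖ ^ 2 = (τ k).re ^ 2 + (τ k).im ^ 2 := by
    rw [← normSq_eq_norm_sq, normSq_apply]
    ring
  have h4 : (τ k ^ 2).re = (τ k).re ^ 2 - (τ k).im ^ 2 := by
    simp [sq]
  rw [h4]
  nlinarith [le_abs_self C, abs_nonneg C]

/-- Pairing the zeros `±iτ_k` cancels the compensating terms `1/ρ` and leaves `2y / (τ_k² + y²)`. -/
theorem hasSum_inv_sq_add (h : IsZeroSequence Ξ τ) (hΞ : Differentiable ℂ Ξ)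
    (hord : HasGrowthOrder Ξ 1) (hz : ∀ x : ℂ, Ξ x = 0 → 0 < x.re ∧ x.re < 1 ∧ x.im ≠ 0)
    (hfe : ∀ x : ℂ, Ξ x = Ξ (1 - x)) {y : ℝ} (hy : 0 < y) :
    HasSum (fun k => (τ k ^ 2 + (y : ℂ) ^ 2)⁻¹) ((2 * y : ℂ)⁻¹ * logDeriv Ξ (1 / 2 + y)) := by
  have h0 : ∀ y : ℝ, Ξ (1 / 2 + y) ≠ 0 := fun y h0 => (hz _ h0).2.2 (by simp)
  have h00 : Ξ (1 / 2 + 0) ≠ 0 := by simpa using h0 0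
  have hyc : (y : ℂ) ≠ 0 := ofReal_ne_zero.2 hy.ne'
  have h1 := h.isZeroFamily.hasSum_logDeriv (r := 3 / 2) (by fun_prop) h00 (by norm_num)
    (by norm_num) (hord.isBigO_comp_const_add (by norm_num) _) (h0 y)
  have h2 : logDeriv (fun z => Ξ (1 / 2 + z)) 0 = 0 := by
    refine logDeriv_zero_of_even fun z => ?_
    rw [hfe]
    ring_nf
  have h3 : logDeriv (fun z => Ξ (1 / 2 + z)) y = logDeriv Ξ (1 / 2 + y) := by
    rw [logDeriv_apply, deriv_comp_const_add, logDeriv_apply]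
  rw [h2, sub_zero, h3] at h1
  have hl := (h1.summable.comp_injective Sum.inl_injective).hasSum
  have hr := (h1.summable.comp_injective Sum.inr_injective).hasSum
  have h4 := (hl.add hr).mul_left (2 * y : ℂ)⁻¹
  rw [(HasSum.sum hl hr).unique h1] at h4
  refine h4.congr_fun fun k => ?_
  have hτ : τ k ≠ 0 := fun hτ => by simpa [hτ] using h.re_pos k
  have e1 := h.isZeroFamily.ne_zero (by fun_prop) (h0 y) (Sum.inl k)
  have e2 := h.isZeroFamily.ne_zero (by fun_prop) (h0 y) (Sum.inr k)
  simp only [Sum.elim_inl, Sum.elim_inr] at e1 e2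
  have e3 : (y : ℂ) - I * τ k ≠ 0 := sub_ne_zero.2 e1.symm
  have e4 : (y : ℂ) + I * τ k ≠ 0 := by simpa using sub_ne_zero.2 e2.symm
  have e5 : τ k ^ 2 + (y : ℂ) ^ 2 = (y - I * τ k) * (y + I * τ k) := by
    linear_combination τ k ^ 2 * I_sq
  simp only [Function.comp, Sum.elim_inl, Sum.elim_inr, sub_neg_eq_add]
  rw [e5]
  field_simp
  ring

end IsZeroSequence

/-- The inverse power expansion of `∑ (τ k ^ 2 + y ^ 2)⁻¹`. -/
theorem hasInvExpansion_inv_sq_add {L G Ξ : ℂ → ℂ} {q : ℕ} {τ : ℕ → ℂ} {a₁ b₁ a₀ b₀ : ℂ}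
    {a : ℕ → ℂ} (hL : IsPrimary L G Ξ q) (hτ : IsZeroSequence Ξ τ)
    (hG : HasStirlingExpansion G a₁ b₁ a₀ b₀ a) :
    HasInvExpansion
      (fun y : ℝ => ∑' k, (τ k ^ 2 + (y : ℂ) ^ 2)⁻¹ - a₁ / 2 * (Real.log y / y))
      (fun n => if n = 0 then b₁ / 2 else
        1 / 2 * ((-1) ^ n * tracePoly a₁ a₀ a (n - 1) (1 / 2) + q * (1 / 2) ^ (n - 1))) := by
  obtain ⟨logG, hlogG, hasy⟩ := hG
  obtain ⟨logL, hlogL, hdec⟩ := hL.log_decay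
  have e1 := hasInvExpansion_deriv_log (fun x hx => (hlogG x hx).1) hasy
  have e2 := (hasInvExpansion_inv_sub (1 / 2)).const_mul q
  have e3 : HasInvExpansion (fun y : ℝ => deriv logL (1 / 2 + y)) (fun _ => 0) := by
    refine HasInvExpansion.of_isBigO fun N => ?_
    have := isBigO_comp_half_add le_rfl (hdec 1 N)
    simpa [iteratedDeriv_one] using this
  -- Division by `2y` shifts the coefficients by one place; `b₁`, set aside in `e1`, returns as `b₁
  -- / (2y)` and fills the vacant place `n = 0`.
  have e4 := ((e1.add (e2.add e3)).inv_id_mul.const_mul (1 / 2)).add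
    (hasInvExpansion_inv.const_mul (b₁ / 2))
  convert e4.congr ?_ using 1
  · funext n
    cases n with
    | zero => simp
    | succ n => simp
  -- The bound `y > 1/2` puts `1/2 + y` in `Re x > 1`, where `log L` exists.
  · filter_upwards [eventually_gt_atTop (1 / 2)] with y hy
    have hy0 : 0 < y := by linarith
    have hyc : (y : ℂ) ≠ 0 := ofReal_ne_zero.2 hy0.ne'
    rw [(hτ.hasSum_inv_sq_add hL.entire_Xi hL.order_Xi hL.zeros_Xi hL.functional_equation
      hy0).tsum_eq, logDeriv_completed hL hlogL hlogG (by simp; linarith)]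
    have : (1 / 2 + y - 1 : ℂ) = y - 1 / 2 := by ring
    rw [this]
    have : (y - 1 / 2 : ℂ) ≠ 0 := by
      have : ((y - 1 / 2 : ℝ) : ℂ) ≠ 0 := ofReal_ne_zero.2 (by linarith)
      simpa using this
    field_simp
    ring

theorem sum_choose_mul_of_values {W Y : ℕ → ℂ} {q : ℂ}
    (hW : ∀ k, W k = 1 / 2 * ((-1) ^ k * (-Y k + q * (1 / 4) ^ k))) (m : ℕ) (v : ℂ) :
    ∑ l ∈ range (m + 1), (m.choose l : ℂ) * W (m - l) * v ^ l =
      1 / 2 * (-(∑ j ∈ range (m + 1), (m.choose j : ℂ) * (-1) ^ j * Y j * v ^ (m - j)) +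
        q * (v - 1 / 4) ^ m) := by
  rw [← sum_range_reflect, sub_eq_neg_add, add_pow, ← sum_neg_distrib, mul_sum, ← sum_add_distrib,
    mul_sum]
  refine sum_congr rfl fun j hj => ?_
  have hjm : j ≤ m := Nat.lt_succ_iff.1 (mem_range.1 hj)
  have h1 : m + 1 - 1 - j = m - j := by omega
  have h2 : m - (m - j) = j := by omega
  rw [h1, h2, Nat.choose_symm hjm, hW, neg_pow (1 / 4 : ℂ)]
  ring

theorem tracePoly_zero (a₁ a₀ : ℂ) (a : ℕ → ℂ) :
    tracePoly a₁ a₀ a 0 (1 / 2) = -(1 / 2 * a₁) - a₀ := by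
  simp [tracePoly]
  ring

end

theorem mainTheorem6 (L G Ξ : ℂ → ℂ) (q : ℕ) (τ : ℕ → ℂ)
    (a₁ b₁ a₀ b₀ : ℂ) (a : ℕ → ℂ)
    (hL : IsPrimary L G Ξ q) (hτ : IsZeroSequence Ξ τ)
    (hG : HasStirlingExpansion G a₁ b₁ a₀ b₀ a) :
    ∃ (Zt : ℂ → ℂ) (Z : ℂ → ℂ → ℂ),
      -- the zeta function over the trivial zeros at `x = 1/2`: continuation, pole, values
      (IsShadowZeta G (1 / 2) Zt ∧
        (fun s => Zt s - a₁ / (s - 1)) =O[𝓝[≠] 1] (fun _ => (1 : ℝ)) ∧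
        ∀ n : ℕ, Zt (-n) = tracePoly a₁ a₀ a n (1 / 2)) ∧
      -- meromorphic continuation of `Z σ v`
      (∀ v : ℂ, (∀ k, τ k ^ 2 + v ∈ slitPlane) → IsSecondZeta τ v (fun σ => Z σ v)) ∧
      -- expansion around `v = 0`
      (∀ v : ℂ, (∀ k, ‖v‖ < ‖τ k‖ ^ 2) →
        (∀ t : ℝ, 0 ≤ t → t ≤ 1 → ∀ k, τ k ^ 2 + t * v ∈ slitPlane) →
        (∀ σ : ℂ, 1 / 2 < σ.re →
          HasSum (fun k => (τ k ^ 2) ^ (-σ) * (1 + v / τ k ^ 2) ^ (-σ)) (Z σ v)) ∧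
        ∀ σ : ℂ, (∀ m : ℕ, σ ≠ 1 / 2 - m) →
          HasSum (fun l : ℕ => Ring.choose (-σ) l * Z (σ + l) 0 * v ^ l) (Z σ v)) ∧
      -- polar parts, special values
      (∀ v : ℂ, (∀ k, τ k ^ 2 + v ∈ slitPlane) →
        (∀ m : ℕ,
          (fun ε => Z (-m + 1 / 2 + ε) v -
            (a₁ / (4 * Real.pi) * (Gamma (m + 1 / 2) / (m.factorial * Gamma (1 / 2))) * v ^ m / ε ^ 2
              + residuePoly a₁ b₁ q Zt m v / ε)) =O[𝓝[≠] 0] (fun _ => (1 : ℝ))) ∧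
        (∀ m : ℕ, a₁ ≠ 0 → (m = 0 ∨ v ≠ 0) →
          meromorphicOrderAt (fun σ => Z σ v) (1 / 2 - m) = ((-2 : ℤ) : WithTop ℤ)) ∧
        (∀ m : ℕ, Z (-m) v =
          ∑ l ∈ Finset.range (m + 1), (m.choose l : ℂ) * Z (-m + l) 0 * v ^ l) ∧
        (∀ m : ℕ, Z (-m) v = 1 / 2 * (-(∑ j ∈ Finset.range (m + 1),
            (m.choose j : ℂ) * (-1) ^ j * Zt (-(2 * j : ℕ)) * v ^ (m - j))
              + q * (v - 1 / 4) ^ m)) ∧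
        Z 0 v = 1 / 2 * (-Zt 0 + q) ∧
        Z 0 v = 1 / 2 * (1 / 2 * a₁ + a₀ + q)) := by
  have hpi : (Real.pi : ℂ) ≠ 0 := ofReal_ne_zero.2 Real.pi_ne_zero
  obtain ⟨Zt, hZt1, hZt2, hZt3, hZt4⟩ :=
    exists_shadowZeta hL.entire_G hL.order_G hL.zeros_G hG
  have hs : ∀ x : ℝ, 1 / 2 < x → Summable fun k => ‖τ k ^ 2‖ ^ (-x) := fun x hx =>
    hτ.summable_norm_sq_rpow hL.entire_Xi hL.order_Xi hL.zeros_Xi hx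
  have hre := hτ.eventually_lt_re_sq hL.entire_Xi hL.order_Xi hL.zeros_Xi
  have hz : ∀ k, τ k ^ 2 ≠ 0 := fun k => slitPlane_ne_zero (hτ.sq_mem_slitPlane k)
  obtain ⟨Z, hZ1, hZ2, hZ3, hZ4⟩ := exists_zeta_of_inv
    (awayFromNegative_of_eventually hτ.sq_mem_slitPlane ((hre 0).mono fun k hk => hk.le)) hs
    (hasInvExpansion_inv_sq_add hL hτ hG)
  set A : ℂ := a₁ / (4 * Real.pi) with hA
  have hZ3' : ∀ m : ℕ, HasPolarPart Z (1 / 2 - m) (if m = 0 then A else 0) _ := fun m => by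
    have h1 := hZ3 m
    rwa [show a₁ / 2 / (2 * Real.pi) = A by rw [hA]; field_simp; norm_num] at h1
  -- The residues of the unshifted function come from the even coefficients: index 0 carries `b₁`,
  -- and index `2m` the trace value `𝐙(1 - 2m, 1/2)`.
  have hB : ∀ m v, residuePoly a₁ b₁ q Zt m v = _ := fun m v =>
    residuePoly_eq (B := fun m => (-1) ^ m * (if 2 * m = 0 then b₁ / 2 else
      1 / 2 * ((-1) ^ (2 * m) * tracePoly a₁ a₀ a (2 * m - 1) (1 / 2) +
        q * (1 / 2) ^ (2 * m - 1))) / Real.pi)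
      (by simp; field_simp) (fun j hj => by
        have h1 : (1 - 2 * j : ℂ) = -((2 * j - 1 : ℕ) : ℂ) := by
          rw [Nat.cast_sub (by omega)]
          push_cast
          ring
        have h2 : (2 : ℂ) ^ (1 - 2 * (j : ℤ)) = (1 / 2) ^ (2 * j - 1) := by
          have h3 : 1 - 2 * (j : ℤ) = -((2 * j - 1 : ℕ) : ℤ) := by omega
          rw [h3, zpow_neg, zpow_natCast, one_div, inv_pow]
        rw [if_neg (by omega), basicResidue, h1, hZt4, h2, pow_mul]
        simp
        field_simp) m v
  -- The odd coefficient of index `2m + 1` carries the trace value `𝐙(-2m, 1/2)`, with the sign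
  -- `(-1)^(2m+1) = -1`.
  have hval : ∀ m : ℕ, Z (-m) =
      1 / 2 * ((-1) ^ m * (-Zt (-(2 * m : ℕ)) + q * (1 / 4) ^ m)) := by
    intro m
    rw [hZ4, if_neg (by omega), Nat.add_sub_cancel, hZt4, pow_succ, pow_mul, pow_mul]
    norm_num
    ring
  have hZ0 : ∀ s, shiftZeta (fun k => τ k ^ 2) Z 0 s = Z s := shiftZeta_zero hz hs hre hZ1
  have hpol : ∀ v : ℂ, (∀ k, τ k ^ 2 + v ∈ slitPlane) → ∀ m : ℕ,
      HasPolarPart (shiftZeta (fun k => τ k ^ 2) Z v) (1 / 2 - m)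
        (A * (Gamma (m + 1 / 2) / (m.factorial * Gamma (1 / 2))) * v ^ m)
        (residuePoly a₁ b₁ q Zt m v) := by
    intro v hv m
    have h1 := hasPolarPart_shiftZeta hz (fun k => slitPlane_ne_zero (hv k)) hs hre hZ1 hZ3' m
    rw [hB]
    convert h1 using 1
    rw [ring_choose_sub_half, show (m : ℂ) + 1 / 2 - m = 1 / 2 by ring]
    ring
  have hneg : ∀ v : ℂ, (∀ k, τ k ^ 2 + v ∈ slitPlane) → ∀ m : ℕ,
      shiftZeta (fun k => τ k ^ 2) Z v (-m) = 1 / 2 * (-(∑ j ∈ range (m + 1),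
        (m.choose j : ℂ) * (-1) ^ j * Zt (-(2 * j : ℕ)) * v ^ (m - j)) + q * (v - 1 / 4) ^ m) := by
    intro v hv m
    rw [shiftZeta_neg_natCast hz (fun k => slitPlane_ne_zero (hv k)) hs hre hZ1,
      ← sum_choose_mul_of_values (W := fun k => Z (-k)) (Y := fun j => Zt (-(2 * j : ℕ))) hval]
    refine sum_congr rfl fun l hl => ?_
    rw [Nat.cast_sub (Nat.lt_succ_iff.1 (mem_range.1 hl)), neg_sub, sub_eq_neg_add]
  have hzero : ∀ v : ℂ, (∀ k, τ k ^ 2 + v ∈ slitPlane) →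
      shiftZeta (fun k => τ k ^ 2) Z v 0 = 1 / 2 * (-Zt 0 + q) := by
    intro v hv
    simpa using hneg v hv 0
  -- One formula serves every `v`, including `v = 0`, where `hZ0` identifies it with `Z` even at the
  -- poles.
  refine ⟨Zt, fun σ v => shiftZeta (fun k => τ k ^ 2) Z v σ, ⟨⟨hZt1, fun s => ?_, hZt2⟩, ?_, hZt4⟩,
    fun v hv => ?_, fun v hv hseg => ?_, fun v hv => ?_⟩
  · by_cases h1 : s = 1
    · rw [h1]
      exact hZt3.meromorphicAt
    · exact (hZt2 s h1).meromorphicAt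
  · simpa using hZt3.isBigO
  · have hzv : ∀ k, τ k ^ 2 + v ≠ 0 := fun k => slitPlane_ne_zero (hv k)
    have han : ∀ σ : ℂ, (∀ m : ℕ, σ ≠ 1 / 2 - m) →
        AnalyticAt ℂ (shiftZeta (fun k => τ k ^ 2) Z v) σ := fun σ hσ =>
      analyticAt_shiftZeta hz hzv hs hre hZ1 hZ2 hσ
    refine ⟨fun σ hσ => hasSum_shiftZeta hz hzv hs hre hZ1 hσ, fun σ => ?_, han⟩
    by_cases h1 : ∀ m : ℕ, σ ≠ 1 / 2 - m
    · exact (han σ h1).meromorphicAt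
    · push Not at h1
      obtain ⟨m, rfl⟩ := h1
      exact (hpol v hv m).meromorphicAt
  · have hv' : ∀ k, ‖v‖ < ‖τ k ^ 2‖ := fun k => by simpa using hv k
    refine ⟨fun σ hσ => ?_, fun σ _ => ?_⟩
    · have h1 := hasSum_shiftZeta hz (fun k => slitPlane_ne_zero
        (by simpa using hseg 1 zero_le_one le_rfl k)) hs hre hZ1 hσ
      refine h1.congr_fun fun k => ?_
      rw [cpow_add_eq (hv' k) fun t h0 h1 => hseg t h0 h1 k]
    · simp only [hZ0]
      exact hasSum_shiftZeta_pow hs hre hZ1 hv' hseg σ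
  · refine ⟨fun m => ?_, fun m ha hmv => ?_, fun m => ?_, hneg v hv, hzero v hv, ?_⟩
    · have h1 := (hpol v hv m).isBigO_add
      rwa [show (1 / 2 - m : ℂ) = -m + 1 / 2 by ring] at h1
    · refine (hpol v hv m).meromorphicOrderAt_eq ?_
      have h1 : v ^ m ≠ 0 := by
        rcases hmv with rfl | h
        · simp
        · exact pow_ne_zero m h
      have h2 : Gamma (m + 1 / 2) ≠ 0 := Gamma_ne_zero_of_re_pos (by simp; positivity)
      have h3 : Gamma (1 / 2) ≠ 0 := Gamma_ne_zero_of_re_pos (by simp)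
      have h4 : (m.factorial : ℂ) ≠ 0 := by exact_mod_cast m.factorial_ne_zero
      have h5 : A ≠ 0 := div_ne_zero ha (mul_ne_zero (by norm_num) hpi)
      positivity
    · simp only [hZ0]
      exact shiftZeta_neg_natCast hz (fun k => slitPlane_ne_zero (hv k)) hs hre hZ1 m
    · have h1 := hZt4 0
      rw [Nat.cast_zero, neg_zero, tracePoly_zero] at h1
      simp only [hzero v hv, h1]
      ring
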